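/- Let $M$ be a smooth manifold (finite-dimensional, Hausdorff, $\sigma$-compact) and let $\zeta:\mathbf Z\to M$ be an AV-bundle, i.e. a smooth one-dimensional affine bundle modelled on the trivial line bundle $M\times\mathbb R$. For a section $\sigma$ of $\mathbf Z$ let $F_\sigma:\mathbf Z\to\mathbb R$, $F_\sigma(z)=\sigma(\zeta(z))-z$. Let $P\mathbf Z\to M$ be the affine bundle of affine differentials $\mathbf d\sigma(m)$ (classes of sections $\sigma$ modulo $d(\sigma-\tau)(m)=0$), modelled on $T^*M$, and let $C\mathbf Z\to M$ be the affine bundle of first jets $\mathbf c\sigma(m)$ of sections of $\mathbf Z$, modelled on $T^*M\times\mathbb R$. Let $\overline{T}\mathbf Z$ and $\overline{L}\mathbf Z$ be the special affine bundles over $M$ with fibres $\mathrm{Aff}(P_m\mathbf Z,\mathbf Z_m)$ and $\mathrm{Aff}(C_m\mathbf Z,\mathbf Z_m)$, modelled on the vector bundles $\mathrm{Aff}(P\mathbf Z,\mathbb R)$ and $\mathrm{Aff}(C\mathbf Z,\mathbb R)$ with the distinguished section $1$. A section $D$ of $\overline{T}\mathbf Z$ (of $\overline{L}\mathbf Z$)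 acts on sections of $\mathbf Z$ as an affine derivation $D(\sigma)(m)=D_m(\mathbf d\sigma(m))$ (as an affine first-order differential operator $D(\sigma)(m)=D_m(\mathbf c\sigma(m))$). Let $X_{\mathbf Z}$ be the fundamental vector field of $\mathbf Z$, the vertical field with $X_{\mathbf Z}(F_\sigma)=1$. Let $\breve{L}\mathbf Z$ be the vector bundle over $M$ whose fibre at $m$ consists of the fields, along $\mathbf Z_m$, of vectors tangent to $\mathbf Z$ of the form $Y+\varphi X_{\mathbf Z}$ with $Y$ invariant under the translations $z\mapsto t+z$ and $\varphi$ an affine function on $\mathbf Z_m$, and let $R\mathbf Z=\breve{L}\mathbf Z\oplus(M\times\mathbb R)$. Sections of $\breve{L}\mathbf Z$ are vector fields on $\mathbf Z$, and a section $(X,h)$ of $R\mathbf Z$ is the first-order differential operator $f\mapsto X(f)+(h\circ\zeta)f$ on $C^\infty(\mathbf Z)$. A Lie affgebroid structure on an affine bundle $A\to M$ modelled on $V$ is a skew-symmetric bi-affine bracket $\mathrm{Sec}(A)\times\mathrm{Sec}(A)\to\mathrm{Sec}(V)$ such that, with $[\sigma,\cdot]_v:\mathrm{Sec}(V)\to\mathrm{Sec}(V)$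 the linear part of $[\sigma,\cdot]$, one has $[\sigma_1,[\sigma_2,\sigma_3]]_v+[\sigma_2,[\sigma_3,\sigma_1]]_v+[\sigma_3,[\sigma_1,\sigma_2]]_v=0$, together with a morphism $\gamma:A\to TM$ of affine bundles over the identity such that $[\sigma,fX]_v=f[\sigma,X]_v+\gamma(\sigma)(f)X$. A Lie algebroid $K$ is the Lie algebroid hull of $A$ if $A$ is embedded in $K$ as an affine hyperbundle $\{\phi=1\}$ (so that $K$ is the vector hull of $A$), the bracket and the anchor of $K$ extend those of $A$, and the 1-form $\phi$ is closed: $\phi([S,T])=\rho(S)(\phi(T))-\rho(T)(\phi(S))$, where $\rho$ is the anchor of $K$. Theorem. The commutators $[D,D']=D\circ D'-D'\circ D$ (differences of sections of $\mathbf Z$, hence functions on $M$) are the brackets of Lie affgebroid structures on $\overline{T}\mathbf Z$ and on $\overline{L}\mathbf Z$, with anchors the principal symbols: $\langle\eta,\gamma(D)\rangle$ is the value of the linear part of $D$ on $\eta\in T^*_mM$, respectively on $(\eta,0)\in T_m^*M\times\mathbb R$. The commutators of operators on $C^\infty(\mathbf Z)$ make $\breve{L}\mathbf Z$ and $R\mathbf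 Z$ into Lie algebroids, with anchors induced by $T\zeta$. There are embeddings $j:\overline{T}\mathbf Z\to\breve{L}\mathbf Z$ and $j:\overline{L}\mathbf Z\to R\mathbf Z$ with $j(D)(F_\sigma)=F_{D(\sigma)}$ for all sections $\sigma$ of $\mathbf Z$, and by means of them $\breve{L}\mathbf Z$ is the Lie algebroid hull of $\overline{T}\mathbf Z$ and $R\mathbf Z$ is the Lie algebroid hull of $\overline{L}\mathbf Z$. -/

import Mathlib

open scoped Manifold ContDiff Bundle
open Bundle
noncomputable section

/-- An AV-bundle: a smooth one-dimensional affine bundle `proj : Z → M` modelled on the trivial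
line bundle `M × ℝ`. The affine structure is the addition `t +ᵥ z` of a real number to a point of a
fibre; it is smooth, preserves the fibres, is free, and `Z` has local trivializations
`z = τ z +ᵥ s (proj z)` given by local smooth sections `s` and smooth functions `τ`. -/
structure AVBundle (E M EZ Z : Type*)
    [NormedAddCommGroup E] [NormedSpace ℝ E] [TopologicalSpace M] [ChartedSpace E M]
    [NormedAddCommGroup EZ] [NormedSpace ℝ EZ] [TopologicalSpace Z] [ChartedSpace EZ Z]
    [AddAction ℝ Z] where
  proj : Z → M
  contMDiff_proj : ContMDiff 𝓘(ℝ, EZ) 𝓘(ℝ, E) ∞ proj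
  contMDiff_vadd :
    ContMDiff (𝓘(ℝ, ℝ).prod 𝓘(ℝ, EZ)) 𝓘(ℝ, EZ) ∞ (fun p : ℝ × Z => p.1 +ᵥ p.2)
  proj_vadd : ∀ (t : ℝ) (z : Z), proj (t +ᵥ z) = proj z
  vadd_free : ∀ (t : ℝ) (z : Z), t +ᵥ z = z → t = 0
  exists_localTriv : ∀ m : M, ∃ U : Set M, IsOpen U ∧ m ∈ U ∧ ∃ (s : M → Z) (τ : Z → ℝ),
    ContMDiffOn 𝓘(ℝ, E) 𝓘(ℝ, EZ) ∞ s U ∧ ContMDiffOn 𝓘(ℝ, EZ) 𝓘(ℝ, ℝ) ∞ τ (proj ⁻¹' U) ∧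
    (∀ x ∈ U, proj (s x) = x) ∧ ∀ z, proj z ∈ U → z = τ z +ᵥ s (proj z)

section Diff
variable {E M : Type*} [NormedAddCommGroup E] [NormedSpace ℝ E]
  [TopologicalSpace M] [ChartedSpace E M]

/-- The cotangent space at `m`. -/
abbrev Cotangent (E : Type*) {M : Type*} [NormedAddCommGroup E] [NormedSpace ℝ E]
    [TopologicalSpace M] [ChartedSpace E M] (m : M) : Type _ :=
  TangentSpace 𝓘(ℝ, E) m →L[ℝ] ℝ

/-- The differential `df(m)` of a real function. -/
def diffAt (E : Type*) {M : Type*} [NormedAddCommGroup E] [NormedSpace ℝ E]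
    [TopologicalSpace M] [ChartedSpace E M] (f : M → ℝ) (m : M) : Cotangent E m :=
  mfderiv 𝓘(ℝ, E) 𝓘(ℝ, ℝ) f m

theorem diffAt_congr {f g : M → ℝ} {m : M} (h : f =ᶠ[nhds m] g) : diffAt E f m = diffAt E g m :=
  h.mfderiv_eq

theorem diffAt_const (c : ℝ) (m : M) : diffAt E (fun _ : M => c) m = 0 :=
  mfderiv_const

theorem diffAt_sub {f g : M → ℝ} {m : M} (hf : MDifferentiableAt 𝓘(ℝ, E) 𝓘(ℝ, ℝ) f m)
    (hg : MDifferentiableAt 𝓘(ℝ, E) 𝓘(ℝ, ℝ) g m) :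
    diffAt E (fun x => f x - g x) m = diffAt E f m - diffAt E g m :=
  mfderiv_sub hf hg

theorem diffAt_add {f g : M → ℝ} {m : M} (hf : MDifferentiableAt 𝓘(ℝ, E) 𝓘(ℝ, ℝ) f m)
    (hg : MDifferentiableAt 𝓘(ℝ, E) 𝓘(ℝ, ℝ) g m) :
    diffAt E (fun x => f x + g x) m = diffAt E f m + diffAt E g m :=
  mfderiv_add hf hg

variable [IsManifold 𝓘(ℝ, E) ∞ M]

theorem diffAt_comp_symmL {f : M → ℝ} (hf : ContMDiff 𝓘(ℝ, E) 𝓘(ℝ, ℝ) ∞ f) (x₀ : M) :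
    ContMDiffOn 𝓘(ℝ, E) 𝓘(ℝ, E →L[ℝ] ℝ) ∞
      (fun m => (diffAt E f m).comp
        ((trivializationAt E (TangentSpace 𝓘(ℝ, E)) x₀).symmL ℝ m))
      (trivializationAt E (TangentSpace 𝓘(ℝ, E) (M := M)) x₀).baseSet := by
  intro x hx
  have h1 := (hf x).mfderiv_const (m := ∞) (by simp)
  have h2 := contMDiffAt_coordChangeL (IB := 𝓘(ℝ, E)) (n := ∞)
    (e := trivializationAt E (TangentSpace 𝓘(ℝ, E) (M := M)) x₀)
    (e' := trivializationAt E (TangentSpace 𝓘(ℝ, E) (M := M)) x) hx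
    (FiberBundle.mem_baseSet_trivializationAt' x)
  refine ((h1.clm_comp h2).congr_of_eventuallyEq ?_).contMDiffWithinAt
  filter_upwards [(trivializationAt E (TangentSpace 𝓘(ℝ, E) (M := M)) x₀).open_baseSet.mem_nhds hx,
    (trivializationAt E (TangentSpace 𝓘(ℝ, E) (M := M)) x).open_baseSet.mem_nhds
      (FiberBundle.mem_baseSet_trivializationAt' x)] with m hm hm'
  ext v
  have h3 : (trivializationAt E (TangentSpace 𝓘(ℝ, E) (M := M)) x).symmL ℝ m
      ((trivializationAt E (TangentSpace 𝓘(ℝ, E) (M := M)) x₀).coordChangeL ℝ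
        (trivializationAt E (TangentSpace 𝓘(ℝ, E) (M := M)) x) m v) =
      (trivializationAt E (TangentSpace 𝓘(ℝ, E) (M := M)) x₀).symmL ℝ m v := by
    rw [Trivialization.coordChangeL_apply _ _ ⟨hm, hm'⟩, ← Trivialization.symmL_apply (R := ℝ) _ hm,
      ← Trivialization.continuousLinearMapAt_apply_of_mem (R := ℝ) _ hm',
      Trivialization.symmL_continuousLinearMapAt _ hm']
  simp only [inTangentCoordinates, ContinuousLinearMap.inCoordinates,
    ContinuousLinearMap.comp_apply, ContinuousLinearEquiv.coe_coe, id, h3]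
  simp [diffAt]
  rfl
variable [FiniteDimensional ℝ E] [T2Space M]

theorem exists_contMDiff_diffAt_eq_aux (m : M) (η : E →L[ℝ] ℝ) (c : ℝ) :
    ∃ f : M → ℝ, ContMDiff 𝓘(ℝ, E) 𝓘(ℝ, ℝ) ∞ f ∧ diffAt E f m = η ∧ f m = c := by
  obtain ⟨b⟩ : Nonempty (SmoothBumpFunction 𝓘(ℝ, E) m) := inferInstance
  let y₀ : E := extChartAt 𝓘(ℝ, E) m m
  let h : E → ℝ := fun y => c + η (y - y₀)
  let g : M → ℝ := fun x => h (extChartAt 𝓘(ℝ, E) m x)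
  have hg : ContMDiffOn 𝓘(ℝ, E) 𝓘(ℝ, ℝ) ∞ g (chartAt E m).source := by
    have h1 : ContMDiffOn 𝓘(ℝ, E) 𝓘(ℝ, E) ∞ (extChartAt 𝓘(ℝ, E) m) (chartAt E m).source :=
      contMDiffOn_extChartAt
    have h2 : ContMDiff 𝓘(ℝ, E) 𝓘(ℝ, ℝ) ∞ h :=
      (contDiff_const.add (η.contDiff.comp (contDiff_id.sub contDiff_const))).contMDiff
    exact h2.comp_contMDiffOn h1
  refine ⟨fun x => b x • g x, b.contMDiff_smul hg, ?_, ?_⟩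
  · have h1 : (fun x => b x • g x) =ᶠ[nhds m] g := by
      filter_upwards [b.eventuallyEq_one] with x hx
      simp [hx]
    rw [diffAt_congr h1]
    have hd : HasMFDerivAt 𝓘(ℝ, E) 𝓘(ℝ, ℝ) g m η := by
      refine ⟨(hg.contMDiffAt
        ((chartAt E m).open_source.mem_nhds (mem_chart_source E m))).continuousAt, ?_⟩
      have h2 : HasFDerivAt h η y₀ := by
        simpa [h] using
          ((η.hasFDerivAt (x := y₀)).sub_const (η y₀)).const_add c
      refine (h2.hasFDerivWithinAt (s := Set.range 𝓘(ℝ, E))).congr_of_eventuallyEq ?_ ?_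
      · filter_upwards [extChartAt_target_mem_nhdsWithin (I := 𝓘(ℝ, E)) m] with y hy
        simp only [writtenInExtChartAt, g, Function.comp]
        rw [(extChartAt 𝓘(ℝ, E) m).right_inv hy]
        rfl
      · simp only [writtenInExtChartAt, g, Function.comp]
        rw [extChartAt_to_inv]
        rfl
    exact hd.mfderiv
  · simp [g, h, y₀]

theorem exists_contMDiff_diffAt_eq (m : M) (η : Cotangent E m) (c : ℝ) :
    ∃ f : M → ℝ, ContMDiff 𝓘(ℝ, E) 𝓘(ℝ, ℝ) ∞ f ∧ diffAt E f m = η ∧ f m = c :=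
  exists_contMDiff_diffAt_eq_aux (E := E) m η c

end Diff

/-- Fibrewise linear charts `V m ≃ T_m M × W` of a family of vector spaces `V m`, with smooth
transition functions of the form `(v, w) ↦ (v, C w + B v)`. They make `V` a smooth vector bundle
with standard fibre `E × W`. -/
structure ChartFamily (E : Type*) {M : Type*} [NormedAddCommGroup E] [NormedSpace ℝ E]
    [TopologicalSpace M] [ChartedSpace E M] [IsManifold 𝓘(ℝ, E) ∞ M]
    (ι W : Type*) [NormedAddCommGroup W] [NormedSpace ℝ W] (V : M → Type*)
    [∀ m, AddCommGroup (V m)] [∀ m, Module ℝ (V m)] where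
  chart : ι → ∀ m, V m ≃ₗ[ℝ] TangentSpace 𝓘(ℝ, E) m × W
  exists_transition : ∀ i j, ∃ (B : ∀ m : M, TangentSpace 𝓘(ℝ, E) m →L[ℝ] W) (C : M → W →L[ℝ] W),
    (∀ x₀ : M, ContMDiffOn 𝓘(ℝ, E) 𝓘(ℝ, E →L[ℝ] W) ∞
      (fun m => (B m).comp ((trivializationAt E (TangentSpace 𝓘(ℝ, E)) x₀).symmL ℝ m))
      (trivializationAt E (TangentSpace 𝓘(ℝ, E) (M := M)) x₀).baseSet) ∧
    ContMDiff 𝓘(ℝ, E) 𝓘(ℝ, W →L[ℝ] W) ∞ C ∧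
    ∀ m v, chart j m v = ((chart i m v).1, C m (chart i m v).2 + B m (chart i m v).1)

namespace ChartFamily
variable {E M : Type*} [NormedAddCommGroup E] [NormedSpace ℝ E]
  [TopologicalSpace M] [ChartedSpace E M] [IsManifold 𝓘(ℝ, E) ∞ M]
  {ι W : Type*} [NormedAddCommGroup W] [NormedSpace ℝ W] {V : M → Type*}
  [∀ m, AddCommGroup (V m)] [∀ m, Module ℝ (V m)] (c : ChartFamily E ι W V)

local notation "tTriv" => trivializationAt E (TangentSpace 𝓘(ℝ, E) (M := M))

/-- The local trivialization given by a chart and the trivialization of the tangent bundle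
at `x₀`. -/
def pretriv (x₀ : M) (i : ι) : Pretrivialization (E × W) (π (E × W) V) where
  toFun p := (p.1, ((tTriv x₀).continuousLinearMapAt ℝ p.1 (c.chart i p.1 p.2).1,
    (c.chart i p.1 p.2).2))
  invFun q := ⟨q.1, (c.chart i q.1).symm ((tTriv x₀).symmL ℝ q.1 q.2.1, q.2.2)⟩
  source := π (E × W) V ⁻¹' (tTriv x₀).baseSet
  target := (tTriv x₀).baseSet ×ˢ Set.univ
  baseSet := (tTriv x₀).baseSet
  map_source' p hp := ⟨hp, trivial⟩
  map_target' q hq := hq.1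
  left_inv' p hp := by
    obtain ⟨m, v⟩ := p
    have hm : m ∈ (tTriv x₀).baseSet := hp
    congr 1
    simp only [(tTriv x₀).symmL_continuousLinearMapAt hm]
    exact (c.chart i m).symm_apply_apply v
  right_inv' q hq := by
    obtain ⟨m, a, w⟩ := q
    have hm : m ∈ (tTriv x₀).baseSet := hq.1
    simp [(tTriv x₀).continuousLinearMapAt_symmL hm]
  open_target := (tTriv x₀).open_baseSet.prod isOpen_univ
  open_baseSet := (tTriv x₀).open_baseSet
  source_eq := rfl
  target_eq := rfl
  proj_toFun _ _ := rfl

/-- The vector space topology of the fibres. -/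
@[reducible] def fiberTopology [Nonempty ι] (m : M) : TopologicalSpace (V m) :=
  TopologicalSpace.induced (fun v => c.pretriv m (Classical.arbitrary ι) ⟨m, v⟩) inferInstance

theorem pretriv_apply (x₀ : M) (i : ι) (m : M) (v : V m) : c.pretriv x₀ i ⟨m, v⟩ =
    (m, ((tTriv x₀).continuousLinearMapAt ℝ m (c.chart i m v).1, (c.chart i m v).2)) := rfl

theorem pretriv_symm (x₀ : M) (i : ι) {m : M} (hm : m ∈ (tTriv x₀).baseSet) (q : E × W) :
    (c.pretriv x₀ i).symm m q = (c.chart i m).symm ((tTriv x₀).symmL ℝ m q.1, q.2) := by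
  rw [Pretrivialization.symm_apply (c.pretriv x₀ i) hm]
  rfl

theorem exists_coordChange (x₀ : M) (i : ι) (x₁ : M) (j : ι) : ∃ f : M → E × W →L[ℝ] E × W,
    ContMDiffOn 𝓘(ℝ, E) 𝓘(ℝ, E × W →L[ℝ] E × W) ∞ f
      ((tTriv x₀).baseSet ∩ (tTriv x₁).baseSet) ∧
    ∀ b ∈ (tTriv x₀).baseSet ∩ (tTriv x₁).baseSet, ∀ v,
      f b v = (c.pretriv x₁ j ⟨b, (c.pretriv x₀ i).symm b v⟩).2 := by
  obtain ⟨B, C, hB, hC, h⟩ := c.exists_transition i j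
  let p1 : E × W →L[ℝ] E := ContinuousLinearMap.fst ℝ E W
  let p2 : E × W →L[ℝ] W := ContinuousLinearMap.snd ℝ E W
  let i1 : E →L[ℝ] E × W := ContinuousLinearMap.inl ℝ E W
  let i2 : W →L[ℝ] E × W := ContinuousLinearMap.inr ℝ E W
  refine ⟨fun m => i1.comp (((tTriv x₀).coordChangeL ℝ (tTriv x₁) m : E →L[ℝ] E).comp p1) +
    i2.comp ((C m).comp p2 + ((B m).comp ((tTriv x₀).symmL ℝ m)).comp p1), ?_, ?_⟩
  · refine ContMDiffOn.add (contMDiffOn_const.clm_comp (ContMDiffOn.clm_comp ?_ contMDiffOn_const))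
      (contMDiffOn_const.clm_comp (ContMDiffOn.add (hC.contMDiffOn.clm_comp contMDiffOn_const)
        (ContMDiffOn.clm_comp ((hB x₀).mono Set.inter_subset_left) contMDiffOn_const)))
    exact contMDiffOn_coordChangeL _ _
  · intro b hb v
    rw [pretriv_symm c x₀ i hb.1, pretriv_apply, h, LinearEquiv.apply_symm_apply]
    simp [p1, p2, i1, i2, Trivialization.coordChangeL_apply _ _ hb,
      Trivialization.continuousLinearMapAt_apply_of_mem (R := ℝ) _ hb.2,
      Trivialization.symmL_apply (R := ℝ) _ hb.1]

/-- The vector bundle structure defined by the charts. -/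
def prebundle [Nonempty ι] : letI := c.fiberTopology; VectorPrebundle ℝ (E × W) V :=
  letI := c.fiberTopology
  { pretrivializationAtlas := Set.range fun p : M × ι => c.pretriv p.1 p.2
    pretrivialization_linear' := by
      rintro _ ⟨⟨x₀, i⟩, rfl⟩
      exact ⟨fun m _ => ⟨fun v w => by simp [pretriv_apply], fun r v => by simp [pretriv_apply]⟩⟩
    pretrivializationAt := fun m => c.pretriv m (Classical.arbitrary ι)
    mem_base_pretrivializationAt := fun m => FiberBundle.mem_baseSet_trivializationAt' m
    pretrivialization_mem_atlas := fun m => ⟨(m, _), rfl⟩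
    exists_coordChange := by
      rintro _ ⟨⟨x₀, i⟩, rfl⟩ _ ⟨⟨x₁, j⟩, rfl⟩
      obtain ⟨f, hf, h⟩ := c.exists_coordChange x₀ i x₁ j
      exact ⟨f, hf.continuousOn, h⟩
    totalSpaceMk_isInducing := fun m => ⟨rfl⟩ }

theorem isContMDiff_prebundle [Nonempty ι] :
    letI := c.fiberTopology; c.prebundle.IsContMDiff 𝓘(ℝ, E) ∞ :=
  letI := c.fiberTopology
  { exists_contMDiffCoordChange := by
      rintro _ ⟨⟨x₀, i⟩, rfl⟩ _ ⟨⟨x₁, j⟩, rfl⟩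
      obtain ⟨f, hf, h⟩ := c.exists_coordChange x₀ i x₁ j
      exact ⟨f, hf, h⟩ }

/-- Smoothness of sections can be read in any of the charts. -/
theorem contMDiff_section_iff [Nonempty ι] (i : ι) (v : ∀ m, V m) :
    letI := c.fiberTopology
    letI := c.prebundle.totalSpaceTopology
    letI := c.prebundle.toFiberBundle
    ContMDiff 𝓘(ℝ, E) (𝓘(ℝ, E).prod 𝓘(ℝ, E × W)) ∞ (fun m => TotalSpace.mk' (E × W) m (v m)) ↔
      ∀ x₀ : M, ContMDiffOn 𝓘(ℝ, E) 𝓘(ℝ, E × W) ∞ (fun m => (c.pretriv x₀ i ⟨m, v m⟩).2)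
        (trivializationAt E (TangentSpace 𝓘(ℝ, E) (M := M)) x₀).baseSet := by
  let _ := c.fiberTopology
  let _ := c.prebundle.totalSpaceTopology
  let _ := c.prebundle.toFiberBundle
  have _ := c.prebundle.toVectorBundle
  have : c.prebundle.IsContMDiff 𝓘(ℝ, E) ∞ := c.isContMDiff_prebundle
  have : ContMDiffVectorBundle ∞ (E × W) V 𝓘(ℝ, E) := c.prebundle.contMDiffVectorBundle 𝓘(ℝ, E)
  have key : ∀ x₀ : M,
      ContMDiffOn 𝓘(ℝ, E) (𝓘(ℝ, E).prod 𝓘(ℝ, E × W)) ∞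
        (fun m => TotalSpace.mk' (E × W) m (v m))
        (trivializationAt E (TangentSpace 𝓘(ℝ, E) (M := M)) x₀).baseSet ↔
      ContMDiffOn 𝓘(ℝ, E) 𝓘(ℝ, E × W) ∞ (fun m => (c.pretriv x₀ i ⟨m, v m⟩).2)
        (trivializationAt E (TangentSpace 𝓘(ℝ, E) (M := M)) x₀).baseSet := by
    intro x₀
    have hmem : c.pretriv x₀ i ∈ c.prebundle.pretrivializationAtlas := ⟨(x₀, i), rfl⟩
    let e := c.prebundle.toFiberPrebundle.trivializationOfMemPretrivializationAtlas hmem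
    have : MemTrivializationAtlas e := ⟨⟨_, hmem, rfl⟩⟩
    exact e.contMDiffOn_section_baseSet_iff
  refine ⟨fun h x₀ => (key x₀).1 h.contMDiffOn, fun h x => ?_⟩
  exact ((key x).2 (h x)).contMDiffAt
    ((trivializationAt E (TangentSpace 𝓘(ℝ, E) (M := M)) x).open_baseSet.mem_nhds
      (FiberBundle.mem_baseSet_trivializationAt' x))

end ChartFamily

namespace AVBundle

variable {E M EZ Z : Type*}
  [NormedAddCommGroup E] [NormedSpace ℝ E] [TopologicalSpace M] [ChartedSpace E M]
  [NormedAddCommGroup EZ] [NormedSpace ℝ EZ] [TopologicalSpace Z] [ChartedSpace EZ Z]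
  [AddAction ℝ Z] (𝒵 : AVBundle E M EZ Z)

/-- The fibre of the AV-bundle over `m`, an affine line with difference map `z -ᵥ w : ℝ`. -/
def Fiber (m : M) : Type _ := {z : Z // 𝒵.proj z = m}

variable {𝒵} in
theorem Fiber.ext {m : M} {z w : 𝒵.Fiber m} (h : z.1 = w.1) : z = w := Subtype.ext h

/-- A point of the total space as an element of its fibre. -/
def toFiber (z : Z) : 𝒵.Fiber (𝒵.proj z) := ⟨z, rfl⟩

theorem exists_vadd_eq {z w : Z} (h : 𝒵.proj z = 𝒵.proj w) : ∃ t : ℝ, t +ᵥ w = z := by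
  obtain ⟨U, _, hm, s, τ, _, _, _, h4⟩ := 𝒵.exists_localTriv (𝒵.proj z)
  refine ⟨τ z - τ w, ?_⟩
  have hz := h4 z hm
  have hw := h4 w (h ▸ hm)
  rw [← h] at hw
  calc (τ z - τ w) +ᵥ w = (τ z - τ w) +ᵥ (τ w +ᵥ s (𝒵.proj z)) := by rw [← hw]
    _ = τ z +ᵥ s (𝒵.proj z) := by rw [vadd_vadd, sub_add_cancel]
    _ = z := hz.symm

theorem vadd_injective (𝒵 : AVBundle E M EZ Z) {t t' : ℝ} {z : Z} (h : t +ᵥ z = t' +ᵥ z) : t = t' := by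
  have : (t - t') +ᵥ (t' +ᵥ z) = t' +ᵥ z := by rw [vadd_vadd, sub_add_cancel, h]
  exact sub_eq_zero.mp (𝒵.vadd_free _ _ this)

instance (m : M) : AddTorsor ℝ (𝒵.Fiber m) where
  vadd t z := ⟨t +ᵥ z.1, (𝒵.proj_vadd t z.1).trans z.2⟩
  zero_vadd z := Fiber.ext (zero_vadd ℝ z.1)
  add_vadd t t' z := Fiber.ext (add_vadd t t' z.1)
  vsub z w := (𝒵.exists_vadd_eq (z.2.trans w.2.symm)).choose
  nonempty := by
    obtain ⟨U, _, hm, s, _, _, _, h3, _⟩ := 𝒵.exists_localTriv m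
    exact ⟨⟨s m, h3 m hm⟩⟩
  vsub_vadd' z w := Fiber.ext (𝒵.exists_vadd_eq (z.2.trans w.2.symm)).choose_spec
  vadd_vsub' t w := 𝒵.vadd_injective
    (𝒵.exists_vadd_eq (((𝒵.proj_vadd t w.1).trans w.2).trans w.2.symm)).choose_spec

@[simp] theorem coe_vadd {m : M} (t : ℝ) (z : 𝒵.Fiber m) : (t +ᵥ z).1 = t +ᵥ z.1 := rfl

theorem vsub_eq_of_eq {m : M} {z w : 𝒵.Fiber m} {t t' : ℝ} {a : Z} (hz : z.1 = t +ᵥ a)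
    (hw : w.1 = t' +ᵥ a) : z -ᵥ w = t - t' := by
  rw [← vadd_vsub (t - t') w]
  congr 1
  apply Fiber.ext
  rw [coe_vadd, hw, hz, vadd_vadd, sub_add_cancel]

/-- Smooth global sections of the AV-bundle. -/
structure Sec where
  toFun : ∀ m : M, 𝒵.Fiber m
  contMDiff_toFun : ContMDiff 𝓘(ℝ, E) 𝓘(ℝ, EZ) ∞ (fun m => (toFun m).1)

instance : CoeFun 𝒵.Sec (fun _ => ∀ m : M, 𝒵.Fiber m) := ⟨Sec.toFun⟩

variable {𝒵} in
@[ext] theorem Sec.ext {σ τ : 𝒵.Sec} (h : ∀ m, σ m = τ m) : σ = τ := by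
  cases σ; cases τ; congr; exact funext h

theorem contMDiff_sub (σ τ : 𝒵.Sec) :
    ContMDiff 𝓘(ℝ, E) 𝓘(ℝ, ℝ) ∞ (fun m => (σ m -ᵥ τ m : ℝ)) := by
  intro m
  obtain ⟨U, hU, hm, s, t, _, h2, _, h4⟩ := 𝒵.exists_localTriv m
  have key : ∀ ρ : 𝒵.Sec, ContMDiffAt 𝓘(ℝ, E) 𝓘(ℝ, ℝ) ∞ (fun m => t (ρ m).1) m := fun ρ => by
    have h5 : ContMDiffAt 𝓘(ℝ, EZ) 𝓘(ℝ, ℝ) ∞ t (ρ m).1 :=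
      h2.contMDiffAt ((hU.preimage 𝒵.contMDiff_proj.continuous).mem_nhds
        (by rw [Set.mem_preimage, (ρ m).2]; exact hm))
    exact h5.comp m (ρ.contMDiff_toFun m)
  refine ((key σ).sub (key τ)).congr_of_eventuallyEq ?_
  filter_upwards [hU.mem_nhds hm] with x hx
  have e1 := h4 (σ x).1 (by rw [(σ x).2]; exact hx)
  have e2 := h4 (τ x).1 (by rw [(τ x).2]; exact hx)
  rw [(σ x).2] at e1
  rw [(τ x).2] at e2
  exact 𝒵.vsub_eq_of_eq e1 e2

/-- The function `F_σ(z) = σ(proj z) - z` on `Z` corresponding to a section `σ`. -/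
def affFun (σ : 𝒵.Sec) (z : Z) : ℝ := σ (𝒵.proj z) -ᵥ 𝒵.toFiber z

theorem affFun_eq (σ : 𝒵.Sec) {m : M} (z : 𝒵.Fiber m) : 𝒵.affFun σ z.1 = σ m -ᵥ z := by
  obtain ⟨z, rfl⟩ := z
  rfl

theorem contMDiff_affFun (σ : 𝒵.Sec) : ContMDiff 𝓘(ℝ, EZ) 𝓘(ℝ, ℝ) ∞ (𝒵.affFun σ) := by
  intro z
  obtain ⟨U, hU, hm, s, t, _, h2, _, h4⟩ := 𝒵.exists_localTriv (𝒵.proj z)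
  have hV := hU.preimage 𝒵.contMDiff_proj.continuous
  have h5 : ContMDiffAt 𝓘(ℝ, EZ) 𝓘(ℝ, ℝ) ∞ (fun z => t (σ (𝒵.proj z)).1) z := by
    have h6 : ContMDiffAt 𝓘(ℝ, EZ) 𝓘(ℝ, ℝ) ∞ t (σ (𝒵.proj z)).1 :=
      h2.contMDiffAt (hV.mem_nhds (by rw [Set.mem_preimage, (σ _).2]; exact hm))
    have h7 := h6.comp (𝒵.proj z) (σ.contMDiff_toFun (𝒵.proj z))
    exact h7.comp z (𝒵.contMDiff_proj z)
  refine (h5.sub (h2.contMDiffAt (hV.mem_nhds hm))).congr_of_eventuallyEq ?_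
  filter_upwards [hV.mem_nhds hm] with x hx
  have e1 := h4 (σ (𝒵.proj x)).1 (by rw [(σ _).2]; exact hx)
  rw [(σ _).2] at e1
  exact 𝒵.vsub_eq_of_eq e1 (h4 x hx)

/-- The section `σ + f` for a smooth function `f`. -/
def Sec.add (σ : 𝒵.Sec) (f : M → ℝ) (hf : ContMDiff 𝓘(ℝ, E) 𝓘(ℝ, ℝ) ∞ f) : 𝒵.Sec where
  toFun m := f m +ᵥ σ m
  contMDiff_toFun := 𝒵.contMDiff_vadd.comp (hf.prodMk σ.contMDiff_toFun)

section
variable [FiniteDimensional ℝ E] [IsManifold 𝓘(ℝ, E) ∞ M] [T2Space M] [SigmaCompactSpace M]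

instance nonempty_sec : Nonempty 𝒵.Sec := by
  choose U hU hmU s τ hs hτ hps hz using 𝒵.exists_localTriv
  obtain ⟨ρ, hρ⟩ := SmoothPartitionOfUnity.exists_isSubordinate 𝓘(ℝ, E) isClosed_univ U hU
    (fun x _ => Set.mem_iUnion.2 ⟨x, hmU x⟩)
  -- a base point in each fibre and the local sections, extended arbitrarily
  let z₀ : ∀ m, 𝒵.Fiber m := fun m => ⟨s m m, hps m m (hmU m)⟩
  classical
  let S : M → ∀ m, 𝒵.Fiber m := fun i m => if h : m ∈ U i then ⟨s i m, hps i m h⟩ else z₀ m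
  have hS : ∀ i m, m ∈ U i → (S i m).1 = s i m := fun i m h => by simp [S, h]
  let g : (∀ m, 𝒵.Fiber m) → M → ℝ := fun b m => ∑ᶠ i, ρ i m • (S i m -ᵥ b m : ℝ)
  have hfin : ∀ m, (Function.support fun i => ρ i m).Finite := fun m =>
    ρ.locallyFinite.point_finite m
  -- the barycentre does not depend on the base point
  have hind : ∀ b b' : ∀ m, 𝒵.Fiber m, ∀ m, g b m +ᵥ b m = g b' m +ᵥ b' m := by
    intro b b' m
    have h1 : g b m = g b' m + (b' m -ᵥ b m) := by
      have h2 : (∑ᶠ i, ρ i m • (b' m -ᵥ b m : ℝ)) = b' m -ᵥ b m := by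
        rw [← finsum_smul, ρ.sum_eq_one (Set.mem_univ m), one_smul]
      simp only [g]
      rw [← h2, ← finsum_add_distrib]
      · refine finsum_congr fun i => ?_
        rw [← smul_add, vsub_add_vsub_cancel]
      · exact (hfin m).subset fun i hi h => hi (by simp [show ρ i m = 0 from h])
      · exact (hfin m).subset fun i hi h => hi (by simp [show ρ i m = 0 from h])
    rw [h1, ← vadd_vadd, vsub_vadd]
  refine ⟨⟨fun m => g z₀ m +ᵥ z₀ m, fun x => ?_⟩⟩
  have hloc : ContMDiffAt 𝓘(ℝ, E) 𝓘(ℝ, ℝ) ∞ (g (S x)) x := by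
    refine ρ.contMDiffAt_finsum fun i hi => ?_
    have hiU : x ∈ U i := hρ i hi
    have hτ' : ContMDiffAt 𝓘(ℝ, EZ) 𝓘(ℝ, ℝ) ∞ (τ x) (s i x) :=
      (hτ x).contMDiffAt (((hU x).preimage 𝒵.contMDiff_proj.continuous).mem_nhds
        (by rw [Set.mem_preimage, hps i x hiU]; exact hmU x))
    have h1 := hτ'.comp x ((hs i).contMDiffAt ((hU i).mem_nhds hiU))
    refine h1.congr_of_eventuallyEq ?_
    filter_upwards [(hU i).mem_nhds hiU, (hU x).mem_nhds (hmU x)] with y hy hy'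
    have e1 := hz x (s i y) (by rw [hps i y hy]; exact hy')
    rw [hps i y hy] at e1
    have := 𝒵.vsub_eq_of_eq (z := S i y) (w := S x y) (t := τ x (s i y)) (t' := 0) (a := s x y)
      (by rw [hS i y hy]; exact e1) (by rw [hS x y hy', zero_vadd])
    simpa using this
  have h2 := (𝒵.contMDiff_vadd (g (S x) x, s x x)).comp x
    (hloc.prodMk ((hs x).contMDiffAt ((hU x).mem_nhds (hmU x))))
  refine h2.congr_of_eventuallyEq ?_
  filter_upwards [(hU x).mem_nhds (hmU x)] with y hy
  rw [hind z₀ (S x) y, coe_vadd, hS x y hy]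
  rfl

end

section Jets

/-- The covector `d(σ - τ)(m)`. -/
def dSub (σ τ : 𝒵.Sec) (m : M) : Cotangent E m := diffAt E (fun x => (σ x -ᵥ τ x : ℝ)) m

theorem mdifferentiableAt_sub (σ τ : 𝒵.Sec) (m : M) :
    MDifferentiableAt 𝓘(ℝ, E) 𝓘(ℝ, ℝ) (fun x => (σ x -ᵥ τ x : ℝ)) m :=
  (𝒵.contMDiff_sub σ τ m).mdifferentiableAt (by simp)

theorem dSub_add_dSub (σ τ ρ : 𝒵.Sec) (m : M) :
    𝒵.dSub σ τ m + 𝒵.dSub τ ρ m = 𝒵.dSub σ ρ m := by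
  rw [dSub, dSub, ← diffAt_add (𝒵.mdifferentiableAt_sub σ τ m) (𝒵.mdifferentiableAt_sub τ ρ m)]
  simp only [vsub_add_vsub_cancel, dSub]

theorem dSub_add_left (σ : 𝒵.Sec) (f : M → ℝ) (hf : ContMDiff 𝓘(ℝ, E) 𝓘(ℝ, ℝ) ∞ f) (m : M) :
    𝒵.dSub (σ.add 𝒵 f hf) σ m = diffAt E f m := by
  simp [dSub, Sec.add]

end Jets
end AVBundle

theorem cocycle_self {S V : Type*} [AddCommGroup V] {δ : S → S → V}
    (h : ∀ σ τ ρ, δ σ τ + δ τ ρ = δ σ ρ) (σ : S) : δ σ σ = 0 := by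
  simpa using h σ σ σ

theorem cocycle_symm {S V : Type*} [AddCommGroup V] {δ : S → S → V}
    (h : ∀ σ τ ρ, δ σ τ + δ τ ρ = δ σ ρ) (σ τ : S) : δ τ σ = - δ σ τ := by
  rw [eq_neg_iff_add_eq_zero, h, cocycle_self h]

/-- The equivalence relation `δ σ τ = 0` of a cocycle. -/
def cocycleSetoid {S V : Type*} [AddCommGroup V] (δ : S → S → V)
    (h : ∀ σ τ ρ, δ σ τ + δ τ ρ = δ σ ρ) : Setoid S where
  r σ τ := δ σ τ = 0
  iseqv := ⟨cocycle_self h, fun {σ τ} e => by rw [cocycle_symm h, e, neg_zero],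
    fun {σ τ ρ} e e' => by rw [← h σ τ ρ, e, e', add_zero]⟩

/-- The quotient by a cocycle is an affine space. -/
@[reducible] def cocycleTorsor {S V : Type*} [AddCommGroup V] [Nonempty S] (δ : S → S → V)
    (h : ∀ σ τ ρ, δ σ τ + δ τ ρ = δ σ ρ) (hs : ∀ (v : V) (σ : S), ∃ τ, δ τ σ = v) :
    AddTorsor V (Quotient (cocycleSetoid δ h)) :=
  let sub : Quotient (cocycleSetoid δ h) → Quotient (cocycleSetoid δ h) → V :=
    Quotient.lift₂ δ (fun σ τ σ' τ' (e : δ σ σ' = 0) (e' : δ τ τ' = 0) => by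
      rw [← h σ σ' τ, e, zero_add, ← h σ' τ' τ, cocycle_symm h τ τ', e', neg_zero, add_zero])
  let vadd : V → Quotient (cocycleSetoid δ h) → Quotient (cocycleSetoid δ h) :=
    fun v p => Quotient.mk _ (hs v p.out).choose
  have hsub : ∀ p q r, sub p q + sub q r = sub p r := by
    rintro ⟨p⟩ ⟨q⟩ ⟨r⟩
    exact h p q r
  have hsymm : ∀ p q, sub q p = - sub p q := fun p q => cocycle_symm hsub p q
  have heq : ∀ p q, sub p q = 0 → p = q := by
    rintro ⟨p⟩ ⟨q⟩ e
    exact Quotient.sound e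
  have hv : ∀ v p, sub (vadd v p) p = v := by
    intro v p
    have h1 : sub (vadd v p) (Quotient.mk _ p.out) = v := (hs v p.out).choose_spec
    rwa [p.out_eq] at h1
  { vadd := vadd
    vsub := sub
    zero_vadd := fun p => heq _ _ (hv 0 p)
    add_vadd := fun v w p => heq _ _ (by
      change sub (vadd (v + w) p) (vadd v (vadd w p)) = 0
      rw [← hsub _ p, hv, hsymm, ← hsub _ (vadd w p), hv, hv, add_neg_cancel])
    nonempty := ⟨Quotient.mk _ (Classical.arbitrary S)⟩
    vsub_vadd' := fun p q => heq _ _ (by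
      change sub (vadd (sub p q) q) p = 0
      rw [← hsub _ q, hv, hsymm, neg_add_cancel])
    vadd_vsub' := hv }

/-- An affine function is its linear part and its value at a point. -/
def affineEquivProd {V P : Type*} [AddCommGroup V] [Module ℝ V] [AddTorsor V P] (p₀ : P) :
    (P →ᵃ[ℝ] ℝ) ≃ₗ[ℝ] (V →ₗ[ℝ] ℝ) × ℝ where
  toFun D := (D.linear, D p₀)
  map_add' _ _ := rfl
  map_smul' _ _ := rfl
  invFun q := ⟨fun p => q.1 (p -ᵥ p₀) + q.2, q.1, fun p v => by simp [vadd_vsub_assoc, add_assoc]⟩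
  left_inv D := by
    ext p
    simp
  right_inv q := by simp

/-- A finite-dimensional space is its double dual. -/
def bidualEquiv (E : Type*) [NormedAddCommGroup E] [NormedSpace ℝ E] [FiniteDimensional ℝ E] :
    ((E →L[ℝ] ℝ) →ₗ[ℝ] ℝ) ≃ₗ[ℝ] E :=
  ((LinearMap.toContinuousLinearMap.symm.arrowCongr (LinearEquiv.refl ℝ ℝ)).trans
    (Module.evalEquiv ℝ E).symm)

theorem apply_bidualEquiv {E : Type*} [NormedAddCommGroup E] [NormedSpace ℝ E]
    [FiniteDimensional ℝ E] (L : (E →L[ℝ] ℝ) →ₗ[ℝ] ℝ) (η : E →L[ℝ] ℝ) :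
    η (bidualEquiv E L) = L η := by
  have h := LinearMap.congr_fun ((Module.evalEquiv ℝ E).apply_symm_apply
    (LinearMap.toContinuousLinearMap.symm.arrowCongr (LinearEquiv.refl ℝ ℝ) L))
    (η : E →ₗ[ℝ] ℝ)
  exact h

namespace AVBundle

variable {E M EZ Z : Type*}
  [NormedAddCommGroup E] [NormedSpace ℝ E] [TopologicalSpace M] [ChartedSpace E M]
  [NormedAddCommGroup EZ] [NormedSpace ℝ EZ] [TopologicalSpace Z] [ChartedSpace EZ Z]
  [AddAction ℝ Z] (𝒵 : AVBundle E M EZ Z)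

/-- The fibre at `m` of the phase bundle `PZ`: classes of sections `σ` modulo `d(σ - τ)(m) = 0`. -/
def Phase (m : M) : Type _ :=
  Quotient (cocycleSetoid (fun σ τ : 𝒵.Sec => 𝒵.dSub σ τ m)
    (fun σ τ ρ => 𝒵.dSub_add_dSub σ τ ρ m))

/-- The affine differential `𝐝σ(m)`. -/
def Sec.phase {𝒵 : AVBundle E M EZ Z} (σ : 𝒵.Sec) (m : M) : 𝒵.Phase m := Quotient.mk _ σ

theorem contact_cocycle (m : M) (σ τ ρ : 𝒵.Sec) :
    ((𝒵.dSub σ τ m, (σ m -ᵥ τ m : ℝ)) : Cotangent E m × ℝ) + (𝒵.dSub τ ρ m, (τ m -ᵥ ρ m : ℝ)) =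
      (𝒵.dSub σ ρ m, (σ m -ᵥ ρ m : ℝ)) := by
  rw [Prod.mk_add_mk, dSub_add_dSub, vsub_add_vsub_cancel]

/-- The fibre at `m` of the contact bundle `CZ` of first jets of sections: classes of sections `σ`
modulo `d(σ - τ)(m) = 0` and `σ(m) = τ(m)`. -/
def Contact (m : M) : Type _ :=
  Quotient (cocycleSetoid
    (fun σ τ : 𝒵.Sec => ((𝒵.dSub σ τ m, (σ m -ᵥ τ m : ℝ)) : Cotangent E m × ℝ))
    (𝒵.contact_cocycle m))

/-- The first jet `𝐜σ(m)`. -/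
def Sec.contact {𝒵 : AVBundle E M EZ Z} (σ : 𝒵.Sec) (m : M) : 𝒵.Contact m := Quotient.mk _ σ

/-- The map `(α, β) ↦ (α, β + r α)`. -/
def shear (r : ℝ) : ℝ × ℝ →L[ℝ] ℝ × ℝ :=
  ContinuousLinearMap.id ℝ (ℝ × ℝ) +
    r • (ContinuousLinearMap.inr ℝ ℝ ℝ).comp (ContinuousLinearMap.fst ℝ ℝ ℝ)

theorem contMDiff_shear {f : M → ℝ} (hf : ContMDiff 𝓘(ℝ, E) 𝓘(ℝ, ℝ) ∞ f) :
    ContMDiff 𝓘(ℝ, E) 𝓘(ℝ, ℝ × ℝ →L[ℝ] ℝ × ℝ) ∞ (fun m => shear (f m)) :=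
  contMDiff_const.add (hf.smul contMDiff_const)

section
variable [FiniteDimensional ℝ E]

/-- The tangent vector corresponding to a functional on covectors. -/
def tangentOfFunctional (m : M) :
    (Cotangent E m →ₗ[ℝ] ℝ) ≃ₗ[ℝ] TangentSpace 𝓘(ℝ, E) m := bidualEquiv E

theorem apply_tangentOfFunctional (m : M) (L : Cotangent E m →ₗ[ℝ] ℝ) (η : Cotangent E m) :
    η (tangentOfFunctional m L) = L η := apply_bidualEquiv (E := E) L η

/-- Functionals on `T*_m M × ℝ` as elements of `T_m M × ℝ`. -/
def contactLinEquiv (m : M) : (Cotangent E m × ℝ →ₗ[ℝ] ℝ) ≃ₗ[ℝ]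
    TangentSpace 𝓘(ℝ, E) m × ℝ :=
  (LinearMap.coprodEquiv ℝ).symm.trans
    ((tangentOfFunctional m).prodCongr (LinearMap.ringLmapEquivSelf ℝ ℝ ℝ))

theorem contactLinEquiv_spec (m : M) (L : Cotangent E m × ℝ →ₗ[ℝ] ℝ) (η : Cotangent E m) (r : ℝ) :
    η (contactLinEquiv m L).1 + r * (contactLinEquiv m L).2 = L (η, r) := by
  have h1 : η (contactLinEquiv m L).1 = L (η, 0) :=
    apply_tangentOfFunctional m (L.comp (LinearMap.inl ℝ _ _)) η
  have h2 : (contactLinEquiv m L).2 = L (0, 1) := rfl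
  rw [h1, h2, ← smul_eq_mul, ← L.map_smul, ← L.map_add]
  simp

end

section
variable [IsManifold 𝓘(ℝ, E) ∞ M]

theorem contMDiffOn_inr_comp (σ τ : 𝒵.Sec) (x₀ : M) :
    ContMDiffOn 𝓘(ℝ, E) 𝓘(ℝ, E →L[ℝ] ℝ × ℝ) ∞
      (fun m => ((ContinuousLinearMap.inr ℝ ℝ ℝ).comp (𝒵.dSub τ σ m)).comp
        ((trivializationAt E (TangentSpace 𝓘(ℝ, E)) x₀).symmL ℝ m))
      (trivializationAt E (TangentSpace 𝓘(ℝ, E) (M := M)) x₀).baseSet :=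
  (contMDiffOn_const (c := ContinuousLinearMap.inr ℝ ℝ ℝ)).clm_comp
    (diffAt_comp_symmL (𝒵.contMDiff_sub τ σ) x₀)

end

variable [FiniteDimensional ℝ E] [IsManifold 𝓘(ℝ, E) ∞ M] [T2Space M] [SigmaCompactSpace M]

/-- The phase fibres are affine spaces modelled on the cotangent spaces,
`𝐝σ(m) - 𝐝τ(m) = d(σ - τ)(m)`. -/
instance (m : M) : AddTorsor (Cotangent E m) (𝒵.Phase m) :=
  cocycleTorsor (fun σ τ : 𝒵.Sec => 𝒵.dSub σ τ m) (fun σ τ ρ => 𝒵.dSub_add_dSub σ τ ρ m)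
    fun η σ => by
      obtain ⟨f, hf, h, _⟩ := exists_contMDiff_diffAt_eq (E := E) m η 0
      exact ⟨σ.add 𝒵 f hf, (𝒵.dSub_add_left σ f hf m).trans h⟩

theorem phase_vsub_phase (σ τ : 𝒵.Sec) (m : M) : σ.phase m -ᵥ τ.phase m = 𝒵.dSub σ τ m := rfl

/-- The contact fibres are affine spaces modelled on `T*_m M × ℝ`,
`𝐜σ(m) - 𝐜τ(m) = (d(σ - τ)(m), σ(m) - τ(m))`. -/
instance (m : M) : AddTorsor (Cotangent E m × ℝ) (𝒵.Contact m) :=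
  cocycleTorsor (fun σ τ : 𝒵.Sec => ((𝒵.dSub σ τ m, (σ m -ᵥ τ m : ℝ)) : Cotangent E m × ℝ))
    (𝒵.contact_cocycle m)
    fun v σ => by
      obtain ⟨f, hf, h, h'⟩ := exists_contMDiff_diffAt_eq (E := E) m v.1 v.2
      refine ⟨σ.add 𝒵 f hf, Prod.ext ((𝒵.dSub_add_left σ f hf m).trans h) ?_⟩
      simp [Sec.add, h']

theorem contact_vsub_contact (σ τ : 𝒵.Sec) (m : M) :
    σ.contact m -ᵥ τ.contact m = (𝒵.dSub σ τ m, (σ m -ᵥ τ m : ℝ)) := rfl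

/-- The fibre `Aff(P_m Z, ℝ)` of the bundle of affine derivations with values in functions. -/
abbrev PhaseDual (m : M) : Type _ := 𝒵.Phase m →ᵃ[ℝ] ℝ

/-- The fibre `Aff(C_m Z, ℝ)` of the bundle of affine first-order operators with values in
functions. -/
abbrev ContactDual (m : M) : Type _ := 𝒵.Contact m →ᵃ[ℝ] ℝ

/-- The fibre `Aff(P_m Z, Z_m)` of `T̄Z`. -/
abbrev TBar (m : M) : Type _ := 𝒵.Phase m →ᵃ[ℝ] 𝒵.Fiber m

/-- The fibre `Aff(C_m Z, Z_m)` of `L̄Z`. -/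
abbrev LBar (m : M) : Type _ := 𝒵.Contact m →ᵃ[ℝ] 𝒵.Fiber m

/-- A section `σ` gives the chart `D ↦ (D_v, D(𝐝σ(m)))` of `Aff(P_m Z, ℝ)`, where the linear part
`D_v` is a tangent vector. -/
def phaseDualCharts : ChartFamily E 𝒵.Sec ℝ 𝒵.PhaseDual where
  chart σ m := (affineEquivProd (σ.phase m)).trans
    ((tangentOfFunctional m).prodCongr (LinearEquiv.refl ℝ ℝ))
  exists_transition σ τ := by
    refine ⟨fun m => 𝒵.dSub τ σ m, fun _ => ContinuousLinearMap.id ℝ ℝ,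
      fun x₀ => diffAt_comp_symmL (𝒵.contMDiff_sub τ σ) x₀, contMDiff_const, fun m D => ?_⟩
    have h := D.linearMap_vsub (τ.phase m) (σ.phase m)
    rw [phase_vsub_phase, ← apply_tangentOfFunctional] at h
    refine Prod.ext rfl ?_
    change D (τ.phase m) = D (σ.phase m) + 𝒵.dSub τ σ m (tangentOfFunctional m D.linear)
    rw [h]
    simp

/-- A section `σ` gives the chart `D ↦ (v, α, D(𝐜σ(m)))` of `Aff(C_m Z, ℝ)`, where the linear part
of `D` is `(η, r) ↦ η(v) + α r`. -/
def contactDualCharts : ChartFamily E 𝒵.Sec (ℝ × ℝ) 𝒵.ContactDual where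
  chart σ m := (affineEquivProd (σ.contact m)).trans
    (((contactLinEquiv m).prodCongr (LinearEquiv.refl ℝ ℝ)).trans
      (LinearEquiv.prodAssoc ℝ _ _ _))
  exists_transition σ τ := by
    refine ⟨fun m => (ContinuousLinearMap.inr ℝ ℝ ℝ).comp (𝒵.dSub τ σ m),
      fun m => shear (τ m -ᵥ σ m : ℝ), 𝒵.contMDiffOn_inr_comp σ τ,
      contMDiff_shear (𝒵.contMDiff_sub τ σ), fun m D => ?_⟩
    have h := D.linearMap_vsub (τ.contact m) (σ.contact m)
    rw [contact_vsub_contact, ← contactLinEquiv_spec, vsub_eq_sub, eq_sub_iff_add_eq] at h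
    refine Prod.ext rfl (Prod.ext ?_ ?_)
    · simp [shear, affineEquivProd]
    · change D (τ.contact m) = _
      rw [← h]
      simp [shear, affineEquivProd]
      ring

section Instances

instance (m : M) : TopologicalSpace (𝒵.PhaseDual m) := 𝒵.phaseDualCharts.fiberTopology m
instance : TopologicalSpace (TotalSpace (E × ℝ) 𝒵.PhaseDual) :=
  𝒵.phaseDualCharts.prebundle.totalSpaceTopology
instance : FiberBundle (E × ℝ) 𝒵.PhaseDual := 𝒵.phaseDualCharts.prebundle.toFiberBundle
instance : VectorBundle ℝ (E × ℝ) 𝒵.PhaseDual := 𝒵.phaseDualCharts.prebundle.toVectorBundle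
instance : ContMDiffVectorBundle ∞ (E × ℝ) 𝒵.PhaseDual 𝓘(ℝ, E) :=
  haveI := 𝒵.phaseDualCharts.isContMDiff_prebundle
  𝒵.phaseDualCharts.prebundle.contMDiffVectorBundle 𝓘(ℝ, E)

instance (m : M) : TopologicalSpace (𝒵.ContactDual m) := 𝒵.contactDualCharts.fiberTopology m
instance : TopologicalSpace (TotalSpace (E × (ℝ × ℝ)) 𝒵.ContactDual) :=
  𝒵.contactDualCharts.prebundle.totalSpaceTopology
instance : FiberBundle (E × (ℝ × ℝ)) 𝒵.ContactDual := 𝒵.contactDualCharts.prebundle.toFiberBundle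
instance : VectorBundle ℝ (E × (ℝ × ℝ)) 𝒵.ContactDual :=
  𝒵.contactDualCharts.prebundle.toVectorBundle
instance : ContMDiffVectorBundle ∞ (E × (ℝ × ℝ)) 𝒵.ContactDual 𝓘(ℝ, E) :=
  haveI := 𝒵.contactDualCharts.isContMDiff_prebundle
  𝒵.contactDualCharts.prebundle.contMDiffVectorBundle 𝓘(ℝ, E)

end Instances

end AVBundle

namespace AVBundle

variable {E M EZ Z : Type*}
  [NormedAddCommGroup E] [NormedSpace ℝ E] [TopologicalSpace M] [ChartedSpace E M]
  [NormedAddCommGroup EZ] [NormedSpace ℝ EZ] [TopologicalSpace Z] [ChartedSpace EZ Z]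
  [AddAction ℝ Z] (𝒵 : AVBundle E M EZ Z)

/-- Families of vectors tangent to `Z` along the fibre over `m` (not necessarily vertical). -/
abbrev FiberField (m : M) : Type _ := ∀ z : 𝒵.Fiber m, TangentSpace 𝓘(ℝ, EZ) z.1

variable (EZ) in
/-- The fundamental vector field `X_Z` of `Z`. It is minus the generator of the translations
`z ↦ t +ᵥ z`, so that `X_Z(F_σ) = 1`. -/
def fundamentalField (z : Z) : TangentSpace 𝓘(ℝ, EZ) z :=
  -(mfderiv 𝓘(ℝ, ℝ) 𝓘(ℝ, EZ) (fun t : ℝ => t +ᵥ z) 0 (1 : ℝ) : EZ)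

/-- The fields along the fibre over `m` which are invariant under all translations `z ↦ t +ᵥ z`. -/
def invariantFields (m : M) : Submodule ℝ (𝒵.FiberField m) where
  carrier := {Y | ∀ (t : ℝ) (z : 𝒵.Fiber m),
    mfderiv 𝓘(ℝ, EZ) 𝓘(ℝ, EZ) (fun w : Z => t +ᵥ w) z.1 (Y z) = Y (t +ᵥ z)}
  zero_mem' t z := map_zero _
  add_mem' {X Y} hX hY t z := by
    change mfderiv 𝓘(ℝ, EZ) 𝓘(ℝ, EZ) (fun w : Z => t +ᵥ w) z.1 (X z + Y z) =
      X (t +ᵥ z) + Y (t +ᵥ z)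
    rw [map_add, hX, hY]
  smul_mem' c X hX t z := by
    change mfderiv 𝓘(ℝ, EZ) 𝓘(ℝ, EZ) (fun w : Z => t +ᵥ w) z.1 (c • X z) = c • X (t +ᵥ z)
    rw [map_smul, hX]

/-- The vertical field `φ X_Z` for an affine function `φ` on the fibre. -/
def verticalField (m : M) : (𝒵.Fiber m →ᵃ[ℝ] ℝ) →ₗ[ℝ] 𝒵.FiberField m where
  toFun φ z := φ z • fundamentalField EZ z.1
  map_add' φ ψ := funext fun z => add_smul (φ z) (ψ z) (fundamentalField EZ z.1)
  map_smul' c φ := funext fun z => mul_smul c (φ z) (fundamentalField EZ z.1)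

/-- The fibre over `m` of `L̆Z`: the fields along the fibre of `Z` of the form `Y + φ X_Z`, with `Y`
invariant and `φ` affine. Sections of `L̆Z` are the affine vector fields on `Z`, locally of the form
`f_a(x) ∂_{x_a} + (α(x) s + β(x)) ∂_s`. -/
def LBreve (m : M) : Type _ :=
  ↥(𝒵.invariantFields m ⊔ LinearMap.range (𝒵.verticalField m))

instance (m : M) : AddCommGroup (𝒵.LBreve m) :=
  inferInstanceAs (AddCommGroup ↥(𝒵.invariantFields m ⊔ LinearMap.range (𝒵.verticalField m)))
instance (m : M) : Module ℝ (𝒵.LBreve m) :=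
  inferInstanceAs (Module ℝ ↥(𝒵.invariantFields m ⊔ LinearMap.range (𝒵.verticalField m)))

/-- The field along the fibre. -/
def LBreve.field {𝒵 : AVBundle E M EZ Z} {m : M} (X : 𝒵.LBreve m) : 𝒵.FiberField m := X.1

/-- The differential of the projection of `Z`. -/
def dProj {m : M} (z : 𝒵.Fiber m) : TangentSpace 𝓘(ℝ, EZ) z.1 →L[ℝ] TangentSpace 𝓘(ℝ, E) m :=
  (mfderiv 𝓘(ℝ, EZ) 𝓘(ℝ, E) 𝒵.proj z.1 : EZ →L[ℝ] E)

/-- The differential of `F_σ`. -/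
def dAff (σ : 𝒵.Sec) {m : M} (z : 𝒵.Fiber m) : TangentSpace 𝓘(ℝ, EZ) z.1 →L[ℝ] ℝ :=
  diffAt EZ (𝒵.affFun σ) z.1

/-- The trivialization of `Z` by a global section. -/
def secDiffeo (σ : 𝒵.Sec) : Diffeomorph 𝓘(ℝ, EZ) (𝓘(ℝ, E).prod 𝓘(ℝ, ℝ)) Z (M × ℝ) ∞ where
  toFun z := (𝒵.proj z, 𝒵.affFun σ z)
  invFun p := (-p.2) +ᵥ (σ p.1).1
  left_inv z := by
    change (-(𝒵.affFun σ z)) +ᵥ (σ (𝒵.proj z)).1 = z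
    rw [affFun, neg_vsub_eq_vsub_rev, ← coe_vadd, vsub_vadd]
    rfl
  right_inv p := by
    obtain ⟨m, t⟩ := p
    have h : 𝒵.proj ((-t) +ᵥ (σ m).1) = m := by rw [𝒵.proj_vadd, (σ m).2]
    refine Prod.ext h ?_
    change 𝒵.affFun σ ((-t) +ᵥ σ m).1 = t
    rw [affFun_eq, vsub_vadd_eq_vsub_sub, vsub_self]
    simp
  contMDiff_toFun := 𝒵.contMDiff_proj.prodMk (𝒵.contMDiff_affFun σ)
  contMDiff_invFun := 𝒵.contMDiff_vadd.comp
    ((contMDiff_snd.neg).prodMk (σ.contMDiff_toFun.comp contMDiff_fst))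

theorem mfderiv_secDiffeo (σ : 𝒵.Sec) {m : M} (z : 𝒵.Fiber m) (v : TangentSpace 𝓘(ℝ, EZ) z.1) :
    (mfderiv 𝓘(ℝ, EZ) (𝓘(ℝ, E).prod 𝓘(ℝ, ℝ)) (𝒵.secDiffeo σ) z.1 v : E × ℝ) =
      (𝒵.dProj z v, 𝒵.dAff σ z v) := by
  have := mfderiv_prodMk ((𝒵.contMDiff_proj z.1).mdifferentiableAt (by simp))
    ((𝒵.contMDiff_affFun σ z.1).mdifferentiableAt (by simp))
  exact DFunLike.congr_fun this v

theorem existsUnique_tangent (σ : 𝒵.Sec) {m : M} (z : 𝒵.Fiber m) (u : TangentSpace 𝓘(ℝ, E) m)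
    (r : ℝ) : ∃! v : TangentSpace 𝓘(ℝ, EZ) z.1, 𝒵.dProj z v = u ∧ 𝒵.dAff σ z v = r := by
  let e := (𝒵.secDiffeo σ).mfderivToContinuousLinearEquiv (x := z.1) (by simp)
  have he : ∀ v, (e v : E × ℝ) = (𝒵.dProj z v, 𝒵.dAff σ z v) := 𝒵.mfderiv_secDiffeo σ z
  refine ⟨e.symm (u, r), ?_, fun v hv => ?_⟩
  · have h1 := (he (e.symm (u, r))).symm.trans (e.apply_symm_apply (u, r))
    exact Prod.ext_iff.mp h1
  · exact e.injective (((he v).trans (Prod.ext hv.1 hv.2)).trans (e.apply_symm_apply (u, r)).symm)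

theorem tangent_ext (σ : 𝒵.Sec) {m : M} (z : 𝒵.Fiber m) {v w : TangentSpace 𝓘(ℝ, EZ) z.1}
    (h : 𝒵.dProj z v = 𝒵.dProj z w) (h' : 𝒵.dAff σ z v = 𝒵.dAff σ z w) : v = w :=
  (𝒵.existsUnique_tangent σ z _ _).unique ⟨h, h'⟩ ⟨rfl, rfl⟩

/-- The differential of `z ↦ t +ᵥ z`. -/
def dTrans {m : M} (t : ℝ) (z : 𝒵.Fiber m) :
    TangentSpace 𝓘(ℝ, EZ) z.1 →L[ℝ] TangentSpace 𝓘(ℝ, EZ) (t +ᵥ z).1 :=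
  mfderiv 𝓘(ℝ, EZ) 𝓘(ℝ, EZ) (fun w : Z => t +ᵥ w) z.1

theorem contMDiff_trans (𝒵 : AVBundle E M EZ Z) (t : ℝ) : ContMDiff 𝓘(ℝ, EZ) 𝓘(ℝ, EZ) ∞ (fun w : Z => t +ᵥ w) :=
  𝒵.contMDiff_vadd.comp (contMDiff_const.prodMk contMDiff_id)

theorem affFun_vadd (σ : 𝒵.Sec) (t : ℝ) (z : Z) : 𝒵.affFun σ (t +ᵥ z) = 𝒵.affFun σ z - t := by
  change 𝒵.affFun σ (t +ᵥ 𝒵.toFiber z).1 = 𝒵.affFun σ (𝒵.toFiber z).1 - t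
  rw [affFun_eq, affFun_eq, vsub_vadd_eq_vsub_sub]

theorem dProj_dTrans {m : M} (t : ℝ) (z : 𝒵.Fiber m) (v : TangentSpace 𝓘(ℝ, EZ) z.1) :
    𝒵.dProj (t +ᵥ z) (𝒵.dTrans t z v) = 𝒵.dProj z v := by
  have h := mfderiv_comp (I := 𝓘(ℝ, EZ)) (I' := 𝓘(ℝ, EZ)) (I'' := 𝓘(ℝ, E)) z.1
    ((𝒵.contMDiff_proj (t +ᵥ z.1)).mdifferentiableAt (by simp))
    ((𝒵.contMDiff_trans t z.1).mdifferentiableAt (by simp))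
  have h2 : (𝒵.proj ∘ fun w : Z => t +ᵥ w) = 𝒵.proj := funext fun w => 𝒵.proj_vadd t w
  rw [h2] at h
  exact (DFunLike.congr_fun h v).symm

theorem dAff_dTrans (σ : 𝒵.Sec) {m : M} (t : ℝ) (z : 𝒵.Fiber m) (v : TangentSpace 𝓘(ℝ, EZ) z.1) :
    𝒵.dAff σ (t +ᵥ z) (𝒵.dTrans t z v) = 𝒵.dAff σ z v := by
  have h := mfderiv_comp (I := 𝓘(ℝ, EZ)) (I' := 𝓘(ℝ, EZ)) (I'' := 𝓘(ℝ, ℝ)) z.1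
    ((𝒵.contMDiff_affFun σ (t +ᵥ z.1)).mdifferentiableAt (by simp))
    ((𝒵.contMDiff_trans t z.1).mdifferentiableAt (by simp))
  have h2 : (𝒵.affFun σ ∘ fun w : Z => t +ᵥ w) = fun w => 𝒵.affFun σ w - t :=
    funext fun w => 𝒵.affFun_vadd σ t w
  have h3 : diffAt EZ (fun w => 𝒵.affFun σ w - t) z.1 = diffAt EZ (𝒵.affFun σ) z.1 := by
    rw [diffAt_sub ((𝒵.contMDiff_affFun σ z.1).mdifferentiableAt (by simp))
      mdifferentiableAt_const, diffAt_const, sub_zero]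
  rw [h2] at h
  exact ((DFunLike.congr_fun h v).symm).trans (DFunLike.congr_fun h3 v)

theorem mdifferentiableAt_orbit (𝒵 : AVBundle E M EZ Z) (z : Z) :
    MDifferentiableAt 𝓘(ℝ, ℝ) 𝓘(ℝ, EZ) (fun t : ℝ => t +ᵥ z) 0 :=
  ((𝒵.contMDiff_vadd.comp (contMDiff_id.prodMk contMDiff_const)) 0).mdifferentiableAt (by simp)

theorem mfderiv_orbit_apply (𝒵 : AVBundle E M EZ Z) {F : Type*} [NormedAddCommGroup F]
    [NormedSpace ℝ F] {N : Type*} [TopologicalSpace N] [ChartedSpace F N] (g : Z → N) (z : Z)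
    (hg : MDifferentiableAt 𝓘(ℝ, EZ) 𝓘(ℝ, F) g z) {L : ℝ →L[ℝ] F}
    (hL : HasMFDerivAt 𝓘(ℝ, ℝ) 𝓘(ℝ, F) (fun t : ℝ => g (t +ᵥ z)) 0 L) :
    (mfderiv 𝓘(ℝ, EZ) 𝓘(ℝ, F) g z (fundamentalField EZ z) : F) = - L 1 := by
  have aux : ∀ w, z = w → HasMFDerivAt 𝓘(ℝ, EZ) 𝓘(ℝ, F) g w
      (mfderiv 𝓘(ℝ, EZ) 𝓘(ℝ, F) g z : EZ →L[ℝ] F) := by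
    rintro _ rfl
    exact hg.hasMFDerivAt
  have h1 := HasMFDerivAt.comp (0 : ℝ) (aux ((fun t : ℝ => t +ᵥ z) 0) (zero_vadd ℝ z).symm)
    (𝒵.mdifferentiableAt_orbit z).hasMFDerivAt
  have h2 := hasMFDerivAt_unique h1 hL
  have h3 : (mfderiv 𝓘(ℝ, EZ) 𝓘(ℝ, F) g z : EZ →L[ℝ] F)
      (mfderiv 𝓘(ℝ, ℝ) 𝓘(ℝ, EZ) (fun t : ℝ => t +ᵥ z) 0 (1 : ℝ) : EZ) = L 1 :=
    DFunLike.congr_fun h2 (1 : ℝ)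
  rw [← h3]
  exact map_neg (mfderiv 𝓘(ℝ, EZ) 𝓘(ℝ, F) g z : EZ →L[ℝ] F) _

theorem dProj_fundamentalField {m : M} (z : 𝒵.Fiber m) :
    𝒵.dProj z (fundamentalField EZ z.1) = 0 := by
  have h2 : (fun t : ℝ => 𝒵.proj (t +ᵥ z.1)) = fun _ => m :=
    funext fun t => (𝒵.proj_vadd t z.1).trans z.2
  have h := 𝒵.mfderiv_orbit_apply 𝒵.proj z.1 ((𝒵.contMDiff_proj _).mdifferentiableAt (by simp))
    (L := 0) (by rw [h2]; exact hasMFDerivAt_const m (0 : ℝ))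
  exact h.trans neg_zero

theorem dAff_fundamentalField (σ : 𝒵.Sec) {m : M} (z : 𝒵.Fiber m) :
    𝒵.dAff σ z (fundamentalField EZ z.1) = 1 := by
  have h2 : (fun t : ℝ => 𝒵.affFun σ (t +ᵥ z.1)) = fun t => 𝒵.affFun σ z.1 - t :=
    funext fun t => 𝒵.affFun_vadd σ t z.1
  have h := 𝒵.mfderiv_orbit_apply (𝒵.affFun σ) z.1
    ((𝒵.contMDiff_affFun σ _).mdifferentiableAt (by simp))
    (L := -ContinuousLinearMap.id ℝ ℝ)
    (by
      rw [h2]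
      exact ((hasFDerivAt_id (0 : ℝ)).const_sub (𝒵.affFun σ z.1)).hasMFDerivAt)
  refine h.trans ?_
  change -(-(1 : ℝ)) = 1
  norm_num

theorem dAff_sub (σ τ : 𝒵.Sec) {m : M} (z : 𝒵.Fiber m) (v : TangentSpace 𝓘(ℝ, EZ) z.1) :
    𝒵.dAff τ z v = 𝒵.dAff σ z v + 𝒵.dSub τ σ m (𝒵.dProj z v) := by
  obtain ⟨z, rfl⟩ := z
  have h1 : 𝒵.affFun τ = fun w => 𝒵.affFun σ w +
      ((fun x => (τ x -ᵥ σ x : ℝ)) ∘ 𝒵.proj) w := by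
    funext w
    simp only [affFun, Function.comp]
    rw [add_comm, vsub_add_vsub_cancel]
  have hd := 𝒵.mdifferentiableAt_sub τ σ (𝒵.proj z)
  have hp : MDifferentiableAt 𝓘(ℝ, EZ) 𝓘(ℝ, E) 𝒵.proj z :=
    (𝒵.contMDiff_proj z).mdifferentiableAt (by simp)
  have h2 : diffAt EZ (𝒵.affFun τ) z = diffAt EZ (𝒵.affFun σ) z +
      diffAt EZ ((fun x => (τ x -ᵥ σ x : ℝ)) ∘ 𝒵.proj) z := by
    rw [h1]
    exact diffAt_add ((𝒵.contMDiff_affFun σ z).mdifferentiableAt (by simp)) (hd.comp z hp)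
  have h3 := mfderiv_comp z hd hp
  exact (DFunLike.congr_fun h2 v).trans (congrArg (_ + ·) (DFunLike.congr_fun h3 v))

theorem exists_coeffs (σ : 𝒵.Sec) {m : M} (X : 𝒵.LBreve m) :
    ∃ (u : TangentSpace 𝓘(ℝ, E) m) (a b : ℝ), ∀ t : ℝ,
      𝒵.dProj (t +ᵥ σ m) (X.field (t +ᵥ σ m)) = u ∧
      𝒵.dAff σ (t +ᵥ σ m) (X.field (t +ᵥ σ m)) = t * a + b := by
  obtain ⟨X, hX⟩ := X
  obtain ⟨Y, hY, _, ⟨φ, rfl⟩, rfl⟩ := Submodule.mem_sup.1 hX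
  refine ⟨𝒵.dProj (σ m) (Y (σ m)), φ.linear 1, 𝒵.dAff σ (σ m) (Y (σ m)) + φ (σ m), fun t => ?_⟩
  have hYt : 𝒵.dTrans t (σ m) (Y (σ m)) = Y (t +ᵥ σ m) := hY t (σ m)
  change 𝒵.dProj (t +ᵥ σ m) (Y (t +ᵥ σ m) + φ (t +ᵥ σ m) • fundamentalField EZ (t +ᵥ σ m).1) = _ ∧
    𝒵.dAff σ (t +ᵥ σ m) (Y (t +ᵥ σ m) + φ (t +ᵥ σ m) • fundamentalField EZ (t +ᵥ σ m).1) = _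
  rw [map_add, map_add, map_smul, map_smul, dProj_fundamentalField, dAff_fundamentalField, ← hYt,
    dProj_dTrans, dAff_dTrans, φ.map_vadd]
  constructor
  · simp
  · have : φ.linear t = t * φ.linear 1 := by
      rw [← smul_eq_mul, ← φ.linear.map_smul, smul_eq_mul, mul_one]
    rw [this]
    simp only [smul_eq_mul, vadd_eq_add, mul_one]
    ring

/-- The coordinates `(v, a, b)` of an element of `L̆Z`: it projects to `v`, and applied to `F_σ` it
gives the affine function `t +ᵥ σ(m) ↦ t a + b`. -/
def lBreveLin (σ : 𝒵.Sec) (m : M) : 𝒵.LBreve m →ₗ[ℝ] TangentSpace 𝓘(ℝ, E) m × (ℝ × ℝ) where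
  toFun X := (𝒵.dProj (σ m) (X.field (σ m)),
    (𝒵.dAff σ ((1 : ℝ) +ᵥ σ m) (X.field ((1 : ℝ) +ᵥ σ m)) - 𝒵.dAff σ (σ m) (X.field (σ m)),
      𝒵.dAff σ (σ m) (X.field (σ m))))
  map_add' X Y := by
    have h : ∀ z, (X + Y).field z = X.field z + Y.field z := fun _ => rfl
    simp only [h, map_add, Prod.mk_add_mk]
    congr 2
    ring
  map_smul' c X := by
    have h : ∀ z, (c • X).field z = c • X.field z := fun _ => rfl
    simp only [h, map_smul, Prod.smul_mk, smul_sub, RingHom.id_apply]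

theorem lBreveLin_spec (σ : 𝒵.Sec) {m : M} (X : 𝒵.LBreve m) (t : ℝ) :
    𝒵.dProj (t +ᵥ σ m) (X.field (t +ᵥ σ m)) = (𝒵.lBreveLin σ m X).1 ∧
    𝒵.dAff σ (t +ᵥ σ m) (X.field (t +ᵥ σ m)) =
      t * (𝒵.lBreveLin σ m X).2.1 + (𝒵.lBreveLin σ m X).2.2 := by
  obtain ⟨u, a, b, h⟩ := 𝒵.exists_coeffs σ X
  have h0 := h 0
  have h1 := (h 1).2
  rw [zero_vadd] at h0
  have e : 𝒵.lBreveLin σ m X = (u, (a, b)) := by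
    change (_, (_ - _, _)) = _
    rw [h0.1, h1, h0.2]
    simp
  rw [e]
  exact h t

theorem lBreveLin_bijective (σ : 𝒵.Sec) (m : M) : Function.Bijective (𝒵.lBreveLin σ m) := by
  constructor
  · rw [← LinearMap.ker_eq_bot, LinearMap.ker_eq_bot']
    intro X hX
    have h : ∀ z, X.field z = 0 := by
      intro z
      obtain ⟨t, rfl⟩ : ∃ t : ℝ, z = t +ᵥ σ m := ⟨z -ᵥ σ m, (vsub_vadd z (σ m)).symm⟩
      obtain ⟨h1, h2⟩ := 𝒵.lBreveLin_spec σ X t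
      rw [hX] at h1 h2
      apply 𝒵.tangent_ext σ
      · rw [h1, map_zero]; rfl
      · rw [h2, map_zero]; simp
    exact Subtype.ext (funext h)
  · rintro ⟨u, a, b⟩
    choose Y hY using fun z : 𝒵.Fiber m => (𝒵.existsUnique_tangent σ z u b).exists
    let φ : 𝒵.Fiber m →ᵃ[ℝ] ℝ :=
      ⟨fun z => a * (z -ᵥ σ m : ℝ), a • LinearMap.id, fun z t => by
        simp [vadd_vsub_assoc, mul_add]⟩
    have hYinv : Y ∈ 𝒵.invariantFields m := by
      intro t z
      change 𝒵.dTrans t z (Y z) = Y (t +ᵥ z)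
      apply 𝒵.tangent_ext σ
      · rw [dProj_dTrans, (hY _).1, (hY _).1]
      · rw [dAff_dTrans, (hY _).2, (hY _).2]
    let X : 𝒵.LBreve m := ⟨Y + 𝒵.verticalField m φ,
      Submodule.add_mem_sup hYinv ⟨φ, rfl⟩⟩
    have hX : ∀ z, 𝒵.dProj z (X.field z) = u ∧ 𝒵.dAff σ z (X.field z) = b + a * (z -ᵥ σ m : ℝ) := by
      intro z
      change 𝒵.dProj z (Y z + φ z • fundamentalField EZ z.1) = _ ∧
        𝒵.dAff σ z (Y z + φ z • fundamentalField EZ z.1) = _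
      rw [map_add, map_add, map_smul, map_smul, dProj_fundamentalField, dAff_fundamentalField,
        (hY z).1, (hY z).2]
      simp [φ]
    refine ⟨X, ?_⟩
    change (_, (_ - _, _)) = _
    rw [(hX _).1, (hX _).2, (hX _).2]
    simp

/-- These coordinates form a chart. -/
def lBreveEquiv (σ : 𝒵.Sec) (m : M) :
    𝒵.LBreve m ≃ₗ[ℝ] TangentSpace 𝓘(ℝ, E) m × (ℝ × ℝ) :=
  LinearEquiv.ofBijective (𝒵.lBreveLin σ m) (𝒵.lBreveLin_bijective σ m)

variable [IsManifold 𝓘(ℝ, E) ∞ M]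

/-- The charts of `L̆Z` given by sections of `Z`. -/
def lBreveCharts : ChartFamily E 𝒵.Sec (ℝ × ℝ) 𝒵.LBreve where
  chart := 𝒵.lBreveEquiv
  exists_transition σ τ := by
    refine ⟨fun m => (ContinuousLinearMap.inr ℝ ℝ ℝ).comp (𝒵.dSub τ σ m),
      fun m => shear (τ m -ᵥ σ m : ℝ), 𝒵.contMDiffOn_inr_comp σ τ,
      contMDiff_shear (𝒵.contMDiff_sub τ σ), fun m X => ?_⟩
    change 𝒵.lBreveLin τ m X = (_, _)
    set q := 𝒵.lBreveLin σ m X with hq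
    have key : ∀ t : ℝ, 𝒵.dProj (t +ᵥ τ m) (X.field (t +ᵥ τ m)) = q.1 ∧
        𝒵.dAff τ (t +ᵥ τ m) (X.field (t +ᵥ τ m)) =
          (t + (τ m -ᵥ σ m)) * q.2.1 + q.2.2 + 𝒵.dSub τ σ m q.1 := by
      intro t
      have e : t +ᵥ τ m = (t + (τ m -ᵥ σ m : ℝ)) +ᵥ σ m := by
        rw [← vadd_vadd, vsub_vadd]
      obtain ⟨h1, h2⟩ := 𝒵.lBreveLin_spec σ X (t + (τ m -ᵥ σ m))
      rw [𝒵.dAff_sub σ τ, e, h1, h2]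
      exact ⟨rfl, rfl⟩
    have hq' : 𝒵.lBreveEquiv σ m X = q := rfl
    have k0 := key 0
    have k1 := (key 1).2
    rw [zero_vadd] at k0
    change (_, (_ - _, _)) = _
    rw [k0.1, k0.2, k1]
    refine Prod.ext rfl (Prod.ext ?_ ?_)
    · rw [hq']
      simp [shear]
      ring
    · rw [hq']
      simp [shear]
      ring

section Instances
variable [FiniteDimensional ℝ E] [T2Space M] [SigmaCompactSpace M]

instance (m : M) : TopologicalSpace (𝒵.LBreve m) := 𝒵.lBreveCharts.fiberTopology m
instance : TopologicalSpace (TotalSpace (E × (ℝ × ℝ)) 𝒵.LBreve) :=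
  𝒵.lBreveCharts.prebundle.totalSpaceTopology
instance : FiberBundle (E × (ℝ × ℝ)) 𝒵.LBreve := 𝒵.lBreveCharts.prebundle.toFiberBundle
instance : VectorBundle ℝ (E × (ℝ × ℝ)) 𝒵.LBreve :=
  𝒵.lBreveCharts.prebundle.toVectorBundle
instance : ContMDiffVectorBundle ∞ (E × (ℝ × ℝ)) 𝒵.LBreve 𝓘(ℝ, E) :=
  haveI := 𝒵.lBreveCharts.isContMDiff_prebundle
  𝒵.lBreveCharts.prebundle.contMDiffVectorBundle 𝓘(ℝ, E)

/-- The bundle `RZ` of affine-homogeneous first-order differential operators `X + h` on `Z`, with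
`X` an affine vector field and `h` a basic function; it is the direct sum of `L̆Z` and the trivial
line bundle. -/
abbrev RBundle : M → Type _ := 𝒵.LBreve ×ᵇ Bundle.Trivial M ℝ

end Instances

end AVBundle

section Affgebroids

/-- The section `f X`. -/
def smulSection {E M : Type*} [NormedAddCommGroup E] [NormedSpace ℝ E]
    [TopologicalSpace M] [ChartedSpace E M] {F : Type*} [NormedAddCommGroup F] [NormedSpace ℝ F]
    {V : M → Type*} [TopologicalSpace (TotalSpace F V)] [∀ m, TopologicalSpace (V m)]
    [∀ m, AddCommGroup (V m)] [∀ m, Module ℝ (V m)] [FiberBundle F V] [VectorBundle ℝ F V]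
    (f : M → ℝ) (hf : ContMDiff 𝓘(ℝ, E) 𝓘(ℝ, ℝ) ∞ f) (X : Cₛ^∞⟮𝓘(ℝ, E); F, V⟯) :
    Cₛ^∞⟮𝓘(ℝ, E); F, V⟯ :=
  ⟨fun m => f m • X m, hf.smul_section X.contMDiff⟩

/-- A Lie algebroid structure on a smooth vector bundle `K` over `M`. -/
structure LieAlgebroid (E : Type*) {M : Type*} [NormedAddCommGroup E] [NormedSpace ℝ E]
    [TopologicalSpace M] [ChartedSpace E M] [IsManifold 𝓘(ℝ, E) ∞ M]
    (F : Type*) [NormedAddCommGroup F] [NormedSpace ℝ F]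
    (K : M → Type*) [TopologicalSpace (TotalSpace F K)] [∀ m, TopologicalSpace (K m)]
    [∀ m, AddCommGroup (K m)] [∀ m, Module ℝ (K m)] [FiberBundle F K] [VectorBundle ℝ F K] where
  bracket : Cₛ^∞⟮𝓘(ℝ, E); F, K⟯ →ₗ[ℝ] Cₛ^∞⟮𝓘(ℝ, E); F, K⟯ →ₗ[ℝ] Cₛ^∞⟮𝓘(ℝ, E); F, K⟯
  bracket_skew : ∀ S T, bracket S T = -bracket T S
  jacobi : ∀ S T R,
    bracket S (bracket T R) + bracket T (bracket R S) + bracket R (bracket S T) = 0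
  anchor : ∀ m : M, K m →ₗ[ℝ] TangentSpace 𝓘(ℝ, E) m
  contMDiff_anchor : ContMDiff (𝓘(ℝ, E).prod 𝓘(ℝ, F)) 𝓘(ℝ, E).tangent ∞
    (fun p : TotalSpace F K => (⟨p.1, anchor p.1 p.2⟩ : TangentBundle 𝓘(ℝ, E) M))
  leibniz : ∀ S (f : M → ℝ) (hf : ContMDiff 𝓘(ℝ, E) 𝓘(ℝ, ℝ) ∞ f) T m,
    bracket S (smulSection f hf T) m = f m • bracket S T m + diffAt E f m (anchor m (S m)) • T m

/-- A smooth affine bundle with fibres `A m`, modelled on a smooth vector bundle `V`. The smooth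
structure is given by local sections, over open sets covering `M`, whose differences are smooth
sections of `V`. Each of them identifies `A` with `V` over its domain, by taking it as the origin. -/
structure SmoothAffineBundle (E : Type*) {M : Type*} [NormedAddCommGroup E] [NormedSpace ℝ E]
    [TopologicalSpace M] [ChartedSpace E M]
    (F : Type*) [NormedAddCommGroup F] [NormedSpace ℝ F]
    (V : M → Type*) [TopologicalSpace (TotalSpace F V)] [∀ m, TopologicalSpace (V m)]
    [∀ m, AddCommGroup (V m)] [∀ m, Module ℝ (V m)] [FiberBundle F V] [VectorBundle ℝ F V]
    (A : M → Type*) [∀ m, AddTorsor (V m) (A m)] where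
  origins : Set (Set M × ∀ m, A m)
  isOpen_fst : ∀ o ∈ origins, IsOpen o.1
  exists_mem : ∀ m : M, ∃ o ∈ origins, m ∈ o.1
  contMDiffOn_vsub : ∀ o ∈ origins, ∀ o' ∈ origins,
    ContMDiffOn 𝓘(ℝ, E) (𝓘(ℝ, E).prod 𝓘(ℝ, F)) ∞
      (fun m => TotalSpace.mk' F m (o.2 m -ᵥ o'.2 m)) (o.1 ∩ o'.1)

/-- A special affine bundle: the model vector bundle has a distinguished nowhere vanishing smooth
section. -/
structure SpecialAffineBundle (E : Type*) {M : Type*} [NormedAddCommGroup E] [NormedSpace ℝ E]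
    [TopologicalSpace M] [ChartedSpace E M]
    (F : Type*) [NormedAddCommGroup F] [NormedSpace ℝ F]
    (V : M → Type*) [TopologicalSpace (TotalSpace F V)] [∀ m, TopologicalSpace (V m)]
    [∀ m, AddCommGroup (V m)] [∀ m, Module ℝ (V m)] [FiberBundle F V] [VectorBundle ℝ F V]
    (A : M → Type*) [∀ m, AddTorsor (V m) (A m)] extends SmoothAffineBundle E F V A where
  unit : Cₛ^∞⟮𝓘(ℝ, E); F, V⟯
  unit_ne_zero : ∀ m, unit m ≠ 0

variable {E M : Type*} [NormedAddCommGroup E] [NormedSpace ℝ E]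
    [TopologicalSpace M] [ChartedSpace E M]
    {F : Type*} [NormedAddCommGroup F] [NormedSpace ℝ F]
    {V : M → Type*} [TopologicalSpace (TotalSpace F V)] [∀ m, TopologicalSpace (V m)]
    [∀ m, AddCommGroup (V m)] [∀ m, Module ℝ (V m)] [FiberBundle F V] [VectorBundle ℝ F V]
    {A : M → Type*} [∀ m, AddTorsor (V m) (A m)]

/-- Smooth global sections of an affine bundle. -/
structure SmoothAffineBundle.Sec (𝒜 : SmoothAffineBundle E F V A) where
  toFun : ∀ m, A m
  contMDiffOn_vsub : ∀ o ∈ 𝒜.origins, ContMDiffOn 𝓘(ℝ, E) (𝓘(ℝ, E).prod 𝓘(ℝ, F)) ∞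
    (fun m => TotalSpace.mk' F m (toFun m -ᵥ o.2 m)) o.1

instance (𝒜 : SmoothAffineBundle E F V A) : CoeFun 𝒜.Sec (fun _ => ∀ m : M, A m) :=
  ⟨SmoothAffineBundle.Sec.toFun⟩

/-- The section `X + σ`. -/
def SmoothAffineBundle.Sec.vadd {𝒜 : SmoothAffineBundle E F V A} (X : Cₛ^∞⟮𝓘(ℝ, E); F, V⟯)
    (σ : 𝒜.Sec) : 𝒜.Sec where
  toFun m := X m +ᵥ σ m
  contMDiffOn_vsub o ho := by
    simp only [vadd_vsub_assoc]
    exact X.contMDiff.contMDiffOn.add_section (σ.contMDiffOn_vsub o ho)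

/-- A Lie affgebroid structure on an affine bundle `A` modelled on `V`: a skew-symmetric bi-affine
bracket of sections of `A` with values in sections of `V`, with the Jacobi identity
`[σ₁, [σ₂, σ₃]]_v + [σ₂, [σ₃, σ₁]]_v + [σ₃, [σ₁, σ₂]]_v = 0`, and an affine bundle morphism
`anchor : A → TM` such that the linear part `[σ, ·]_v` of `[σ, ·]` is a quasi-derivation with anchor
`anchor(σ)`. The bracket is affine in the first argument by skew-symmetry. -/
structure LieAffgebroid [IsManifold 𝓘(ℝ, E) ∞ M] (𝒜 : SmoothAffineBundle E F V A) where
  bracket : 𝒜.Sec → 𝒜.Sec → Cₛ^∞⟮𝓘(ℝ, E); F, V⟯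
  /-- the linear part `[σ, ·]_v` of the affine map `[σ, ·]` -/
  lin : 𝒜.Sec → Cₛ^∞⟮𝓘(ℝ, E); F, V⟯ →ₗ[ℝ] Cₛ^∞⟮𝓘(ℝ, E); F, V⟯
  bracket_vadd : ∀ σ X τ, bracket σ (.vadd X τ) = lin σ X + bracket σ τ
  bracket_skew : ∀ σ τ, bracket σ τ = -bracket τ σ
  jacobi : ∀ σ₁ σ₂ σ₃,
    lin σ₁ (bracket σ₂ σ₃) + lin σ₂ (bracket σ₃ σ₁) + lin σ₃ (bracket σ₁ σ₂) = 0
  anchor : ∀ m : M, A m →ᵃ[ℝ] TangentSpace 𝓘(ℝ, E) m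
  contMDiff_anchor_linear : ContMDiff (𝓘(ℝ, E).prod 𝓘(ℝ, F)) 𝓘(ℝ, E).tangent ∞
    (fun p : TotalSpace F V => (⟨p.1, (anchor p.1).linear p.2⟩ : TangentBundle 𝓘(ℝ, E) M))
  contMDiffOn_anchor : ∀ o ∈ 𝒜.origins, ContMDiffOn 𝓘(ℝ, E) 𝓘(ℝ, E).tangent ∞
    (fun m => (⟨m, anchor m (o.2 m)⟩ : TangentBundle 𝓘(ℝ, E) M)) o.1
  leibniz : ∀ σ (f : M → ℝ) (hf : ContMDiff 𝓘(ℝ, E) 𝓘(ℝ, ℝ) ∞ f) X m,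
    lin σ (smulSection f hf X) m = f m • lin σ X m + diffAt E f m (anchor m (σ m)) • X m

/-- The Lie algebroid `K` together with the embedding `j : A → K` is the Lie algebroid hull of the
Lie affgebroid `A`: `j` is an isomorphism of `A` onto an affine hyperbundle `{φ = 1}` of `K` (so that
`K` is the vector hull of `A` and `φ` corresponds to the constant function `1` on `A`), the bracket
and the anchor of `K` extend those of `A`, and the 1-form `φ` is closed,
`φ([S, T]) = ρ(S)(φ(T)) - ρ(T)(φ(S))`. -/
structure IsLieAlgebroidHull [IsManifold 𝓘(ℝ, E) ∞ M] {𝒜 : SmoothAffineBundle E F V A}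
    (L : LieAffgebroid 𝒜)
    {G : Type*} [NormedAddCommGroup G] [NormedSpace ℝ G]
    {K : M → Type*} [TopologicalSpace (TotalSpace G K)] [∀ m, TopologicalSpace (K m)]
    [∀ m, AddCommGroup (K m)] [∀ m, Module ℝ (K m)] [FiberBundle G K] [VectorBundle ℝ G K]
    (H : LieAlgebroid E G K) (j : ∀ m, A m →ᵃ[ℝ] K m) : Prop where
  injective : ∀ m, Function.Injective (j m)
  contMDiff_linear : ContMDiff (𝓘(ℝ, E).prod 𝓘(ℝ, F)) (𝓘(ℝ, E).prod 𝓘(ℝ, G)) ∞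
    (fun p : TotalSpace F V => TotalSpace.mk' G p.1 ((j p.1).linear p.2))
  contMDiffOn_origin : ∀ o ∈ 𝒜.origins, ContMDiffOn 𝓘(ℝ, E) (𝓘(ℝ, E).prod 𝓘(ℝ, G)) ∞
    (fun m => TotalSpace.mk' G m (j m (o.2 m))) o.1
  bracket_eq : ∀ (σ τ : 𝒜.Sec) (S T : Cₛ^∞⟮𝓘(ℝ, E); G, K⟯), (∀ m, S m = j m (σ m)) →
    (∀ m, T m = j m (τ m)) → ∀ m, H.bracket S T m = (j m).linear (L.bracket σ τ m)
  anchor_eq : ∀ m a, H.anchor m (j m a) = L.anchor m a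
  exists_closed : ∃ φ : ∀ m, K m →ₗ[ℝ] ℝ, (∀ m, Set.range (j m) = {k | φ m k = 1}) ∧
    ∀ (S T : Cₛ^∞⟮𝓘(ℝ, E); G, K⟯) m, φ m (H.bracket S T m) =
      diffAt E (fun x => φ x (T x)) m (H.anchor m (S m)) -
        diffAt E (fun x => φ x (S x)) m (H.anchor m (T m))

end Affgebroids

namespace AVBundle

variable {E M EZ Z : Type*}
  [NormedAddCommGroup E] [NormedSpace ℝ E] [TopologicalSpace M] [ChartedSpace E M]
  [NormedAddCommGroup EZ] [NormedSpace ℝ EZ] [TopologicalSpace Z] [ChartedSpace EZ Z]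
  [AddAction ℝ Z] [FiniteDimensional ℝ E] [IsManifold 𝓘(ℝ, E) ∞ M] [T2Space M]
  [SigmaCompactSpace M] (𝒵 : AVBundle E M EZ Z)

theorem contMDiff_constPhase {f : M → ℝ} (hf : ContMDiff 𝓘(ℝ, E) 𝓘(ℝ, ℝ) ∞ f) :
    ContMDiff 𝓘(ℝ, E) (𝓘(ℝ, E).prod 𝓘(ℝ, E × ℝ)) ∞
      (fun m => TotalSpace.mk' (E × ℝ) m (AffineMap.const ℝ (𝒵.Phase m) (f m))) := by
  refine (𝒵.phaseDualCharts.contMDiff_section_iff (Classical.arbitrary _) _).2 fun x₀ => ?_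
  refine ((contMDiffOn_const (c := (0 : E))).prodMk_space hf.contMDiffOn).congr fun m _ => ?_
  refine Prod.ext ?_ rfl
  have h : (𝒵.phaseDualCharts.chart (Classical.arbitrary _) m
      (AffineMap.const ℝ (𝒵.Phase m) (f m))).1 = 0 := map_zero (tangentOfFunctional m)
  rw [ChartFamily.pretriv_apply]
  simp only
  rw [h, map_zero]

theorem contMDiff_constContact {f : M → ℝ} (hf : ContMDiff 𝓘(ℝ, E) 𝓘(ℝ, ℝ) ∞ f) :
    ContMDiff 𝓘(ℝ, E) (𝓘(ℝ, E).prod 𝓘(ℝ, E × (ℝ × ℝ))) ∞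
      (fun m => TotalSpace.mk' (E × (ℝ × ℝ)) m (AffineMap.const ℝ (𝒵.Contact m) (f m))) := by
  refine (𝒵.contactDualCharts.contMDiff_section_iff (Classical.arbitrary _) _).2 fun x₀ => ?_
  refine ((contMDiffOn_const (c := (0 : E))).prodMk_space
    ((contMDiffOn_const (c := (0 : ℝ))).prodMk_space hf.contMDiffOn)).congr fun m _ => ?_
  have h : contactLinEquiv m (0 : Cotangent E m × ℝ →ₗ[ℝ] ℝ) = 0 := map_zero _
  have h1 : (𝒵.contactDualCharts.chart (Classical.arbitrary _) m
      (AffineMap.const ℝ (𝒵.Contact m) (f m))).1 = 0 := congrArg Prod.fst h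
  have h2 : (𝒵.contactDualCharts.chart (Classical.arbitrary _) m
      (AffineMap.const ℝ (𝒵.Contact m) (f m))).2 = (0, f m) :=
    Prod.ext (congrArg Prod.snd h) rfl
  rw [ChartFamily.pretriv_apply]
  simp only
  rw [h1, h2, map_zero]

theorem contMDiff_apply_phase (X : Cₛ^∞⟮𝓘(ℝ, E); E × ℝ, 𝒵.PhaseDual⟯) (σ : 𝒵.Sec) :
    ContMDiff 𝓘(ℝ, E) 𝓘(ℝ, ℝ) ∞ (fun m => X m (σ.phase m)) := fun x => by
  have h := (contDiff_snd (𝕜 := ℝ) (E := E) (F := ℝ) (n := ∞)).contMDiff.comp_contMDiffOn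
    ((𝒵.phaseDualCharts.contMDiff_section_iff σ _).1 X.contMDiff x)
  exact h.contMDiffAt
    ((trivializationAt E (TangentSpace 𝓘(ℝ, E) (M := M)) x).open_baseSet.mem_nhds
      (FiberBundle.mem_baseSet_trivializationAt' x))

theorem contMDiff_apply_contact (X : Cₛ^∞⟮𝓘(ℝ, E); E × (ℝ × ℝ), 𝒵.ContactDual⟯) (σ : 𝒵.Sec) :
    ContMDiff 𝓘(ℝ, E) 𝓘(ℝ, ℝ) ∞ (fun m => X m (σ.contact m)) := fun x => by
  have h := ((contDiff_snd (𝕜 := ℝ) (E := ℝ) (F := ℝ) (n := ∞)).comp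
    (contDiff_snd (𝕜 := ℝ) (E := E) (F := ℝ × ℝ) (n := ∞))).contMDiff.comp_contMDiffOn
    ((𝒵.contactDualCharts.contMDiff_section_iff σ _).1 X.contMDiff x)
  exact h.contMDiffAt
    ((trivializationAt E (TangentSpace 𝓘(ℝ, E) (M := M)) x).open_baseSet.mem_nhds
      (FiberBundle.mem_baseSet_trivializationAt' x))

/-- The special affine bundle `T̄Z`, with fibres `Aff(P_m Z, Z_m)`. It is trivialized by the sections
with constant values `σ(m)`; the distinguished section of its model bundle is the constant `1`.
Its sections are the affine derivations of `Z` with values in `Z`. -/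
def tBar : SpecialAffineBundle E (E × ℝ) 𝒵.PhaseDual 𝒵.TBar where
  origins := {o | o.1 = Set.univ ∧ ∃ σ : 𝒵.Sec, o.2 = fun m => AffineMap.const ℝ (𝒵.Phase m) (σ m)}
  isOpen_fst o ho := ho.1 ▸ isOpen_univ
  exists_mem m := ⟨⟨Set.univ, _⟩, ⟨rfl, Classical.arbitrary 𝒵.Sec, rfl⟩, trivial⟩
  contMDiffOn_vsub := by
    rintro ⟨_, _⟩ ⟨_, σ, rfl⟩ ⟨_, _⟩ ⟨_, τ, rfl⟩
    exact (𝒵.contMDiff_constPhase (𝒵.contMDiff_sub σ τ)).contMDiffOn.congr fun m _ =>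
      congrArg (TotalSpace.mk' (E × ℝ) m) (AffineMap.ext fun _ => rfl)
  unit := ⟨fun m => AffineMap.const ℝ (𝒵.Phase m) 1, 𝒵.contMDiff_constPhase contMDiff_const⟩
  unit_ne_zero m h := one_ne_zero (DFunLike.congr_fun h ((Classical.arbitrary 𝒵.Sec).phase m))

/-- The special affine bundle `L̄Z`, with fibres `Aff(C_m Z, Z_m)`. Its sections are the affine
first-order differential operators on `Z` with values in `Z`. -/
def lBar : SpecialAffineBundle E (E × (ℝ × ℝ)) 𝒵.ContactDual 𝒵.LBar where
  origins :=
    {o | o.1 = Set.univ ∧ ∃ σ : 𝒵.Sec, o.2 = fun m => AffineMap.const ℝ (𝒵.Contact m) (σ m)}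
  isOpen_fst o ho := ho.1 ▸ isOpen_univ
  exists_mem m := ⟨⟨Set.univ, _⟩, ⟨rfl, Classical.arbitrary 𝒵.Sec, rfl⟩, trivial⟩
  contMDiffOn_vsub := by
    rintro ⟨_, _⟩ ⟨_, σ, rfl⟩ ⟨_, _⟩ ⟨_, τ, rfl⟩
    exact (𝒵.contMDiff_constContact (𝒵.contMDiff_sub σ τ)).contMDiffOn.congr fun m _ =>
      congrArg (TotalSpace.mk' (E × (ℝ × ℝ)) m) (AffineMap.ext fun _ => rfl)
  unit := ⟨fun m => AffineMap.const ℝ (𝒵.Contact m) 1, 𝒵.contMDiff_constContact contMDiff_const⟩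
  unit_ne_zero m h := one_ne_zero (DFunLike.congr_fun h ((Classical.arbitrary 𝒵.Sec).contact m))

/-- The affine derivation `σ ↦ D(σ)`, `D(σ)(m) = D_m(𝐝σ(m))`, of sections of `Z`. -/
def actT (D : 𝒵.tBar.Sec) (σ : 𝒵.Sec) : 𝒵.Sec where
  toFun m := D m (σ.phase m)
  contMDiff_toFun := by
    let s : 𝒵.Sec := Classical.arbitrary 𝒵.Sec
    have h := D.contMDiffOn_vsub (Set.univ, fun m => AffineMap.const ℝ (𝒵.Phase m) (s m))
      ⟨rfl, s, rfl⟩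
    let X : Cₛ^∞⟮𝓘(ℝ, E); E × ℝ, 𝒵.PhaseDual⟯ := ⟨_, contMDiffOn_univ.1 h⟩
    have h2 := 𝒵.contMDiff_vadd.comp ((𝒵.contMDiff_apply_phase X σ).prodMk s.contMDiff_toFun)
    refine h2.congr fun m => ?_
    exact (congrArg Subtype.val (vsub_vadd (D m (σ.phase m)) (s m))).symm

/-- The affine first-order operator `σ ↦ D(σ)`, `D(σ)(m) = D_m(𝐜σ(m))`, on sections of `Z`. -/
def actL (D : 𝒵.lBar.Sec) (σ : 𝒵.Sec) : 𝒵.Sec where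
  toFun m := D m (σ.contact m)
  contMDiff_toFun := by
    let s : 𝒵.Sec := Classical.arbitrary 𝒵.Sec
    have h := D.contMDiffOn_vsub (Set.univ, fun m => AffineMap.const ℝ (𝒵.Contact m) (s m))
      ⟨rfl, s, rfl⟩
    let X : Cₛ^∞⟮𝓘(ℝ, E); E × (ℝ × ℝ), 𝒵.ContactDual⟯ := ⟨_, contMDiffOn_univ.1 h⟩
    have h2 := 𝒵.contMDiff_vadd.comp ((𝒵.contMDiff_apply_contact X σ).prodMk s.contMDiff_toFun)
    refine h2.congr fun m => ?_
    exact (congrArg Subtype.val (vsub_vadd (D m (σ.contact m)) (s m))).symm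

/-- The derivative of a function on `Z` along an element of `L̆Z`. -/
def LBreve.apply {𝒵 : AVBundle E M EZ Z} {m : M} (X : 𝒵.LBreve m) (f : Z → ℝ) (z : 𝒵.Fiber m) : ℝ :=
  diffAt EZ f z.1 (X.field z)

/-- The element `X + h` of `RZ` applied to a function on `Z`: `X(f) + h f`. -/
def RBundle.apply {𝒵 : AVBundle E M EZ Z} {m : M} (P : 𝒵.RBundle m) (f : Z → ℝ)
    (z : 𝒵.Fiber m) : ℝ :=
  P.1.apply f z + (P.2 : ℝ) * f z.1

/-- A section of `L̆Z` as a vector field on `Z`, acting on functions. -/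
def opL (S : Cₛ^∞⟮𝓘(ℝ, E); E × (ℝ × ℝ), 𝒵.LBreve⟯) (f : Z → ℝ) (z : Z) : ℝ :=
  (S (𝒵.proj z)).apply f (𝒵.toFiber z)

/-- A section of `RZ` as a first-order differential operator on functions on `Z`. -/
def opR (S : Cₛ^∞⟮𝓘(ℝ, E); (E × (ℝ × ℝ)) × ℝ, 𝒵.RBundle⟯) (f : Z → ℝ) (z : Z) : ℝ :=
  RBundle.apply (S (𝒵.proj z)) f (𝒵.toFiber z)

end AVBundle

end

/-! A section σ identifies `Z` with M × ℝ. In the fibre coordinate t = z − σ(m) = −F_σ(z), an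
element of L̆Z is a triple (u, a, b): it projects to u and maps F_σ to ta + b. A smooth field on `Z`
is a section of L̆Z as soon as its projection is constant along the fibres and it maps F_σ to a
function affine on the fibres with smooth slope. Both properties pass to commutators, so the Lie
bracket of two sections of L̆Z is again one (`exists_opL_commutator`), and the a-component of [X, Y]
is u_X(a_Y) − u_Y(a_X). For operators X + h and Y + k the function component of the commutator is
likewise u_X(k) − u_Y(h). The operators represent sections faithfully, so the Lie algebroid axioms
are inherited from the associative algebra of operators (`exists_lieAlgebroid_of_operators`).

The requirement j(D)(F_τ) = F_{D(τ)} fixes the coordinates of j(D). For D in T̄Z, u is the principal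
symbol, a = −1 and b = D(σ) − σ. For D in L̄Z whose linear part is (η, r) ↦ η(u) + αr, one gets h =
α and a = α − 1. Hence the images are the hyperbundles φ = 1, where φ = −a on L̆Z (intrinsically,
[X_Z, X] = φ(X) X_Z) and φ = h − a on RZ. The formulas above for the components of commutators say
that φ is closed.

The rest is general (`exists_lieAffgebroid_of_hyperbundle`): φ is constant on sections of the
hyperbundle, so closedness places their brackets in the kernel of φ, which is the model bundle, and
the affgebroid axioms are restrictions of those of the Lie algebroid. Evaluating operators on the
functions F_τ identifies this bracket with D ∘ D' − D' ∘ D. -/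

noncomputable section

/-! ### The Lie bracket of vector fields as a commutator of derivations -/

section VectorFields

variable {E M : Type*} [NormedAddCommGroup E] [NormedSpace ℝ E]
  [TopologicalSpace M] [ChartedSpace E M] [IsManifold 𝓘(ℝ, E) ∞ M]

/-- The derivative of a smooth function along a smooth vector field is smooth. -/
theorem contMDiffAt_diffAt_apply {f : M → ℝ} {V : ∀ x : M, TangentSpace 𝓘(ℝ, E) x} {x : M}
    (hf : ContMDiff 𝓘(ℝ, E) 𝓘(ℝ, ℝ) ∞ f)
    (hV : ContMDiffAt 𝓘(ℝ, E) 𝓘(ℝ, E).tangent ∞ (fun y => (⟨y, V y⟩ : TangentBundle 𝓘(ℝ, E) M)) x) :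
    ContMDiffAt 𝓘(ℝ, E) 𝓘(ℝ, ℝ) ∞ (fun y => diffAt E f y (V y)) x := by
  have h1 := (hf.contMDiff_tangentMap (m := ∞) (by simp)).contMDiffAt.comp x hV
  have h2 := (contMDiff_snd_tangentBundle_modelSpace (n := ∞) ℝ 𝓘(ℝ, ℝ)).contMDiffAt.comp x h1
  exact h2

/-- Smoothness is wanted on a neighbourhood, not only at x: in an iterated bracket [V, [W, fU]](x)
the inner bracket must be expanded near x before it is differentiated. -/
theorem eventually_contMDiffAt_extend (x : M) (v : TangentSpace 𝓘(ℝ, E) x) :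
    ∀ᶠ y in nhds x, ContMDiffAt 𝓘(ℝ, E) 𝓘(ℝ, E).tangent ∞
      (fun y => (⟨y, FiberBundle.extend E v y⟩ : TangentBundle 𝓘(ℝ, E) M)) y := by
  obtain ⟨s, hs, h⟩ := FiberBundle.exists_contMDiffOn_extend (k := ∞) 𝓘(ℝ, E) E v
  filter_upwards [eventually_mem_nhds_iff.2 hs] with y hy
  exact h.contMDiffAt hy

/-- A bracket costs one derivative, which is free at order ∞; the instances below only express ∞ + 1
= ∞ and 2 ≤ ∞. -/
theorem contMDiffAt_mlieBracket [CompleteSpace E] {V W : ∀ x : M, TangentSpace 𝓘(ℝ, E) x} {x : M}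
    (hV : ContMDiffAt 𝓘(ℝ, E) 𝓘(ℝ, E).tangent ∞ (fun y => (⟨y, V y⟩ : TangentBundle 𝓘(ℝ, E) M)) x)
    (hW : ContMDiffAt 𝓘(ℝ, E) 𝓘(ℝ, E).tangent ∞
      (fun y => (⟨y, W y⟩ : TangentBundle 𝓘(ℝ, E) M)) x) :
    ContMDiffAt 𝓘(ℝ, E) 𝓘(ℝ, E).tangent ∞
      (fun y => (⟨y, VectorField.mlieBracket 𝓘(ℝ, E) V W y⟩ : TangentBundle 𝓘(ℝ, E) M)) x :=
  haveI : IsManifold 𝓘(ℝ, E) (((⊤ : ℕ∞) : WithTop ℕ∞) + 1) M := by simpa using ‹IsManifold _ ∞ M›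
  haveI : IsManifold 𝓘(ℝ, E) (minSmoothness ℝ 2) M := IsManifold.of_le (n := ∞)
    (by rw [minSmoothness_of_isRCLikeNormedField]; exact WithTop.coe_le_coe.2 le_top)
  ContMDiffAt.mlieBracket_vectorField (m := ⊤) (n := ⊤) hV hW (by simp)

/-- The Lie bracket of vector fields acts on functions as the commutator. -/
theorem diffAt_mlieBracket [CompleteSpace E] {V W : ∀ x : M, TangentSpace 𝓘(ℝ, E) x}
    (hV : ContMDiff 𝓘(ℝ, E) 𝓘(ℝ, E).tangent ∞ (fun y => (⟨y, V y⟩ : TangentBundle 𝓘(ℝ, E) M)))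
    (hW : ContMDiff 𝓘(ℝ, E) 𝓘(ℝ, E).tangent ∞ (fun y => (⟨y, W y⟩ : TangentBundle 𝓘(ℝ, E) M)))
    {f : M → ℝ} (hf : ContMDiff 𝓘(ℝ, E) 𝓘(ℝ, ℝ) ∞ f) (x : M) :
    diffAt E f x (VectorField.mlieBracket 𝓘(ℝ, E) V W x) =
      diffAt E (fun y => diffAt E f y (W y)) x (V x) -
        diffAt E (fun y => diffAt E f y (V y)) x (W x) := by
  -- The argument compares coefficients of a nonzero tangent vector. In a zero tangent space there
  -- is none, but then both sides vanish.
  by_cases hE : ∀ v : TangentSpace 𝓘(ℝ, E) x, v = 0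
  · rw [hE (V x), hE (W x), hE (VectorField.mlieBracket 𝓘(ℝ, E) V W x)]
    simp
  push Not at hE
  obtain ⟨v, hv⟩ := hE
  -- U is an auxiliary local field with U(x) = v ≠ 0. The identity is read off from the Jacobi
  -- identity for V, W and fU.
  let U : ∀ y : M, TangentSpace 𝓘(ℝ, E) y := FiberBundle.extend E v
  have hUx : U x = v := by simp [U]
  have hU := eventually_contMDiffAt_extend x v
  have : IsManifold 𝓘(ℝ, E) 2 M := IsManifold.of_le (n := ∞) (WithTop.coe_le_coe.2 le_top)
  have : IsManifold 𝓘(ℝ, E) (minSmoothness ℝ 3) M :=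
    IsManifold.of_le (n := ∞)
      (by rw [minSmoothness_of_isRCLikeNormedField]; exact WithTop.coe_le_coe.2 le_top)
  have hfd : ∀ y, MDifferentiableAt 𝓘(ℝ, E) 𝓘(ℝ, ℝ) f y := fun y =>
    (hf y).mdifferentiableAt (by simp)
  -- the second brackets
  have key : ∀ {V W : ∀ x : M, TangentSpace 𝓘(ℝ, E) x},
      ContMDiff 𝓘(ℝ, E) 𝓘(ℝ, E).tangent ∞ (fun y => (⟨y, V y⟩ : TangentBundle 𝓘(ℝ, E) M)) →
      ContMDiff 𝓘(ℝ, E) 𝓘(ℝ, E).tangent ∞ (fun y => (⟨y, W y⟩ : TangentBundle 𝓘(ℝ, E) M)) →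
      VectorField.mlieBracket 𝓘(ℝ, E) V (VectorField.mlieBracket 𝓘(ℝ, E) W (f • U)) x =
        (diffAt E (fun y => diffAt E f y (W y)) x (V x) • U x +
          diffAt E f x (W x) • VectorField.mlieBracket 𝓘(ℝ, E) V U x) +
        (diffAt E f x (V x) • VectorField.mlieBracket 𝓘(ℝ, E) W U x +
          f x • VectorField.mlieBracket 𝓘(ℝ, E) V (VectorField.mlieBracket 𝓘(ℝ, E) W U) x) := by
    intro V W hV hW
    let g : M → ℝ := fun y => diffAt E f y (W y)
    have hg : ContMDiffAt 𝓘(ℝ, E) 𝓘(ℝ, ℝ) ∞ g x := contMDiffAt_diffAt_apply hf (hW x)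
    have hUd := hU.self_of_nhds.mdifferentiableAt (by simp : (∞ : WithTop ℕ∞) ≠ 0)
    have hWU := (contMDiffAt_mlieBracket (hW x) hU.self_of_nhds).mdifferentiableAt
      (by simp : (∞ : WithTop ℕ∞) ≠ 0)
    have h1 : VectorField.mlieBracket 𝓘(ℝ, E) W (f • U) =ᶠ[nhds x]
        g • U + f • VectorField.mlieBracket 𝓘(ℝ, E) W U := by
      filter_upwards [hU] with y hy
      exact VectorField.mlieBracket_smul_right (hfd y) (hy.mdifferentiableAt (by simp))
    rw [Filter.EventuallyEq.mlieBracket_vectorField_eq (V := V) (V₁ := V) (.refl _ _) h1,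
      VectorField.mlieBracket_add_right, VectorField.mlieBracket_smul_right
        (hg.mdifferentiableAt (by simp)) hUd, VectorField.mlieBracket_smul_right (hfd x) hWU]
    · rfl
    · exact (hg.smul_section hU.self_of_nhds).mdifferentiableAt (by simp)
    · exact ((hf x).smul_section (contMDiffAt_mlieBracket (hW x) hU.self_of_nhds)).mdifferentiableAt
        (by simp)
  have hle : minSmoothness ℝ 2 ≤ (∞ : WithTop ℕ∞) := by
    rw [minSmoothness_of_isRCLikeNormedField]
    exact WithTop.coe_le_coe.2 le_top
  have hfU : ContMDiffAt 𝓘(ℝ, E) 𝓘(ℝ, E).tangent ∞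
      (fun y => (⟨y, (f • U) y⟩ : TangentBundle 𝓘(ℝ, E) M)) x :=
    (hf x).smul_section hU.self_of_nhds
  -- In the Jacobi identity for V, W, fU the terms df(V)[W, U] + df(W)[V, U] are symmetric and drop
  -- out, as do f times the Jacobi identity for V, W, U and the term f [[V, W], U]. What remains is
  -- a multiple of v whose coefficient is the claimed identity.
  have h1 := VectorField.leibniz_identity_mlieBracket_apply (I := 𝓘(ℝ, E))
    ((hV x).of_le hle) ((hW x).of_le hle) (hfU.of_le hle)
  have h2 := VectorField.leibniz_identity_mlieBracket_apply (I := 𝓘(ℝ, E))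
    ((hV x).of_le hle) ((hW x).of_le hle) (hU.self_of_nhds.of_le hle)
  have h3 := VectorField.mlieBracket_smul_right (I := 𝓘(ℝ, E))
    (V := VectorField.mlieBracket 𝓘(ℝ, E) V W) (hfd x)
    (hU.self_of_nhds.mdifferentiableAt (by simp))
  rw [key hV hW, key hW hV, h3] at h1
  change VectorField.mlieBracket 𝓘(ℝ, E) V (VectorField.mlieBracket 𝓘(ℝ, E) W U) x = _ at h2
  have h4 : (diffAt E f x (VectorField.mlieBracket 𝓘(ℝ, E) V W x) -
      (diffAt E (fun y => diffAt E f y (W y)) x (V x) -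
        diffAt E (fun y => diffAt E f y (V y)) x (W x))) • v = 0 := by
    rw [h2] at h1
    rw [← hUx, sub_smul, sub_smul]
    change _ = (diffAt E f x (VectorField.mlieBracket 𝓘(ℝ, E) V W x) • U x + _) + _ at h1
    rw [smul_add] at h1
    have h5 := sub_eq_zero.2 h1
    rw [← neg_eq_zero]
    rw [← h5]
    abel
  exact sub_eq_zero.1 ((smul_eq_zero.1 h4).resolve_right hv)

end VectorFields

/-! ### Affine hyperbundles of Lie algebroids with a closed 1-form -/

section Hull
variable {E M : Type*} [NormedAddCommGroup E] [NormedSpace ℝ E]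
    [TopologicalSpace M] [ChartedSpace E M]
    {F : Type*} [NormedAddCommGroup F] [NormedSpace ℝ F]
    {V : M → Type*} [TopologicalSpace (TotalSpace F V)] [∀ m, TopologicalSpace (V m)]
    [∀ m, AddCommGroup (V m)] [∀ m, Module ℝ (V m)] [FiberBundle F V] [VectorBundle ℝ F V]
    {A : M → Type*} [∀ m, AddTorsor (V m) (A m)] {𝒜 : SmoothAffineBundle E F V A}
    {G : Type*} [NormedAddCommGroup G] [NormedSpace ℝ G]
    {K : M → Type*} [TopologicalSpace (TotalSpace G K)] [∀ m, TopologicalSpace (K m)]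
    [∀ m, AddCommGroup (K m)] [∀ m, Module ℝ (K m)] [FiberBundle G K] [VectorBundle ℝ G K]

/-- A smooth morphism from an affine bundle to a vector bundle maps smooth sections to smooth
sections. -/
theorem SmoothAffineBundle.Sec.contMDiff_map {j : ∀ m, A m →ᵃ[ℝ] K m}
    (hlin : ContMDiff (𝓘(ℝ, E).prod 𝓘(ℝ, F)) (𝓘(ℝ, E).prod 𝓘(ℝ, G)) ∞
      (fun p : TotalSpace F V => TotalSpace.mk' G p.1 ((j p.1).linear p.2)))
    (horig : ∀ o ∈ 𝒜.origins, ContMDiffOn 𝓘(ℝ, E) (𝓘(ℝ, E).prod 𝓘(ℝ, G)) ∞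
      (fun m => TotalSpace.mk' G m (j m (o.2 m))) o.1) (σ : 𝒜.Sec) :
    ContMDiff 𝓘(ℝ, E) (𝓘(ℝ, E).prod 𝓘(ℝ, G)) ∞ (fun m => TotalSpace.mk' G m (j m (σ m))) := by
  intro x
  obtain ⟨o, ho, hx⟩ := 𝒜.exists_mem x
  -- Near x the image is j(σ) = j_v(σ − o) + j(o) for a local origin o, and both summands are
  -- smooth.
  have h1 := (hlin.comp_contMDiffOn (σ.contMDiffOn_vsub o ho)).add_section (horig o ho)
  refine (h1.congr fun m _ => congrArg (TotalSpace.mk' G m) ?_).contMDiffAt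
    ((𝒜.isOpen_fst o ho).mem_nhds hx)
  change _ = (j m).linear (σ m -ᵥ o.2 m) + j m (o.2 m)
  rw [(j m).linearMap_vsub]
  simp

variable [IsManifold 𝓘(ℝ, E) ∞ M]

theorem IsLieAlgebroidHull.exists_section {L : LieAffgebroid 𝒜} {H : LieAlgebroid E G K}
    {j : ∀ m, A m →ᵃ[ℝ] K m} (h : IsLieAlgebroidHull L H j) (σ : 𝒜.Sec) :
    ∃ S : Cₛ^∞⟮𝓘(ℝ, E); G, K⟯, ∀ m, S m = j m (σ m) :=
  ⟨⟨_, σ.contMDiff_map h.contMDiff_linear h.contMDiffOn_origin⟩, fun _ => rfl⟩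

/-- A Lie algebroid with a closed 1-form `φ` induces a Lie affgebroid structure on the affine
hyperbundle `{φ = 1}`, and it is the Lie algebroid hull of the latter. -/
theorem exists_lieAffgebroid_of_hyperbundle (H : LieAlgebroid E G K) (j : ∀ m, A m →ᵃ[ℝ] K m)
    (φ : ∀ m, K m →ₗ[ℝ] ℝ) (hinj : ∀ m, Function.Injective (j m))
    (hrange : ∀ m, Set.range (j m) = {k | φ m k = 1})
    (hclosed : ∀ (S T : Cₛ^∞⟮𝓘(ℝ, E); G, K⟯) m, φ m (H.bracket S T m) =
      diffAt E (fun x => φ x (T x)) m (H.anchor m (S m)) -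
        diffAt E (fun x => φ x (S x)) m (H.anchor m (T m)))
    (hlin : ContMDiff (𝓘(ℝ, E).prod 𝓘(ℝ, F)) (𝓘(ℝ, E).prod 𝓘(ℝ, G)) ∞
      (fun p : TotalSpace F V => TotalSpace.mk' G p.1 ((j p.1).linear p.2)))
    (horig : ∀ o ∈ 𝒜.origins, ContMDiffOn 𝓘(ℝ, E) (𝓘(ℝ, E).prod 𝓘(ℝ, G)) ∞
      (fun m => TotalSpace.mk' G m (j m (o.2 m))) o.1)
    (hlift : ∀ X : ∀ m, V m, ContMDiff 𝓘(ℝ, E) (𝓘(ℝ, E).prod 𝓘(ℝ, G)) ∞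
      (fun m => TotalSpace.mk' G m ((j m).linear (X m))) →
      ContMDiff 𝓘(ℝ, E) (𝓘(ℝ, E).prod 𝓘(ℝ, F)) ∞ (fun m => TotalSpace.mk' F m (X m))) :
    ∃ L : LieAffgebroid 𝒜, IsLieAlgebroidHull L H j := by
  have hφj : ∀ m a, φ m (j m a) = 1 := fun m a =>
    (Set.ext_iff.1 (hrange m) (j m a)).1 ⟨a, rfl⟩
  have hlinj : ∀ m, Function.Injective (j m).linear := fun m =>
    (j m).linear_injective_iff.2 (hinj m)
  have hφl : ∀ m v, φ m ((j m).linear v) = 0 := fun m v => by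
    obtain ⟨a⟩ := (inferInstance : Nonempty (A m))
    have h := hφj m (v +ᵥ a)
    rw [(j m).map_vadd, vadd_eq_add, map_add, hφj] at h
    linarith
  -- The kernel of φ is all of the image of j_v: translating k in the kernel by some j(a) gives a
  -- point of the hyperplane, hence some j(b), and then k = j_v(b − a).
  have hker : ∀ m k, φ m k = 0 → ∃ v, (j m).linear v = k := fun m k hk => by
    obtain ⟨a⟩ := (inferInstance : Nonempty (A m))
    obtain ⟨b, hb⟩ := (Set.ext_iff.1 (hrange m) (k + j m a)).2 (by simp [hk, hφj])
    refine ⟨b -ᵥ a, ?_⟩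
    rw [(j m).linearMap_vsub, hb]
    simp
  let jV : Cₛ^∞⟮𝓘(ℝ, E); F, V⟯ →ₗ[ℝ] Cₛ^∞⟮𝓘(ℝ, E); G, K⟯ :=
    { toFun := fun X => ⟨fun m => (j m).linear (X m), hlin.comp X.contMDiff⟩
      map_add' := fun X Y => by ext m; exact map_add (j m).linear _ _
      map_smul' := fun c X => by ext m; exact map_smul (j m).linear _ _ }
  have jV_apply : ∀ X m, jV X m = (j m).linear (X m) := fun _ _ => rfl
  have jV_inj : Function.Injective jV := fun X Y h => by
    ext m
    exact hlinj m (DFunLike.congr_fun h m)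
  have hex : ∀ S : Cₛ^∞⟮𝓘(ℝ, E); G, K⟯, (∀ m, φ m (S m) = 0) → ∃ X, jV X = S := fun S hS => by
    choose X hX using fun m => hker m (S m) (hS m)
    -- The pointwise preimage is unique but smooth only thanks to `hlift`, which replaces a smooth
    -- left inverse of j_v.
    refine ⟨⟨X, hlift X ?_⟩, ?_⟩
    · exact S.contMDiff.congr fun m => congrArg (TotalSpace.mk' G m) (hX m)
    · ext m
      exact hX m
  let jA : 𝒜.Sec → Cₛ^∞⟮𝓘(ℝ, E); G, K⟯ := fun σ =>
    ⟨fun m => j m (σ m), σ.contMDiff_map hlin horig⟩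
  have jA_vadd : ∀ X σ, jA (.vadd X σ) = jV X + jA σ := fun X σ => by
    ext m
    exact (j m).map_vadd (σ m) (X m)
  -- φ is 1 on `jA σ` and 0 on `jV X`. Its derivatives in the closedness formula then vanish, so the
  -- brackets here and in `hl` lie in the kernel of φ and come from sections of the model bundle.
  have hb : ∀ σ τ m, φ m (H.bracket (jA σ) (jA τ) m) = 0 := fun σ τ m => by
    have h : ∀ ρ, (fun x => φ x (jA ρ x)) = fun _ => 1 := fun ρ => funext fun x => hφj x (ρ x)
    rw [hclosed, h, h, diffAt_const]
    simp
  have hl : ∀ σ X m, φ m (H.bracket (jA σ) (jV X) m) = 0 := fun σ X m => by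
    have h : ∀ ρ, (fun x => φ x (jA ρ x)) = fun _ => 1 := fun ρ => funext fun x => hφj x (ρ x)
    have h' : (fun x => φ x (jV X x)) = fun _ => 0 := funext fun x => hφl x (X x)
    rw [hclosed, h, h', diffAt_const, diffAt_const]
    simp
  choose br hbr using fun σ τ => hex _ (hb σ τ)
  choose li hli using fun σ X => hex _ (hl σ X)
  -- As `jV` is injective, every axiom may be checked in K, where it is an axiom of the Lie
  -- algebroid.
  let L : LieAffgebroid 𝒜 :=
    { bracket := br
      lin := fun σ =>
        { toFun := li σ
          map_add' := fun X Y => jV_inj (by simp only [map_add, hli])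
          map_smul' := fun c X => jV_inj (by simp only [map_smul, hli, RingHom.id_apply]) }
      bracket_vadd := fun σ X τ => jV_inj (by
        change _ = jV (li σ X + br σ τ)
        rw [map_add, hbr, hbr, hli, jA_vadd, map_add])
      bracket_skew := fun σ τ => jV_inj (by rw [map_neg, hbr, hbr, H.bracket_skew])
      jacobi := fun σ₁ σ₂ σ₃ => jV_inj (by
        change jV (li _ _ + li _ _ + li _ _) = _
        rw [map_add, map_add, hli, hli, hli, hbr, hbr, hbr, H.jacobi, map_zero])
      anchor := fun m => (H.anchor m).toAffineMap.comp (j m)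
      contMDiff_anchor_linear := H.contMDiff_anchor.comp hlin
      contMDiffOn_anchor := fun o ho => H.contMDiff_anchor.comp_contMDiffOn (horig o ho)
      leibniz := fun σ f hf X m => hlinj m (by
        have h : jV (smulSection f hf X) = smulSection f hf (jV X) := by
          ext m
          exact map_smul (j m).linear _ _
        change jV (li σ (smulSection f hf X)) m =
          (j m).linear (f m • li σ X m + diffAt E f m (H.anchor m (jA σ m)) • X m)
        rw [hli, h, H.leibniz, ← hli, map_add, map_smul, map_smul, jV_apply, jV_apply]) }
  refine ⟨L, hinj, hlin, horig, fun σ τ S T hS hT m => ?_, fun _ _ => rfl, φ, hrange, hclosed⟩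
  have h1 : S = jA σ := by ext m; exact hS m
  have h2 : T = jA τ := by ext m; exact hT m
  rw [h1, h2, ← hbr]
  rfl

end Hull

/-! ### Smoothness in a vector bundle read in coordinates -/

section Operators

variable {E M : Type*} [NormedAddCommGroup E] [NormedSpace ℝ E]
  [TopologicalSpace M] [ChartedSpace E M]

/-- Trivializations of the direct sum are products, and on the trivial summand the coordinate is the
value itself. -/
theorem contMDiffAt_prod_trivial_iff {F : Type*} [NormedAddCommGroup F] [NormedSpace ℝ F]
    {V : M → Type*} [TopologicalSpace (TotalSpace F V)] [∀ m, TopologicalSpace (V m)]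
    [∀ m, AddCommGroup (V m)] [FiberBundle F V] {EN HN N : Type*} [NormedAddCommGroup EN] [NormedSpace ℝ EN]
    [TopologicalSpace HN] {I : ModelWithCorners ℝ EN HN} [TopologicalSpace N] [ChartedSpace HN N]
    (f : N → TotalSpace (F × ℝ) (V ×ᵇ Bundle.Trivial M ℝ)) (x : N) :
    ContMDiffAt I (𝓘(ℝ, E).prod 𝓘(ℝ, F × ℝ)) ∞ f x ↔
      ContMDiffAt I (𝓘(ℝ, E).prod 𝓘(ℝ, F)) ∞ (fun y => TotalSpace.mk' F (f y).1 (f y).2.1) x ∧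
      ContMDiffAt I 𝓘(ℝ, ℝ) ∞ (fun y => ((f y).2.2 : ℝ)) x := by
  rw [Bundle.contMDiffAt_totalSpace, Bundle.contMDiffAt_totalSpace, and_assoc]
  exact and_congr_right fun hp => contMDiffAt_prod_module_iff _

variable [IsManifold 𝓘(ℝ, E) ∞ M]

/-- A map to a vector bundle is smooth if and only if its components in a chart are. -/
theorem ChartFamily.contMDiffAt_iff {ι W : Type*} [NormedAddCommGroup W] [NormedSpace ℝ W]
    {V : M → Type*} [∀ m, AddCommGroup (V m)] [∀ m, Module ℝ (V m)] (c : ChartFamily E ι W V)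
    [Nonempty ι] (i : ι) {EN HN N : Type*} [NormedAddCommGroup EN] [NormedSpace ℝ EN]
    [TopologicalSpace HN] {I : ModelWithCorners ℝ EN HN} [TopologicalSpace N] [ChartedSpace HN N]
    (f : N → TotalSpace (E × W) V) (x : N) :
    letI := c.fiberTopology
    letI := c.prebundle.totalSpaceTopology
    letI := c.prebundle.toFiberBundle
    ContMDiffAt I (𝓘(ℝ, E).prod 𝓘(ℝ, E × W)) ∞ f x ↔
      ContMDiffAt I 𝓘(ℝ, E).tangent ∞
        (fun y => (⟨(f y).1, (c.chart i _ (f y).2).1⟩ : TangentBundle 𝓘(ℝ, E) M)) x ∧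
      ContMDiffAt I 𝓘(ℝ, W) ∞ (fun y => (c.chart i _ (f y).2).2) x := by
  let _ := c.fiberTopology
  let _ := c.prebundle.totalSpaceTopology
  let _ := c.prebundle.toFiberBundle
  have _ := c.prebundle.toVectorBundle
  have : c.prebundle.IsContMDiff 𝓘(ℝ, E) ∞ := c.isContMDiff_prebundle
  have : ContMDiffVectorBundle ∞ (E × W) V 𝓘(ℝ, E) := c.prebundle.contMDiffVectorBundle 𝓘(ℝ, E)
  let x₀ : M := (f x).1
  let t := trivializationAt E (TangentSpace 𝓘(ℝ, E) (M := M)) x₀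
  have hx₀ : x₀ ∈ t.baseSet := FiberBundle.mem_baseSet_trivializationAt' x₀
  -- The chart `i` combined with the tangent trivialization centred at the base point of f(x)
  -- belongs to the bundle atlas, so smoothness at x may be tested in it.
  have hmem : c.pretriv x₀ i ∈ c.prebundle.pretrivializationAtlas := ⟨(x₀, i), rfl⟩
  let e := c.prebundle.toFiberPrebundle.trivializationOfMemPretrivializationAtlas hmem
  have : MemTrivializationAtlas e := ⟨⟨_, hmem, rfl⟩⟩
  have h1 := e.contMDiffAt_iff (n := ∞) (IM := I) (IB := 𝓘(ℝ, E)) (f := f) (x₀ := x)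
    (e.mem_source.2 hx₀)
  have h2 := t.contMDiffAt_iff (n := ∞) (IM := I) (IB := 𝓘(ℝ, E))
    (f := fun y => (⟨(f y).1, (c.chart i _ (f y).2).1⟩ : TangentBundle 𝓘(ℝ, E) M)) (x₀ := x)
    (t.mem_source.2 hx₀)
  refine h1.trans (Iff.trans ?_ (and_congr_left' h2.symm))
  rw [and_assoc]
  refine and_congr_right fun hp => ?_
  -- The fibrewise linear map of a trivialization is the true coordinate only over the base set;
  -- continuity of the projection keeps nearby points there.
  have h3 : ∀ᶠ y in nhds x, (f y).1 ∈ t.baseSet :=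
    hp.continuousAt.eventually (t.open_baseSet.mem_nhds hx₀)
  refine contMDiffAt_prod_module_iff _ |>.trans (and_congr_left' ?_)
  refine Filter.EventuallyEq.contMDiffAt_iff ?_
  filter_upwards [h3] with y hy
  exact t.continuousLinearMapAt_apply_of_mem (R := ℝ) hy _

end Operators

theorem diffAt_mul {E M : Type*} [NormedAddCommGroup E] [NormedSpace ℝ E]
    [TopologicalSpace M] [ChartedSpace E M] {f g : M → ℝ} {m : M}
    (hf : MDifferentiableAt 𝓘(ℝ, E) 𝓘(ℝ, ℝ) f m) (hg : MDifferentiableAt 𝓘(ℝ, E) 𝓘(ℝ, ℝ) g m) :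
    diffAt E (fun x => f x * g x) m = f m • diffAt E g m + g m • diffAt E f m :=
  (hf.hasMFDerivAt.mul hg.hasMFDerivAt).mfderiv

/-! ### Lie algebroids from faithful families of operators -/

section OfOperators

variable {E M : Type*} [NormedAddCommGroup E] [NormedSpace ℝ E]
  [TopologicalSpace M] [ChartedSpace E M] [IsManifold 𝓘(ℝ, E) ∞ M]
  {EZ Z : Type*} [NormedAddCommGroup EZ] [NormedSpace ℝ EZ] [TopologicalSpace Z]
  [ChartedSpace EZ Z]
  {F : Type*} [NormedAddCommGroup F] [NormedSpace ℝ F]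
  {K : M → Type*} [TopologicalSpace (TotalSpace F K)] [∀ m, TopologicalSpace (K m)]
  [∀ m, AddCommGroup (K m)] [∀ m, Module ℝ (K m)] [FiberBundle F K] [VectorBundle ℝ F K]

/-- A faithful representation of the sections of a vector bundle over `M` by operators on the
functions on a manifold over `M`, closed under commutators, defines a Lie algebroid. -/
theorem exists_lieAlgebroid_of_operators (p : Z → M) (hp : ContMDiff 𝓘(ℝ, EZ) 𝓘(ℝ, E) ∞ p)
    (op : Cₛ^∞⟮𝓘(ℝ, E); F, K⟯ →ₗ[ℝ] Module.End ℝ C^∞⟮𝓘(ℝ, EZ), Z; 𝓘(ℝ, ℝ), ℝ⟯)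
    (hinj : Function.Injective op) (hcomm : ∀ S T, ∃ R, op R = op S * op T - op T * op S)
    (ρ : ∀ m : M, K m →ₗ[ℝ] TangentSpace 𝓘(ℝ, E) m)
    (hρ : ContMDiff (𝓘(ℝ, E).prod 𝓘(ℝ, F)) 𝓘(ℝ, E).tangent ∞
      (fun q : TotalSpace F K => (⟨q.1, ρ q.1 q.2⟩ : TangentBundle 𝓘(ℝ, E) M)))
    (hsmul : ∀ f hf S g z, op (smulSection f hf S) g z = f (p z) * op S g z)
    (hmul : ∀ S f (hf : ContMDiff 𝓘(ℝ, E) 𝓘(ℝ, ℝ) ∞ f) g z,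
      op S (⟨f ∘ p, hf.comp hp⟩ * g) z =
        f (p z) * op S g z + diffAt E f (p z) (ρ _ (S (p z))) * g z) :
    ∃ L : LieAlgebroid E F K, L.anchor = ρ ∧
      ∀ S T, op (L.bracket S T) = op S * op T - op T * op S := by
  -- Injectivity of `op` makes the chosen section unique and lets each identity be checked after
  -- applying `op`, where the bracket is the commutator of an associative algebra.
  choose br hbr using hcomm
  refine ⟨{
    bracket := LinearMap.mk₂ ℝ br ?_ ?_ ?_ ?_
    bracket_skew := fun S T => hinj ?_
    jacobi := fun S T R => hinj ?_
    anchor := ρ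
    contMDiff_anchor := hρ
    leibniz := fun S f hf T m => ?_ }, rfl, hbr⟩
  · intro S S' T
    apply hinj
    simp only [map_add, hbr]
    noncomm_ring
  · intro c S T
    apply hinj
    simp only [map_smul, hbr, smul_mul_assoc, mul_smul_comm, smul_sub]
  · intro S T T'
    apply hinj
    simp only [map_add, hbr]
    noncomm_ring
  · intro c S T
    apply hinj
    simp only [map_smul, hbr, smul_mul_assoc, mul_smul_comm, smul_sub]
  · change op (br S T) = op (-br T S)
    rw [map_neg, hbr, hbr, neg_sub]
  · change op (br S (br T R) + br T (br R S) + br R (br S T)) = op 0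
    simp only [map_add, map_zero, hbr, mul_sub, sub_mul, mul_assoc]
    abel
  -- The Leibniz rule is proved for sections: [S, fT] = f[S, T] + ρ(S)(f) T is an equality of
  -- operators, because `op (fT)` is multiplication by f ∘ p after `op T`, and `hmul` gives the
  -- extra term. The function ρ(S)(f) must be smooth for the last term to be a section.
  · have hg : ContMDiff 𝓘(ℝ, E) 𝓘(ℝ, ℝ) ∞ (fun m => diffAt E f m (ρ m (S m))) := fun x =>
      contMDiffAt_diffAt_apply hf ((hρ.comp S.contMDiff) x)
    have h : br S (smulSection f hf T) = smulSection f hf (br S T) + smulSection _ hg T := by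
      apply hinj
      rw [map_add, hbr]
      ext g z
      have e : op (smulSection f hf T) g = ⟨f ∘ p, hf.comp hp⟩ * op T g := by
        ext z
        exact hsmul _ _ _ _ _
      change op S (op (smulSection f hf T) g) z - op (smulSection f hf T) (op S g) z =
        op (smulSection f hf (br S T)) g z + op (smulSection _ hg T) g z
      rw [e, hmul S f hf, hsmul f hf, hsmul f hf, hsmul _ hg, hbr]
      change _ = f (p z) * (op S (op T g) z - op T (op S g) z) + _
      ring
    exact congrArg (fun X : Cₛ^∞⟮𝓘(ℝ, E); F, K⟯ => X m) h

end OfOperators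

/-! ### Affine vector fields on the total space and their commutators -/

namespace AVBundle

variable {E M EZ Z : Type*}
  [NormedAddCommGroup E] [NormedSpace ℝ E] [TopologicalSpace M] [ChartedSpace E M]
  [NormedAddCommGroup EZ] [NormedSpace ℝ EZ] [TopologicalSpace Z] [ChartedSpace EZ Z]
  [AddAction ℝ Z] (𝒵 : AVBundle E M EZ Z)

/-- This is `lBreveLin_spec` with the parameter t replaced by z − σ(m), so that coordinates can be
used at an arbitrary point of the fibre. -/
theorem field_spec (σ : 𝒵.Sec) {m : M} (X : 𝒵.LBreve m) (z : 𝒵.Fiber m) :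
    𝒵.dProj z (X.field z) = (𝒵.lBreveLin σ m X).1 ∧
    𝒵.dAff σ z (X.field z) =
      (z -ᵥ σ m) * (𝒵.lBreveLin σ m X).2.1 + (𝒵.lBreveLin σ m X).2.2 := by
  have h := 𝒵.lBreveLin_spec σ X (z -ᵥ σ m)
  rwa [vsub_vadd] at h

theorem diffAt_comp_proj {g : M → ℝ} (hg : ContMDiff 𝓘(ℝ, E) 𝓘(ℝ, ℝ) ∞ g) {m : M}
    (z : 𝒵.Fiber m) (v : TangentSpace 𝓘(ℝ, EZ) z.1) :
    diffAt EZ (g ∘ 𝒵.proj) z.1 v = diffAt E g m (𝒵.dProj z v) := by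
  obtain ⟨z, rfl⟩ := z
  exact DFunLike.congr_fun (mfderiv_comp z ((hg _).mdifferentiableAt (by simp))
    ((𝒵.contMDiff_proj z).mdifferentiableAt (by simp))) v

/-- Covectors separate tangent vectors, and a bump function realizes each covector as the
differential of a global function. -/
theorem tangent_eq_of_diffAt [FiniteDimensional ℝ E] [IsManifold 𝓘(ℝ, E) ∞ M] [T2Space M] {m : M}
    {v w : TangentSpace 𝓘(ℝ, E) m}
    (h : ∀ g : M → ℝ, ContMDiff 𝓘(ℝ, E) 𝓘(ℝ, ℝ) ∞ g → diffAt E g m v = diffAt E g m w) : v = w := by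
  have h' : ∀ η : E →L[ℝ] ℝ, η v = η w := fun η => by
    obtain ⟨g, hg, hη, -⟩ := exists_contMDiff_diffAt_eq (E := E) m η 0
    rw [← hη]
    exact h g hg
  by_contra hne
  obtain ⟨η, hη⟩ := SeparatingDual.exists_ne_zero (R := ℝ) (V := E) (x := v - w) (sub_ne_zero.2 hne)
  exact hη ((η.map_sub v w).trans (sub_eq_zero.2 (h' η)))

/-- The derivative of a function on `Z` which is affine on the fibres. -/
theorem diffAt_affine (σ : 𝒵.Sec) {α β : M → ℝ} (hα : ContMDiff 𝓘(ℝ, E) 𝓘(ℝ, ℝ) ∞ α)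
    (hβ : ContMDiff 𝓘(ℝ, E) 𝓘(ℝ, ℝ) ∞ β) {m : M} (z : 𝒵.Fiber m)
    (v : TangentSpace 𝓘(ℝ, EZ) z.1) :
    diffAt EZ (fun w => (β ∘ 𝒵.proj) w - 𝒵.affFun σ w * (α ∘ 𝒵.proj) w) z.1 v =
      diffAt E β m (𝒵.dProj z v) + (z -ᵥ σ m) * diffAt E α m (𝒵.dProj z v) -
        α m * 𝒵.dAff σ z v := by
  have h1 : ∀ {g : M → ℝ}, ContMDiff 𝓘(ℝ, E) 𝓘(ℝ, ℝ) ∞ g →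
      MDifferentiableAt 𝓘(ℝ, EZ) 𝓘(ℝ, ℝ) (g ∘ 𝒵.proj) z.1 := fun hg =>
    ((hg.comp 𝒵.contMDiff_proj) z.1).mdifferentiableAt (by simp)
  have h2 := (𝒵.contMDiff_affFun σ z.1).mdifferentiableAt (by simp : (∞ : WithTop ℕ∞) ≠ 0)
  have h3 : MDifferentiableAt 𝓘(ℝ, EZ) 𝓘(ℝ, ℝ)
      (fun w => 𝒵.affFun σ w * (α ∘ 𝒵.proj) w) z.1 := h2.mul (h1 hα)
  rw [diffAt_sub (h1 hβ) h3, diffAt_mul h2 (h1 hα)]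
  change diffAt EZ (β ∘ 𝒵.proj) z.1 v - (𝒵.affFun σ z.1 * diffAt EZ (α ∘ 𝒵.proj) z.1 v +
    α (𝒵.proj z.1) * 𝒵.dAff σ z v) = _
  -- The fibre coordinate z − σ(m) is −F_σ(z), which accounts for the sign of the middle term.
  rw [𝒵.diffAt_comp_proj hβ, 𝒵.diffAt_comp_proj hα, affFun_eq, z.2,
    ← neg_vsub_eq_vsub_rev z (σ m)]
  ring

variable [FiniteDimensional ℝ E] [IsManifold 𝓘(ℝ, E) ∞ M] [T2Space M] [SigmaCompactSpace M]

theorem contMDiffAt_lBreve_iff (σ : 𝒵.Sec) {EN HN N : Type*} [NormedAddCommGroup EN]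
    [NormedSpace ℝ EN] [TopologicalSpace HN] {I : ModelWithCorners ℝ EN HN} [TopologicalSpace N]
    [ChartedSpace HN N] (f : N → TotalSpace (E × (ℝ × ℝ)) 𝒵.LBreve) (x : N) :
    ContMDiffAt I (𝓘(ℝ, E).prod 𝓘(ℝ, E × (ℝ × ℝ))) ∞ f x ↔
      ContMDiffAt I 𝓘(ℝ, E).tangent ∞
        (fun y => (⟨(f y).1, (𝒵.lBreveLin σ _ (f y).2).1⟩ : TangentBundle 𝓘(ℝ, E) M)) x ∧
      ContMDiffAt I 𝓘(ℝ, ℝ × ℝ) ∞ (fun y => (𝒵.lBreveLin σ _ (f y).2).2) x :=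
  𝒵.lBreveCharts.contMDiffAt_iff σ f x

/-- The vector field on `Z` defined by a section of `L̆Z`. -/
def vectorField (S : Cₛ^∞⟮𝓘(ℝ, E); E × (ℝ × ℝ), 𝒵.LBreve⟯) (z : Z) : TangentSpace 𝓘(ℝ, EZ) z :=
  (S (𝒵.proj z)).field (𝒵.toFiber z)

theorem contMDiff_vectorField [IsManifold 𝓘(ℝ, EZ) ∞ Z]
    (S : Cₛ^∞⟮𝓘(ℝ, E); E × (ℝ × ℝ), 𝒵.LBreve⟯) :
    ContMDiff 𝓘(ℝ, EZ) 𝓘(ℝ, EZ).tangent ∞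
      (fun z => (⟨z, 𝒵.vectorField S z⟩ : TangentBundle 𝓘(ℝ, EZ) Z)) := by
  intro z₀
  let σ : 𝒵.Sec := Classical.arbitrary 𝒵.Sec
  let Φ := 𝒵.secDiffeo σ
  let q : ∀ m, TangentSpace 𝓘(ℝ, E) m × (ℝ × ℝ) := fun m => 𝒵.lBreveLin σ m (S m)
  -- In the trivialization Φ of `Z` by σ the field has components u and r = ta + b with t = −F_σ.
  -- They are visibly smooth, and the field is recovered by applying the differential of Φ⁻¹.
  let r : Z → ℝ := fun z => -𝒵.affFun σ z * (q (𝒵.proj z)).2.1 + (q (𝒵.proj z)).2.2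
  obtain ⟨hu, hab⟩ := (𝒵.contMDiffAt_lBreve_iff σ _ (𝒵.proj z₀)).1 (S.contMDiff (𝒵.proj z₀))
  have hu' := hu.comp z₀ (𝒵.contMDiff_proj z₀)
  have hab' := hab.comp z₀ (𝒵.contMDiff_proj z₀)
  have hr : ContMDiffAt 𝓘(ℝ, EZ) 𝓘(ℝ, ℝ) ∞ r z₀ := by
    obtain ⟨ha, hb⟩ := (contMDiffAt_prod_module_iff _).1 hab'
    exact (((𝒵.contMDiff_affFun σ z₀).neg).mul ha).add hb
  have hr' : ContMDiffAt 𝓘(ℝ, EZ) 𝓘(ℝ, ℝ).tangent ∞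
      (fun z => (⟨𝒵.affFun σ z, r z⟩ : TangentBundle 𝓘(ℝ, ℝ) ℝ)) z₀ := by
    refine Bundle.contMDiffAt_totalSpace.2 ⟨𝒵.contMDiff_affFun σ z₀, ?_⟩
    simpa using hr
  have h1 := (contMDiff_equivTangentBundleProd_symm (I := 𝓘(ℝ, E)) (M := M) (I' := 𝓘(ℝ, ℝ))
    (M' := ℝ) (n := ∞)).contMDiffAt.comp z₀ (hu'.prodMk hr')
  have h2 := (Φ.symm.contMDiff.contMDiff_tangentMap (m := ∞) (by simp)).contMDiffAt.comp z₀ h1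
  refine h2.congr_of_eventuallyEq (Filter.Eventually.of_forall fun z => ?_)
  have e1 : (equivTangentBundleProd 𝓘(ℝ, E) M 𝓘(ℝ, ℝ) ℝ).symm
      (⟨𝒵.proj z, (q (𝒵.proj z)).1⟩, ⟨𝒵.affFun σ z, r z⟩) =
      tangentMap 𝓘(ℝ, EZ) (𝓘(ℝ, E).prod 𝓘(ℝ, ℝ)) Φ ⟨z, 𝒵.vectorField S z⟩ := by
    have h := 𝒵.mfderiv_secDiffeo σ (𝒵.toFiber z) (𝒵.vectorField S z)
    obtain ⟨h3, h4⟩ := 𝒵.field_spec σ (S (𝒵.proj z)) (𝒵.toFiber z)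
    refine congrArg (fun v : E × ℝ => (⟨Φ z, v⟩ : TangentBundle (𝓘(ℝ, E).prod 𝓘(ℝ, ℝ)) (M × ℝ))) ?_
    refine Eq.trans ?_ h.symm
    refine Prod.ext h3.symm (Eq.trans ?_ h4.symm)
    rw [← neg_vsub_eq_vsub_rev]
    rfl
  change _ = tangentMap (𝓘(ℝ, E).prod 𝓘(ℝ, ℝ)) 𝓘(ℝ, EZ) Φ.symm
    ((equivTangentBundleProd 𝓘(ℝ, E) M 𝓘(ℝ, ℝ) ℝ).symm
      (⟨𝒵.proj z, (q (𝒵.proj z)).1⟩, ⟨𝒵.affFun σ z, r z⟩))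
  -- T(Φ⁻¹) ∘ TΦ is the identity, so transporting the components back returns the original field.
  rw [e1, ← tangentMap_comp_at _ (Φ.symm.contMDiff.contMDiffAt.mdifferentiableAt (by simp))
    (Φ.contMDiff.contMDiffAt.mdifferentiableAt (by simp))]
  have e2 : (Φ.symm ∘ Φ : Z → Z) = id := funext fun z => Φ.symm_apply_apply z
  rw [e2, tangentMap_id]
  rfl

theorem opL_eq (S : Cₛ^∞⟮𝓘(ℝ, E); E × (ℝ × ℝ), 𝒵.LBreve⟯) (f : Z → ℝ) (z : Z) :
    𝒵.opL S f z = diffAt EZ f z (𝒵.vectorField S z) := rfl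

theorem contMDiff_opL [IsManifold 𝓘(ℝ, EZ) ∞ Z] (S : Cₛ^∞⟮𝓘(ℝ, E); E × (ℝ × ℝ), 𝒵.LBreve⟯)
    {f : Z → ℝ} (hf : ContMDiff 𝓘(ℝ, EZ) 𝓘(ℝ, ℝ) ∞ f) :
    ContMDiff 𝓘(ℝ, EZ) 𝓘(ℝ, ℝ) ∞ (𝒵.opL S f) := fun z =>
  contMDiffAt_diffAt_apply hf (𝒵.contMDiff_vectorField S z)

/-- Together with `opL_affFun` this allows commutators to be computed: basic functions stay basic,
and F_σ becomes β − F_σ α with α and β basic, to which a second field can be applied by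
`diffAt_affine`. -/
theorem opL_comp_proj (σ : 𝒵.Sec) (S : Cₛ^∞⟮𝓘(ℝ, E); E × (ℝ × ℝ), 𝒵.LBreve⟯) {g : M → ℝ}
    (hg : ContMDiff 𝓘(ℝ, E) 𝓘(ℝ, ℝ) ∞ g) :
    𝒵.opL S (g ∘ 𝒵.proj) = (fun m => diffAt E g m (𝒵.lBreveLin σ m (S m)).1) ∘ 𝒵.proj :=
  funext fun z => (𝒵.diffAt_comp_proj hg (𝒵.toFiber z) _).trans
    (congrArg (diffAt E g (𝒵.proj z)) (𝒵.field_spec σ (S (𝒵.proj z)) (𝒵.toFiber z)).1)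

theorem opL_affFun (σ : 𝒵.Sec) (S : Cₛ^∞⟮𝓘(ℝ, E); E × (ℝ × ℝ), 𝒵.LBreve⟯) :
    𝒵.opL S (𝒵.affFun σ) = fun z =>
      ((fun m => (𝒵.lBreveLin σ m (S m)).2.2) ∘ 𝒵.proj) z -
        𝒵.affFun σ z * ((fun m => (𝒵.lBreveLin σ m (S m)).2.1) ∘ 𝒵.proj) z :=
  funext fun z => ((𝒵.field_spec σ (S (𝒵.proj z)) (𝒵.toFiber z)).2).trans (by
    rw [← neg_vsub_eq_vsub_rev]
    change -𝒵.affFun σ z * _ + _ = _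
    simp only [Function.comp]
    ring)

theorem contMDiff_coeffs (σ : 𝒵.Sec) (S : Cₛ^∞⟮𝓘(ℝ, E); E × (ℝ × ℝ), 𝒵.LBreve⟯) :
    ContMDiff 𝓘(ℝ, E) 𝓘(ℝ, E).tangent ∞
      (fun m => (⟨m, (𝒵.lBreveLin σ m (S m)).1⟩ : TangentBundle 𝓘(ℝ, E) M)) ∧
    ContMDiff 𝓘(ℝ, E) 𝓘(ℝ, ℝ) ∞ (fun m => (𝒵.lBreveLin σ m (S m)).2.1) ∧
    ContMDiff 𝓘(ℝ, E) 𝓘(ℝ, ℝ) ∞ (fun m => (𝒵.lBreveLin σ m (S m)).2.2) := by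
  have h := fun x => (𝒵.contMDiffAt_lBreve_iff σ _ x).1 (S.contMDiff x)
  exact ⟨fun x => (h x).1, fun x => ((contMDiffAt_prod_module_iff _).1 (h x).2).1,
    fun x => ((contMDiffAt_prod_module_iff _).1 (h x).2).2⟩

/-- A smooth vector field on `Z` with basic projection which maps `F_σ` to a function affine on the
fibres is a section of `L̆Z`. -/
theorem exists_section_of_vectorField [IsManifold 𝓘(ℝ, EZ) ∞ Z] (σ : 𝒵.Sec)
    {B : ∀ z : Z, TangentSpace 𝓘(ℝ, EZ) z}
    (hB : ContMDiff 𝓘(ℝ, EZ) 𝓘(ℝ, EZ).tangent ∞ (fun z => (⟨z, B z⟩ : TangentBundle 𝓘(ℝ, EZ) Z)))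
    (hproj : ∀ m (z : 𝒵.Fiber m), 𝒵.dProj z (B z.1) = 𝒵.dProj (σ m) (B (σ m).1))
    {a : M → ℝ} (ha : ContMDiff 𝓘(ℝ, E) 𝓘(ℝ, ℝ) ∞ a)
    (haff : ∀ m (z : 𝒵.Fiber m), 𝒵.dAff σ z (B z.1) =
      (z -ᵥ σ m) * a m + 𝒵.dAff σ (σ m) (B (σ m).1)) :
    ∃ R : Cₛ^∞⟮𝓘(ℝ, E); E × (ℝ × ℝ), 𝒵.LBreve⟯, (∀ z, 𝒵.vectorField R z = B z) ∧
      ∀ m, (𝒵.lBreveLin σ m (R m)).2.1 = a m := by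
  -- The coordinates of the wanted section are read off along σ, where t = 0. Smoothness of u and b
  -- follows by restricting Tζ ∘ B and B(F_σ) to σ; the slope a is given.
  let u : ∀ m, TangentSpace 𝓘(ℝ, E) m := fun m => 𝒵.dProj (σ m) (B (σ m).1)
  let b : M → ℝ := fun m => 𝒵.dAff σ (σ m) (B (σ m).1)
  let R : ∀ m, 𝒵.LBreve m := fun m => (𝒵.lBreveEquiv σ m).symm (u m, (a m, b m))
  have hR : ∀ m, 𝒵.lBreveLin σ m (R m) = (u m, (a m, b m)) := fun m =>
    (𝒵.lBreveEquiv σ m).apply_symm_apply _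
  have hu : ContMDiff 𝓘(ℝ, E) 𝓘(ℝ, E).tangent ∞
      (fun m => (⟨m, u m⟩ : TangentBundle 𝓘(ℝ, E) M)) := by
    refine ((𝒵.contMDiff_proj.contMDiff_tangentMap (m := ∞) (by simp)).comp
      (hB.comp σ.contMDiff_toFun)).congr fun m => ?_
    -- ζ(σ(m)) and m are equal but not definitionally so, hence the explicit change of base point.
    have aux : ∀ (x y : M) (v : E), x = y →
        (⟨x, v⟩ : TangentBundle 𝓘(ℝ, E) M) = ⟨y, v⟩ := by
      rintro x _ v rfl
      rfl
    exact aux _ _ _ (σ m).2.symm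
  have hb : ContMDiff 𝓘(ℝ, E) 𝓘(ℝ, ℝ) ∞ b :=
    ContMDiff.comp (fun z => contMDiffAt_diffAt_apply (𝒵.contMDiff_affFun σ) (hB z))
      σ.contMDiff_toFun
  refine ⟨⟨R, fun x => (𝒵.contMDiffAt_lBreve_iff σ _ x).2 ?_⟩, fun z => ?_,
    fun m => congrArg (fun q => q.2.1) (hR m)⟩
  · simp only [hR]
    exact ⟨hu x, (contMDiffAt_prod_module_iff _).2 ⟨ha x, hb x⟩⟩
  · obtain ⟨h1, h2⟩ := 𝒵.field_spec σ (R (𝒵.proj z)) (𝒵.toFiber z)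
    rw [hR] at h1 h2
    exact 𝒵.tangent_ext σ (𝒵.toFiber z) (h1.trans (hproj _ (𝒵.toFiber z)).symm)
      (h2.trans (haff _ (𝒵.toFiber z)).symm)

/-- The tangent space of `Z` at a point is isomorphic to E × ℝ, so the model is finite-dimensional.
A point is required, since nothing constrains the model of an empty `Z`. Completeness is what the
results on Lie brackets ask for. -/
theorem completeSpace_model (𝒵 : AVBundle E M EZ Z) (z : Z) : CompleteSpace EZ := by
  let σ : 𝒵.Sec := Classical.arbitrary 𝒵.Sec
  let e : EZ ≃L[ℝ] E × ℝ := (𝒵.secDiffeo σ).mfderivToContinuousLinearEquiv (x := z) (by simp)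
  have := e.symm.toLinearEquiv.finiteDimensional
  exact FiniteDimensional.complete ℝ EZ

/-- The sections of `L̆Z` are closed under commutators. -/
theorem exists_opL_commutator [IsManifold 𝓘(ℝ, EZ) ∞ Z] (σ : 𝒵.Sec)
    (S T : Cₛ^∞⟮𝓘(ℝ, E); E × (ℝ × ℝ), 𝒵.LBreve⟯) :
    ∃ R : Cₛ^∞⟮𝓘(ℝ, E); E × (ℝ × ℝ), 𝒵.LBreve⟯, (∀ f : Z → ℝ,
      ContMDiff 𝓘(ℝ, EZ) 𝓘(ℝ, ℝ) ∞ f → ∀ z, 𝒵.opL R f z =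
        𝒵.opL S (𝒵.opL T f) z - 𝒵.opL T (𝒵.opL S f) z) ∧
      ∀ m, (𝒵.lBreveLin σ m (R m)).2.1 =
        diffAt E (fun m => (𝒵.lBreveLin σ m (T m)).2.1) m (𝒵.lBreveLin σ m (S m)).1 -
          diffAt E (fun m => (𝒵.lBreveLin σ m (S m)).2.1) m (𝒵.lBreveLin σ m (T m)).1 := by
  -- If `Z` is empty then so is M, as σ(m) would be a point of `Z`.
  rcases isEmpty_or_nonempty Z with hZ | ⟨⟨z₀⟩⟩
  · exact ⟨0, fun _ _ z => isEmptyElim z, fun m => (hZ.false (σ m).1).elim⟩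
  have := 𝒵.completeSpace_model z₀
  let B : ∀ z : Z, TangentSpace 𝓘(ℝ, EZ) z :=
    VectorField.mlieBracket 𝓘(ℝ, EZ) (𝒵.vectorField S) (𝒵.vectorField T)
  have hB : ∀ f : Z → ℝ, ContMDiff 𝓘(ℝ, EZ) 𝓘(ℝ, ℝ) ∞ f → ∀ z, diffAt EZ f z (B z) =
      𝒵.opL S (𝒵.opL T f) z - 𝒵.opL T (𝒵.opL S f) z := fun f hf z =>
    diffAt_mlieBracket (𝒵.contMDiff_vectorField S) (𝒵.contMDiff_vectorField T) hf z
  obtain ⟨hu, ha, hb⟩ := 𝒵.contMDiff_coeffs σ S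
  obtain ⟨hu', ha', hb'⟩ := 𝒵.contMDiff_coeffs σ T
  have hproj : ∀ m (z : 𝒵.Fiber m), 𝒵.dProj z (B z.1) = 𝒵.dProj (σ m) (B (σ m).1) := by
    -- Applied to g ∘ ζ, the commutator gives a function of m alone. So every dg takes the same
    -- value on the projections of B at all points of the fibre, and the projections agree.
    have key : ∀ g : M → ℝ, ContMDiff 𝓘(ℝ, E) 𝓘(ℝ, ℝ) ∞ g → ∀ m (z : 𝒵.Fiber m),
        diffAt E g m (𝒵.dProj z (B z.1)) =
          diffAt E (fun y => diffAt E g y (𝒵.lBreveLin σ y (T y)).1) m (𝒵.lBreveLin σ m (S m)).1 -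
          diffAt E (fun y => diffAt E g y (𝒵.lBreveLin σ y (S y)).1) m
            (𝒵.lBreveLin σ m (T m)).1 := by
      rintro g hg _ ⟨z, rfl⟩
      refine (𝒵.diffAt_comp_proj hg (𝒵.toFiber z) (B z)).symm.trans
        ((hB _ (hg.comp 𝒵.contMDiff_proj) z).trans ?_)
      rw [𝒵.opL_comp_proj σ S hg,
        𝒵.opL_comp_proj σ T hg,
        𝒵.opL_comp_proj σ T (fun x => contMDiffAt_diffAt_apply hg (hu x)),
        𝒵.opL_comp_proj σ S (fun x => contMDiffAt_diffAt_apply hg (hu' x))]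
      rfl
    intro m z
    refine tangent_eq_of_diffAt fun g hg => ?_
    rw [key g hg, key g hg]
  have haff : ∀ m (z : 𝒵.Fiber m), 𝒵.dAff σ z (B z.1) = (z -ᵥ σ m) *
      (diffAt E (fun m => (𝒵.lBreveLin σ m (T m)).2.1) m (𝒵.lBreveLin σ m (S m)).1 -
        diffAt E (fun m => (𝒵.lBreveLin σ m (S m)).2.1) m (𝒵.lBreveLin σ m (T m)).1) +
      𝒵.dAff σ (σ m) (B (σ m).1) := by
    -- S(T(F_σ)) contains −t a_T a_S, and T(S(F_σ)) the same term, so these cancel in the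
    -- difference. The coefficient of t that is left is u_S(a_T) − u_T(a_S).
    have key : ∀ m (z : 𝒵.Fiber m), 𝒵.dAff σ z (B z.1) =
        (diffAt E (fun m => (𝒵.lBreveLin σ m (T m)).2.2) m (𝒵.lBreveLin σ m (S m)).1 +
          (z -ᵥ σ m) *
            diffAt E (fun m => (𝒵.lBreveLin σ m (T m)).2.1) m (𝒵.lBreveLin σ m (S m)).1 -
          (𝒵.lBreveLin σ m (T m)).2.1 *
            ((z -ᵥ σ m) * (𝒵.lBreveLin σ m (S m)).2.1 + (𝒵.lBreveLin σ m (S m)).2.2)) -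
        (diffAt E (fun m => (𝒵.lBreveLin σ m (S m)).2.2) m (𝒵.lBreveLin σ m (T m)).1 +
          (z -ᵥ σ m) *
            diffAt E (fun m => (𝒵.lBreveLin σ m (S m)).2.1) m (𝒵.lBreveLin σ m (T m)).1 -
          (𝒵.lBreveLin σ m (S m)).2.1 *
            ((z -ᵥ σ m) * (𝒵.lBreveLin σ m (T m)).2.1 + (𝒵.lBreveLin σ m (T m)).2.2)) := by
      rintro _ ⟨z, rfl⟩
      obtain ⟨h1, h2⟩ := 𝒵.field_spec σ (S (𝒵.proj z)) ⟨z, rfl⟩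
      obtain ⟨h1', h2'⟩ := 𝒵.field_spec σ (T (𝒵.proj z)) ⟨z, rfl⟩
      have h3 := hB _ (𝒵.contMDiff_affFun σ) z
      rw [opL_affFun, opL_affFun] at h3
      refine h3.trans (congrArg₂ _ ((𝒵.diffAt_affine σ ha' hb' ⟨z, rfl⟩ _).trans ?_)
        ((𝒵.diffAt_affine σ ha hb ⟨z, rfl⟩ _).trans ?_))
      · rw [← h1, ← h2]
        rfl
      · rw [← h1', ← h2']
        rfl
    intro m z
    rw [key m z, key m (σ m), vsub_self]
    ring
  obtain ⟨R, hR, hRa⟩ := 𝒵.exists_section_of_vectorField σ (B := B)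
    (fun z => contMDiffAt_mlieBracket (𝒵.contMDiff_vectorField S z) (𝒵.contMDiff_vectorField T z))
    hproj (ContMDiff.sub (fun x => contMDiffAt_diffAt_apply ha' (hu x))
      (fun x => contMDiffAt_diffAt_apply ha (hu' x))) haff
  exact ⟨R, fun f hf z => by rw [opL_eq, hR, hB f hf], hRa⟩

end AVBundle

/-! ### The Lie algebroids L̆Z and RZ -/

namespace AVBundle

variable {E M EZ Z : Type*}
  [NormedAddCommGroup E] [NormedSpace ℝ E] [TopologicalSpace M] [ChartedSpace E M]
  [NormedAddCommGroup EZ] [NormedSpace ℝ EZ] [TopologicalSpace Z] [ChartedSpace EZ Z]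
  [AddAction ℝ Z] (𝒵 : AVBundle E M EZ Z)
  [FiniteDimensional ℝ E] [IsManifold 𝓘(ℝ, E) ∞ M] [T2Space M] [SigmaCompactSpace M]

/-- Basic functions determine the projection, and F_σ supplies the remaining vertical component. -/
theorem LBreve.ext_apply {𝒵 : AVBundle E M EZ Z} {m : M} {X Y : 𝒵.LBreve m}
    (h : ∀ f : Z → ℝ, ContMDiff 𝓘(ℝ, EZ) 𝓘(ℝ, ℝ) ∞ f → ∀ z, X.apply f z = Y.apply f z) : X = Y := by
  let σ : 𝒵.Sec := Classical.arbitrary 𝒵.Sec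
  refine Subtype.ext (funext fun z => 𝒵.tangent_ext σ z ?_ (h _ (𝒵.contMDiff_affFun σ) z))
  refine tangent_eq_of_diffAt fun g hg => ?_
  exact (𝒵.diffAt_comp_proj hg z _).symm.trans
    ((h _ (hg.comp 𝒵.contMDiff_proj) z).trans (𝒵.diffAt_comp_proj hg z _))

theorem opL_add_left (S T : Cₛ^∞⟮𝓘(ℝ, E); E × (ℝ × ℝ), 𝒵.LBreve⟯) (f : Z → ℝ) (z : Z) :
    𝒵.opL (S + T) f z = 𝒵.opL S f z + 𝒵.opL T f z :=
  map_add (diffAt EZ f z) (𝒵.vectorField S z) (𝒵.vectorField T z)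

theorem opL_smul_left (c : ℝ) (S : Cₛ^∞⟮𝓘(ℝ, E); E × (ℝ × ℝ), 𝒵.LBreve⟯) (f : Z → ℝ) (z : Z) :
    𝒵.opL (c • S) f z = c * 𝒵.opL S f z :=
  map_smul (diffAt EZ f z) c (𝒵.vectorField S z)

theorem opL_smulSection (S : Cₛ^∞⟮𝓘(ℝ, E); E × (ℝ × ℝ), 𝒵.LBreve⟯) (f : M → ℝ)
    (hf : ContMDiff 𝓘(ℝ, E) 𝓘(ℝ, ℝ) ∞ f) (g : Z → ℝ) (z : Z) :
    𝒵.opL (smulSection f hf S) g z = f (𝒵.proj z) * 𝒵.opL S g z :=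
  map_smul (diffAt EZ g z) (f (𝒵.proj z)) (𝒵.vectorField S z)

theorem opL_add (S : Cₛ^∞⟮𝓘(ℝ, E); E × (ℝ × ℝ), 𝒵.LBreve⟯) {f g : Z → ℝ}
    (hf : ContMDiff 𝓘(ℝ, EZ) 𝓘(ℝ, ℝ) ∞ f) (hg : ContMDiff 𝓘(ℝ, EZ) 𝓘(ℝ, ℝ) ∞ g) (z : Z) :
    𝒵.opL S (fun z => f z + g z) z = 𝒵.opL S f z + 𝒵.opL S g z :=
  DFunLike.congr_fun (diffAt_add ((hf z).mdifferentiableAt (by simp))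
    ((hg z).mdifferentiableAt (by simp))) (𝒵.vectorField S z)

theorem opL_mul (S : Cₛ^∞⟮𝓘(ℝ, E); E × (ℝ × ℝ), 𝒵.LBreve⟯) {f g : Z → ℝ}
    (hf : ContMDiff 𝓘(ℝ, EZ) 𝓘(ℝ, ℝ) ∞ f) (hg : ContMDiff 𝓘(ℝ, EZ) 𝓘(ℝ, ℝ) ∞ g) (z : Z) :
    𝒵.opL S (fun z => f z * g z) z = f z * 𝒵.opL S g z + g z * 𝒵.opL S f z :=
  DFunLike.congr_fun (diffAt_mul ((hf z).mdifferentiableAt (by simp))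
    ((hg z).mdifferentiableAt (by simp))) (𝒵.vectorField S z)

theorem opL_const (S : Cₛ^∞⟮𝓘(ℝ, E); E × (ℝ × ℝ), 𝒵.LBreve⟯) (c : ℝ) (z : Z) :
    𝒵.opL S (fun _ => c) z = 0 :=
  DFunLike.congr_fun (diffAt_const (E := EZ) c z) (𝒵.vectorField S z)

/-- The product rule in the form required by the Leibniz axiom: the derivative of a basic factor is
again basic and involves only the anchor. -/
theorem opL_comp_proj_mul (σ : 𝒵.Sec) (S : Cₛ^∞⟮𝓘(ℝ, E); E × (ℝ × ℝ), 𝒵.LBreve⟯) {g : M → ℝ}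
    (hg : ContMDiff 𝓘(ℝ, E) 𝓘(ℝ, ℝ) ∞ g) {f : Z → ℝ} (hf : ContMDiff 𝓘(ℝ, EZ) 𝓘(ℝ, ℝ) ∞ f)
    (z : Z) : 𝒵.opL S (fun z => g (𝒵.proj z) * f z) z = g (𝒵.proj z) * 𝒵.opL S f z +
      diffAt E g (𝒵.proj z) (𝒵.lBreveLin σ _ (S (𝒵.proj z))).1 * f z := by
  have h := congrFun (𝒵.opL_comp_proj σ S hg) z
  have h' := 𝒵.opL_mul S (hg.comp 𝒵.contMDiff_proj) hf z
  rw [h] at h'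
  refine h'.trans ?_
  simp only [Function.comp]
  ring

/-- The derivations of functions on `Z` along sections of `L̆Z`. -/
def opLHom [IsManifold 𝓘(ℝ, EZ) ∞ Z] : Cₛ^∞⟮𝓘(ℝ, E); E × (ℝ × ℝ), 𝒵.LBreve⟯ →ₗ[ℝ]
    Module.End ℝ C^∞⟮𝓘(ℝ, EZ), Z; 𝓘(ℝ, ℝ), ℝ⟯ :=
  LinearMap.mk₂ ℝ (fun S g => ⟨𝒵.opL S g, 𝒵.contMDiff_opL S g.contMDiff⟩)
    (fun S T g => ContMDiffMap.ext fun z => 𝒵.opL_add_left S T g z)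
    (fun c S g => ContMDiffMap.ext fun z => 𝒵.opL_smul_left c S g z)
    (fun S f g => ContMDiffMap.ext fun z => 𝒵.opL_add S f.contMDiff g.contMDiff z)
    (fun c S g => ContMDiffMap.ext fun z => by
      have h := 𝒵.opL_mul S (contMDiff_const (c := c)) g.contMDiff z
      rw [opL_const, mul_zero, add_zero] at h
      exact h)

theorem opLHom_injective [IsManifold 𝓘(ℝ, EZ) ∞ Z] : Function.Injective 𝒵.opLHom := by
  intro S T h
  ext m
  refine LBreve.ext_apply fun f hf z => ?_
  obtain ⟨z, rfl⟩ := z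
  exact DFunLike.congr_fun (LinearMap.congr_fun h ⟨f, hf⟩) z

/-- The anchor of `L̆Z`, induced by `Tζ`. -/
def lBreveAnchor (σ : 𝒵.Sec) (m : M) : 𝒵.LBreve m →ₗ[ℝ] TangentSpace 𝓘(ℝ, E) m :=
  (LinearMap.fst ℝ _ _).comp (𝒵.lBreveLin σ m)

theorem contMDiff_lBreveAnchor (σ : 𝒵.Sec) :
    ContMDiff (𝓘(ℝ, E).prod 𝓘(ℝ, E × (ℝ × ℝ))) 𝓘(ℝ, E).tangent ∞
      (fun q : TotalSpace (E × (ℝ × ℝ)) 𝒵.LBreve =>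
        (⟨q.1, 𝒵.lBreveAnchor σ q.1 q.2⟩ : TangentBundle 𝓘(ℝ, E) M)) := fun x =>
  ((𝒵.contMDiffAt_lBreve_iff σ id x).1 contMDiffAt_id).1

/-- The commutators of affine vector fields make `L̆Z` into a Lie algebroid. -/
theorem exists_lieAlgebroid_lBreve [IsManifold 𝓘(ℝ, EZ) ∞ Z] (σ : 𝒵.Sec) :
    ∃ L : LieAlgebroid E (E × (ℝ × ℝ)) 𝒵.LBreve,
      (∀ (S T : Cₛ^∞⟮𝓘(ℝ, E); E × (ℝ × ℝ), 𝒵.LBreve⟯) (f : Z → ℝ),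
        ContMDiff 𝓘(ℝ, EZ) 𝓘(ℝ, ℝ) ∞ f → ∀ z : Z, 𝒵.opL (L.bracket S T) f z =
          𝒵.opL S (𝒵.opL T f) z - 𝒵.opL T (𝒵.opL S f) z) ∧
      (∀ (m : M) (X : 𝒵.LBreve m) (z : 𝒵.Fiber m), L.anchor m X = 𝒵.dProj z (X.field z)) ∧
      ∀ S T m, (𝒵.lBreveLin σ m (L.bracket S T m)).2.1 =
        diffAt E (fun m => (𝒵.lBreveLin σ m (T m)).2.1) m (L.anchor m (S m)) -
          diffAt E (fun m => (𝒵.lBreveLin σ m (S m)).2.1) m (L.anchor m (T m)) := by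
  have hR : ∀ {S T R : Cₛ^∞⟮𝓘(ℝ, E); E × (ℝ × ℝ), 𝒵.LBreve⟯}, (∀ f : Z → ℝ,
      ContMDiff 𝓘(ℝ, EZ) 𝓘(ℝ, ℝ) ∞ f → ∀ z, 𝒵.opL R f z =
        𝒵.opL S (𝒵.opL T f) z - 𝒵.opL T (𝒵.opL S f) z) →
      𝒵.opLHom R = 𝒵.opLHom S * 𝒵.opLHom T - 𝒵.opLHom T * 𝒵.opLHom S := fun h =>
    LinearMap.ext fun g => ContMDiffMap.ext fun z => h g g.contMDiff z
  obtain ⟨L, hL, hb⟩ := exists_lieAlgebroid_of_operators 𝒵.proj 𝒵.contMDiff_proj 𝒵.opLHom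
    𝒵.opLHom_injective (fun S T => (𝒵.exists_opL_commutator σ S T).imp fun R h => hR h.1)
    (𝒵.lBreveAnchor σ) (𝒵.contMDiff_lBreveAnchor σ)
    (fun f hf S g z => 𝒵.opL_smulSection S f hf g z)
    (fun S f hf g z => 𝒵.opL_comp_proj_mul σ S hf g.contMDiff z)
  refine ⟨L, fun S T f hf z => ?_, fun m X z => ?_, fun S T m => ?_⟩
  · exact DFunLike.congr_fun (LinearMap.congr_fun (hb S T) ⟨f, hf⟩) z
  · rw [hL]
    exact (𝒵.field_spec σ X z).1.symm
  -- The bracket is known only through its operator. Faithfulness identifies it with the explicit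
  -- commutator section, whose slope has been computed.
  · obtain ⟨R, h1, h2⟩ := 𝒵.exists_opL_commutator σ S T
    rw [𝒵.opLHom_injective ((hb S T).trans (hR h1).symm), h2, hL]
    rfl

/-- The component of a section of `RZ` in `L̆Z`. -/
def fstSection (S : Cₛ^∞⟮𝓘(ℝ, E); (E × (ℝ × ℝ)) × ℝ, 𝒵.RBundle⟯) :
    Cₛ^∞⟮𝓘(ℝ, E); E × (ℝ × ℝ), 𝒵.LBreve⟯ :=
  ⟨fun m => (S m).1, fun x => ((contMDiffAt_prod_trivial_iff _ x).1 (S.contMDiff x)).1⟩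

theorem contMDiff_snd_section (S : Cₛ^∞⟮𝓘(ℝ, E); (E × (ℝ × ℝ)) × ℝ, 𝒵.RBundle⟯) :
    ContMDiff 𝓘(ℝ, E) 𝓘(ℝ, ℝ) ∞ (fun m => ((S m).2 : ℝ)) := fun x =>
  ((contMDiffAt_prod_trivial_iff _ x).1 (S.contMDiff x)).2

theorem opR_eq (S : Cₛ^∞⟮𝓘(ℝ, E); (E × (ℝ × ℝ)) × ℝ, 𝒵.RBundle⟯) (f : Z → ℝ) :
    𝒵.opR S f = fun z => 𝒵.opL (𝒵.fstSection S) f z + ((S (𝒵.proj z)).2 : ℝ) * f z := rfl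

theorem contMDiff_opR [IsManifold 𝓘(ℝ, EZ) ∞ Z]
    (S : Cₛ^∞⟮𝓘(ℝ, E); (E × (ℝ × ℝ)) × ℝ, 𝒵.RBundle⟯)
    {f : Z → ℝ} (hf : ContMDiff 𝓘(ℝ, EZ) 𝓘(ℝ, ℝ) ∞ f) :
    ContMDiff 𝓘(ℝ, EZ) 𝓘(ℝ, ℝ) ∞ (𝒵.opR S f) :=
  (𝒵.contMDiff_opL (𝒵.fstSection S) hf).add (((𝒵.contMDiff_snd_section S).comp 𝒵.contMDiff_proj).mul hf)

/-- The operators on functions on `Z` defined by sections of `RZ`. -/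
def opRHom [IsManifold 𝓘(ℝ, EZ) ∞ Z] : Cₛ^∞⟮𝓘(ℝ, E); (E × (ℝ × ℝ)) × ℝ, 𝒵.RBundle⟯ →ₗ[ℝ]
    Module.End ℝ C^∞⟮𝓘(ℝ, EZ), Z; 𝓘(ℝ, ℝ), ℝ⟯ :=
  LinearMap.mk₂ ℝ (fun S g => ⟨𝒵.opR S g, 𝒵.contMDiff_opR S g.contMDiff⟩)
    (fun S T g => ContMDiffMap.ext fun z => by
      change 𝒵.opL (𝒵.fstSection S + 𝒵.fstSection T) g z +
        ((S (𝒵.proj z)).2 + (T (𝒵.proj z)).2 : ℝ) * g z =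
        (𝒵.opL (𝒵.fstSection S) g z + ((S (𝒵.proj z)).2 : ℝ) * g z) +
          (𝒵.opL (𝒵.fstSection T) g z + ((T (𝒵.proj z)).2 : ℝ) * g z)
      rw [opL_add_left]
      ring)
    (fun c S g => ContMDiffMap.ext fun z => by
      change 𝒵.opL (c • 𝒵.fstSection S) g z + (c * (S (𝒵.proj z)).2 : ℝ) * g z =
        c * (𝒵.opL (𝒵.fstSection S) g z + ((S (𝒵.proj z)).2 : ℝ) * g z)
      rw [opL_smul_left]
      ring)
    (fun S f g => ContMDiffMap.ext fun z => by
      change 𝒵.opLHom (𝒵.fstSection S) (f + g) z + ((S (𝒵.proj z)).2 : ℝ) * (f z + g z) =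
        (𝒵.opLHom (𝒵.fstSection S) f z + ((S (𝒵.proj z)).2 : ℝ) * f z) +
          (𝒵.opLHom (𝒵.fstSection S) g z + ((S (𝒵.proj z)).2 : ℝ) * g z)
      rw [map_add]
      change (_ + _ : ℝ) + _ = _
      ring)
    (fun c S g => ContMDiffMap.ext fun z => by
      change 𝒵.opLHom (𝒵.fstSection S) (c • g) z + ((S (𝒵.proj z)).2 : ℝ) * (c * g z) =
        c * (𝒵.opLHom (𝒵.fstSection S) g z + ((S (𝒵.proj z)).2 : ℝ) * g z)
      rw [map_smul]
      change (c * _ : ℝ) + _ = _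
      ring)

/-- Evaluation on the constant 1 kills the vector field and isolates the function component; once
these agree, the vector fields agree too. -/
theorem opRHom_injective [IsManifold 𝓘(ℝ, EZ) ∞ Z] : Function.Injective 𝒵.opRHom := by
  intro S T h
  have h0 : ∀ {f : Z → ℝ}, ContMDiff 𝓘(ℝ, EZ) 𝓘(ℝ, ℝ) ∞ f → ∀ z,
      𝒵.opL (𝒵.fstSection S) f z + ((S (𝒵.proj z)).2 : ℝ) * f z =
        𝒵.opL (𝒵.fstSection T) f z + ((T (𝒵.proj z)).2 : ℝ) * f z := fun {f} hf z =>
    DFunLike.congr_fun (LinearMap.congr_fun h ⟨f, hf⟩) z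
  have h1 : ∀ z, ((S (𝒵.proj z)).2 : ℝ) = (T (𝒵.proj z)).2 := fun z => by
    have := h0 (contMDiff_const (c := (1 : ℝ))) z
    rwa [opL_const, opL_const, zero_add, zero_add, mul_one, mul_one] at this
  have h2 : 𝒵.fstSection S = 𝒵.fstSection T := 𝒵.opLHom_injective
    (LinearMap.ext fun f => ContMDiffMap.ext fun z => by
      have := h0 f.contMDiff z
      rw [h1] at this
      exact add_right_cancel this)
  ext m : 1
  refine Prod.ext (DFunLike.congr_fun h2 m) ?_
  obtain ⟨⟨z, rfl⟩⟩ := (inferInstance : Nonempty (𝒵.Fiber m))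
  exact h1 z

/-- [X + h, Y + k] = [X, Y] + (X(k) − Y(h)). Both the slope and the function component thus satisfy
the identity that makes a 1-form closed, which is later applied to their difference. -/
theorem exists_opR_commutator [IsManifold 𝓘(ℝ, EZ) ∞ Z] (σ : 𝒵.Sec)
    (S T : Cₛ^∞⟮𝓘(ℝ, E); (E × (ℝ × ℝ)) × ℝ, 𝒵.RBundle⟯) :
    ∃ R : Cₛ^∞⟮𝓘(ℝ, E); (E × (ℝ × ℝ)) × ℝ, 𝒵.RBundle⟯, (∀ f : Z → ℝ,
      ContMDiff 𝓘(ℝ, EZ) 𝓘(ℝ, ℝ) ∞ f → ∀ z, 𝒵.opR R f z =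
        𝒵.opR S (𝒵.opR T f) z - 𝒵.opR T (𝒵.opR S f) z) ∧
      (∀ m, (𝒵.lBreveLin σ m (R m).1).2.1 =
        diffAt E (fun m => (𝒵.lBreveLin σ m (T m).1).2.1) m (𝒵.lBreveLin σ m (S m).1).1 -
          diffAt E (fun m => (𝒵.lBreveLin σ m (S m).1).2.1) m (𝒵.lBreveLin σ m (T m).1).1) ∧
      ∀ m, ((R m).2 : ℝ) =
        diffAt E (fun m => ((T m).2 : ℝ)) m (𝒵.lBreveLin σ m (S m).1).1 -
          diffAt E (fun m => ((S m).2 : ℝ)) m (𝒵.lBreveLin σ m (T m).1).1 := by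
  obtain ⟨R, h1, h2⟩ := 𝒵.exists_opL_commutator σ (𝒵.fstSection S) (𝒵.fstSection T)
  have hS := 𝒵.contMDiff_snd_section S
  have hT := 𝒵.contMDiff_snd_section T
  have hr : ContMDiff 𝓘(ℝ, E) 𝓘(ℝ, ℝ) ∞ (fun m =>
      diffAt E (fun m => ((T m).2 : ℝ)) m (𝒵.lBreveLin σ m (S m).1).1 -
        diffAt E (fun m => ((S m).2 : ℝ)) m (𝒵.lBreveLin σ m (T m).1).1) :=
    ContMDiff.sub
      (fun x => contMDiffAt_diffAt_apply hT ((𝒵.contMDiff_coeffs σ (𝒵.fstSection S)).1 x))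
      (fun x => contMDiffAt_diffAt_apply hS ((𝒵.contMDiff_coeffs σ (𝒵.fstSection T)).1 x))
  refine ⟨⟨fun m => (R m, _), fun x => (contMDiffAt_prod_trivial_iff _ x).2
    ⟨R.contMDiff x, hr x⟩⟩, fun f hf z => ?_, h2, fun m => rfl⟩
  -- Of the terms of S(Tf), the sum k X(f) + h Y(f) and the product hk f are symmetric in S and T.
  -- Only X(Y(f)) and X(k) f contribute to the commutator.
  have key : ∀ S T : Cₛ^∞⟮𝓘(ℝ, E); (E × (ℝ × ℝ)) × ℝ, 𝒵.RBundle⟯, 𝒵.opR S (𝒵.opR T f) z =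
      (𝒵.opL (𝒵.fstSection S) (𝒵.opL (𝒵.fstSection T) f) z +
        (((T (𝒵.proj z)).2 : ℝ) * 𝒵.opL (𝒵.fstSection S) f z +
          diffAt E (fun m => ((T m).2 : ℝ)) (𝒵.proj z)
            (𝒵.lBreveLin σ _ (S (𝒵.proj z)).1).1 * f z)) +
      ((S (𝒵.proj z)).2 : ℝ) * (𝒵.opL (𝒵.fstSection T) f z + ((T (𝒵.proj z)).2 : ℝ) * f z) := by
    intro S T
    have hT := 𝒵.contMDiff_snd_section T
    have hTf : ContMDiff 𝓘(ℝ, EZ) 𝓘(ℝ, ℝ) ∞ (fun z => ((T (𝒵.proj z)).2 : ℝ) * f z) :=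
      (hT.comp 𝒵.contMDiff_proj).mul hf
    rw [opR_eq, opR_eq]
    simp only
    rw [𝒵.opL_add _ (𝒵.contMDiff_opL _ hf) hTf]
    congr 2
    exact 𝒵.opL_comp_proj_mul σ _ hT hf z
  rw [key, key]
  change 𝒵.opL R f z + (diffAt E (fun m => ((T m).2 : ℝ)) (𝒵.proj z)
    (𝒵.lBreveLin σ _ (S (𝒵.proj z)).1).1 - diffAt E (fun m => ((S m).2 : ℝ)) (𝒵.proj z)
    (𝒵.lBreveLin σ _ (T (𝒵.proj z)).1).1) * f z = _
  rw [h1 f hf]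
  ring

/-- The commutators of operators make `RZ` into a Lie algebroid. -/
theorem exists_lieAlgebroid_rBundle [IsManifold 𝓘(ℝ, EZ) ∞ Z] (σ : 𝒵.Sec) :
    ∃ L : LieAlgebroid E ((E × (ℝ × ℝ)) × ℝ) 𝒵.RBundle,
      (∀ (S T : Cₛ^∞⟮𝓘(ℝ, E); (E × (ℝ × ℝ)) × ℝ, 𝒵.RBundle⟯) (f : Z → ℝ),
        ContMDiff 𝓘(ℝ, EZ) 𝓘(ℝ, ℝ) ∞ f → ∀ z : Z, 𝒵.opR (L.bracket S T) f z =
          𝒵.opR S (𝒵.opR T f) z - 𝒵.opR T (𝒵.opR S f) z) ∧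
      (∀ (m : M) (P : 𝒵.RBundle m) (z : 𝒵.Fiber m),
        L.anchor m P = 𝒵.dProj z (P.1.field z)) ∧
      (∀ S T m, (𝒵.lBreveLin σ m (L.bracket S T m).1).2.1 =
        diffAt E (fun m => (𝒵.lBreveLin σ m (T m).1).2.1) m (L.anchor m (S m)) -
          diffAt E (fun m => (𝒵.lBreveLin σ m (S m).1).2.1) m (L.anchor m (T m))) ∧
      ∀ S T m, ((L.bracket S T m).2 : ℝ) =
        diffAt E (fun m => ((T m).2 : ℝ)) m (L.anchor m (S m)) -
          diffAt E (fun m => ((S m).2 : ℝ)) m (L.anchor m (T m)) := by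
  have hR : ∀ {S T R : Cₛ^∞⟮𝓘(ℝ, E); (E × (ℝ × ℝ)) × ℝ, 𝒵.RBundle⟯}, (∀ f : Z → ℝ,
      ContMDiff 𝓘(ℝ, EZ) 𝓘(ℝ, ℝ) ∞ f → ∀ z, 𝒵.opR R f z =
        𝒵.opR S (𝒵.opR T f) z - 𝒵.opR T (𝒵.opR S f) z) →
      𝒵.opRHom R = 𝒵.opRHom S * 𝒵.opRHom T - 𝒵.opRHom T * 𝒵.opRHom S := fun h =>
    LinearMap.ext fun g => ContMDiffMap.ext fun z => h g g.contMDiff z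
  let ρ : ∀ m : M, 𝒵.RBundle m →ₗ[ℝ] TangentSpace 𝓘(ℝ, E) m := fun m =>
    (𝒵.lBreveAnchor σ m).comp (LinearMap.fst ℝ (𝒵.LBreve m) ℝ)
  have hρ : ContMDiff (𝓘(ℝ, E).prod 𝓘(ℝ, (E × (ℝ × ℝ)) × ℝ)) 𝓘(ℝ, E).tangent ∞
      (fun q : TotalSpace ((E × (ℝ × ℝ)) × ℝ) 𝒵.RBundle =>
        (⟨q.1, ρ q.1 q.2⟩ : TangentBundle 𝓘(ℝ, E) M)) :=
    (𝒵.contMDiff_lBreveAnchor σ).comp fun x =>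
      ((contMDiffAt_prod_trivial_iff id x).1 contMDiffAt_id).1
  obtain ⟨L, hL, hb⟩ := exists_lieAlgebroid_of_operators 𝒵.proj 𝒵.contMDiff_proj 𝒵.opRHom
    𝒵.opRHom_injective (fun S T => (𝒵.exists_opR_commutator σ S T).imp fun R h => hR h.1) ρ hρ
    (fun f hf S g z => by
      change 𝒵.opL (smulSection f hf (𝒵.fstSection S)) g z +
        (f (𝒵.proj z) * (S (𝒵.proj z)).2 : ℝ) * g z =
        f (𝒵.proj z) * (𝒵.opL (𝒵.fstSection S) g z + ((S (𝒵.proj z)).2 : ℝ) * g z)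
      rw [opL_smulSection]
      ring)
    (fun S f hf g z => by
      change 𝒵.opL (𝒵.fstSection S) (fun z => f (𝒵.proj z) * g z) z +
        ((S (𝒵.proj z)).2 : ℝ) * (f (𝒵.proj z) * g z) =
        f (𝒵.proj z) * (𝒵.opL (𝒵.fstSection S) g z + ((S (𝒵.proj z)).2 : ℝ) * g z) +
          diffAt E f (𝒵.proj z) (𝒵.lBreveLin σ _ (𝒵.fstSection S (𝒵.proj z))).1 * g z
      rw [𝒵.opL_comp_proj_mul σ _ hf g.contMDiff]
      ring)
  refine ⟨L, fun S T f hf z => ?_, fun m P z => ?_, fun S T m => ?_, fun S T m => ?_⟩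
  · exact DFunLike.congr_fun (LinearMap.congr_fun (hb S T) ⟨f, hf⟩) z
  · rw [hL]
    exact (𝒵.field_spec σ P.1 z).1.symm
  · obtain ⟨R, h1, h2, -⟩ := 𝒵.exists_opR_commutator σ S T
    rw [𝒵.opRHom_injective ((hb S T).trans (hR h1).symm), h2, hL]
    rfl
  · obtain ⟨R, h1, -, h2⟩ := 𝒵.exists_opR_commutator σ S T
    rw [𝒵.opRHom_injective ((hb S T).trans (hR h1).symm), h2, hL]
    rfl

end AVBundle

/-! ### Affine embeddings with prescribed linear part, and elements of L̆Z with prescribed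
coordinates -/

/-- The affine map with linear part `J` and value `k` at `c`. -/
def AffineMap.ofLinear {V A K : Type*} [AddCommGroup V] [Module ℝ V] [AddTorsor V A]
    [AddCommGroup K] [Module ℝ K] (J : V →ₗ[ℝ] K) (c : A) (k : K) : A →ᵃ[ℝ] K where
  toFun a := J (a -ᵥ c) + k
  linear := J
  map_vadd' a v := by rw [vadd_vsub_assoc, map_add, vadd_eq_add, add_assoc]

theorem AffineMap.ofLinear_injective {V A K : Type*} [AddCommGroup V] [Module ℝ V] [AddTorsor V A]
    [AddCommGroup K] [Module ℝ K] {J : V →ₗ[ℝ] K} (hJ : Function.Injective J) (c : A) (k : K) :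
    Function.Injective (AffineMap.ofLinear J c k) := fun _ _ h =>
  vsub_left_injective c (hJ (add_right_cancel h))

/-- The level set φ = 1 is the translate of the kernel of φ by any vector k with φ(k) = 1. -/
theorem AffineMap.range_ofLinear {V A K : Type*} [AddCommGroup V] [Module ℝ V] [AddTorsor V A]
    [AddCommGroup K] [Module ℝ K] {J : V →ₗ[ℝ] K} {φ : K →ₗ[ℝ] ℝ}
    (hJ : LinearMap.range J = LinearMap.ker φ) (c : A) {k : K} (hk : φ k = 1) :
    Set.range (AffineMap.ofLinear J c k) = {x | φ x = 1} := by
  ext x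
  constructor
  · rintro ⟨a, rfl⟩
    have h : J (a -ᵥ c) ∈ LinearMap.ker φ := hJ ▸ LinearMap.mem_range_self J _
    change φ (J (a -ᵥ c) + k) = 1
    rw [map_add, LinearMap.mem_ker.1 h, hk, zero_add]
  · intro hx
    have h : x - k ∈ LinearMap.range J := by
      rw [hJ, LinearMap.mem_ker, map_sub, hk, show φ x = 1 from hx, sub_self]
    obtain ⟨v, hv⟩ := h
    refine ⟨v +ᵥ c, ?_⟩
    change J ((v +ᵥ c) -ᵥ c) + k = x
    rw [vadd_vsub, hv, sub_add_cancel]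

namespace AVBundle

variable {E M EZ Z : Type*}
  [NormedAddCommGroup E] [NormedSpace ℝ E] [TopologicalSpace M] [ChartedSpace E M]
  [NormedAddCommGroup EZ] [NormedSpace ℝ EZ] [TopologicalSpace Z] [ChartedSpace EZ Z]
  [AddAction ℝ Z] (𝒵 : AVBundle E M EZ Z)

/-- F_τ − F_σ is the basic function τ − σ, so changing the section adds only the derivative of τ − σ
along the projection. -/
theorem apply_affFun (σ τ : 𝒵.Sec) {m : M} (X : 𝒵.LBreve m) (z : 𝒵.Fiber m) :
    X.apply (𝒵.affFun τ) z = (z -ᵥ σ m) * (𝒵.lBreveLin σ m X).2.1 + (𝒵.lBreveLin σ m X).2.2 +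
      𝒵.dSub τ σ m (𝒵.lBreveLin σ m X).1 := by
  obtain ⟨h1, h2⟩ := 𝒵.field_spec σ X z
  rw [← h2, ← h1]
  exact 𝒵.dAff_sub σ τ z _

/-- The element of `L̆Z` with the given coordinates. -/
def ofCoeffs (σ : 𝒵.Sec) (m : M) : TangentSpace 𝓘(ℝ, E) m × (ℝ × ℝ) →ₗ[ℝ] 𝒵.LBreve m :=
  (𝒵.lBreveEquiv σ m).symm

theorem lBreveLin_ofCoeffs (σ : 𝒵.Sec) (m : M) (q : TangentSpace 𝓘(ℝ, E) m × (ℝ × ℝ)) :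
    𝒵.lBreveLin σ m (𝒵.ofCoeffs σ m q) = q := (𝒵.lBreveEquiv σ m).apply_symm_apply q

theorem ofCoeffs_lBreveLin (σ : 𝒵.Sec) (m : M) (X : 𝒵.LBreve m) :
    𝒵.ofCoeffs σ m (𝒵.lBreveLin σ m X) = X := (𝒵.lBreveEquiv σ m).symm_apply_apply X

variable [FiniteDimensional ℝ E] [IsManifold 𝓘(ℝ, E) ∞ M] [T2Space M] [SigmaCompactSpace M]

theorem contMDiff_ofCoeffs_const (σ : 𝒵.Sec) (w : ℝ × ℝ) :
    ContMDiff 𝓘(ℝ, E) (𝓘(ℝ, E).prod 𝓘(ℝ, E × (ℝ × ℝ))) ∞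
      (fun m => TotalSpace.mk' (E × (ℝ × ℝ)) m (𝒵.ofCoeffs σ m (0, w))) := fun x => by
  refine (𝒵.contMDiffAt_lBreve_iff σ _ x).2 ?_
  simp only [lBreveLin_ofCoeffs]
  exact ⟨Bundle.contMDiff_zeroSection ℝ (TangentSpace 𝓘(ℝ, E) (M := M)) x, contMDiffAt_const⟩


/-! ### The embedding of T̄Z into L̆Z and its affgebroid structure -/

section TBar

/-- The linear part of the embedding of `T̄Z` into `L̆Z`. -/
def tBarLin (σ : 𝒵.Sec) (m : M) : 𝒵.PhaseDual m →ₗ[ℝ] 𝒵.LBreve m :=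
  (𝒵.ofCoeffs σ m).comp ((LinearMap.id.prodMap (LinearMap.inr ℝ ℝ ℝ)).comp
    (𝒵.phaseDualCharts.chart σ m).toLinearMap)

theorem lBreveLin_tBarLin (σ : 𝒵.Sec) (m : M) (X : 𝒵.PhaseDual m) :
    𝒵.lBreveLin σ m (𝒵.tBarLin σ m X) =
      (tangentOfFunctional m X.linear, (0, X (σ.phase m))) :=
  𝒵.lBreveLin_ofCoeffs σ m _

/-- The embedding of `T̄Z` into `L̆Z`. -/
def tBarEmb (σ : 𝒵.Sec) (m : M) : 𝒵.TBar m →ᵃ[ℝ] 𝒵.LBreve m :=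
  -- The constant derivation τ ↦ σ goes to the field F_σ X_Z: it is vertical, and F_σ X_Z(F_τ) = F_σ
  -- for every τ. Its coordinates are (0, −1, 0), because F_σ = −t.
  AffineMap.ofLinear (𝒵.tBarLin σ m) (AffineMap.const ℝ (𝒵.Phase m) (σ m))
    (𝒵.ofCoeffs σ m (0, (-1, 0)))

theorem lBreveLin_tBarEmb (σ : 𝒵.Sec) (m : M) (D : 𝒵.TBar m) :
    𝒵.lBreveLin σ m (𝒵.tBarEmb σ m D) =
      (tangentOfFunctional m D.linear, (-1, D (σ.phase m) -ᵥ σ m)) := by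
  change 𝒵.lBreveLin σ m (𝒵.tBarLin σ m (D -ᵥ AffineMap.const ℝ (𝒵.Phase m) (σ m)) +
    𝒵.ofCoeffs σ m (0, (-1, 0))) = _
  rw [map_add, lBreveLin_tBarLin, lBreveLin_ofCoeffs, AffineMap.vsub_linear,
    AffineMap.const_linear, sub_zero]
  simp

/-- The affine map D changes by its linear part on d(τ − σ), exactly the change of F_σ into F_τ
along u. As τ is arbitrary, the auxiliary section σ does not affect the embedding. -/
theorem tBarEmb_apply_affFun (σ : 𝒵.Sec) (m : M) (D : 𝒵.TBar m) (τ : 𝒵.Sec) (z : 𝒵.Fiber m) :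
    (𝒵.tBarEmb σ m D).apply (𝒵.affFun τ) z = D (τ.phase m) -ᵥ z := by
  have h : D.linear (𝒵.dSub τ σ m) = D (τ.phase m) -ᵥ D (σ.phase m) :=
    D.linearMap_vsub (τ.phase m) (σ.phase m)
  rw [𝒵.apply_affFun σ, lBreveLin_tBarEmb]
  simp only
  rw [apply_tangentOfFunctional, h, ← vsub_sub_vsub_cancel_right (D (τ.phase m)) z (σ m),
    ← vsub_sub_vsub_cancel_right (D (τ.phase m)) (D (σ.phase m)) (σ m)]
  ring

theorem tBarLin_apply_affFun (σ : 𝒵.Sec) (m : M) (X : 𝒵.PhaseDual m) (τ : 𝒵.Sec)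
    (z : 𝒵.Fiber m) : (𝒵.tBarLin σ m X).apply (𝒵.affFun τ) z = X (τ.phase m) := by
  have h : X.linear (𝒵.dSub τ σ m) = X (τ.phase m) - X (σ.phase m) :=
    X.linearMap_vsub (τ.phase m) (σ.phase m)
  rw [𝒵.apply_affFun σ, lBreveLin_tBarLin]
  simp only
  rw [apply_tangentOfFunctional, h]
  ring

theorem contMDiffAt_phaseDual_iff (σ : 𝒵.Sec) {EN HN N : Type*} [NormedAddCommGroup EN]
    [NormedSpace ℝ EN] [TopologicalSpace HN] {I : ModelWithCorners ℝ EN HN} [TopologicalSpace N]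
    [ChartedSpace HN N] (f : N → TotalSpace (E × ℝ) 𝒵.PhaseDual) (x : N) :
    ContMDiffAt I (𝓘(ℝ, E).prod 𝓘(ℝ, E × ℝ)) ∞ f x ↔
      ContMDiffAt I 𝓘(ℝ, E).tangent ∞ (fun y =>
        (⟨(f y).1, tangentOfFunctional _ (f y).2.linear⟩ : TangentBundle 𝓘(ℝ, E) M)) x ∧
      ContMDiffAt I 𝓘(ℝ, ℝ) ∞ (fun y => (f y).2 (σ.phase (f y).1)) x :=
  𝒵.phaseDualCharts.contMDiffAt_iff σ f x

/-- In the charts given by σ the linear part is the inclusion (u, b) ↦ (u, 0, b). One direction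
yields smoothness of the embedding, the other the lifting of smooth sections. -/
theorem contMDiffAt_tBarLin_iff (σ : 𝒵.Sec) {EN HN N : Type*} [NormedAddCommGroup EN]
    [NormedSpace ℝ EN] [TopologicalSpace HN] {I : ModelWithCorners ℝ EN HN} [TopologicalSpace N]
    [ChartedSpace HN N] (f : N → TotalSpace (E × ℝ) 𝒵.PhaseDual) (x : N) :
    ContMDiffAt I (𝓘(ℝ, E).prod 𝓘(ℝ, E × (ℝ × ℝ))) ∞
      (fun y => TotalSpace.mk' (E × (ℝ × ℝ)) (f y).1 (𝒵.tBarLin σ _ (f y).2)) x ↔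
    ContMDiffAt I (𝓘(ℝ, E).prod 𝓘(ℝ, E × ℝ)) ∞ f x := by
  rw [𝒵.contMDiffAt_lBreve_iff σ, 𝒵.contMDiffAt_phaseDual_iff σ]
  simp only [lBreveLin_tBarLin]
  refine and_congr_right fun _ => ⟨fun h => ?_, fun h => ?_⟩
  · exact ((contMDiffAt_prod_module_iff _).1 h).2
  · exact (contMDiffAt_prod_module_iff _).2 ⟨contMDiffAt_const, h⟩

/-- The Lie affgebroid structure of `T̄Z`. -/
theorem exists_lieAffgebroid_tBar (σ : 𝒵.Sec) (H : LieAlgebroid E (E × (ℝ × ℝ)) 𝒵.LBreve)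
    (hH : ∀ S T m, (𝒵.lBreveLin σ m (H.bracket S T m)).2.1 =
      diffAt E (fun m => (𝒵.lBreveLin σ m (T m)).2.1) m (H.anchor m (S m)) -
        diffAt E (fun m => (𝒵.lBreveLin σ m (S m)).2.1) m (H.anchor m (T m))) :
    ∃ L : LieAffgebroid 𝒵.tBar.toSmoothAffineBundle, IsLieAlgebroidHull L H (𝒵.tBarEmb σ) := by
  -- Elements j(D) have slope a = −1, so φ = −a. Its closedness is `hH` with the sign changed.
  let φ : ∀ m, 𝒵.LBreve m →ₗ[ℝ] ℝ := fun m =>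
    -((LinearMap.fst ℝ ℝ ℝ).comp ((LinearMap.snd ℝ _ _).comp (𝒵.lBreveLin σ m)))
  have hφ : ∀ m X, φ m X = -(𝒵.lBreveLin σ m X).2.1 := fun _ _ => rfl
  have hlin : ContMDiff (𝓘(ℝ, E).prod 𝓘(ℝ, E × ℝ)) (𝓘(ℝ, E).prod 𝓘(ℝ, E × (ℝ × ℝ))) ∞
      (fun p : TotalSpace (E × ℝ) 𝒵.PhaseDual =>
        TotalSpace.mk' (E × (ℝ × ℝ)) p.1 (𝒵.tBarLin σ p.1 p.2)) := fun x =>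
    (𝒵.contMDiffAt_tBarLin_iff σ id x).2 contMDiffAt_id
  refine exists_lieAffgebroid_of_hyperbundle H (𝒵.tBarEmb σ) φ (fun m => ?_) (fun m => ?_)
    (fun S T m => ?_) hlin ?_ (fun X h x => (𝒵.contMDiffAt_tBarLin_iff σ _ x).1 (h x))
  · refine AffineMap.ofLinear_injective ?_ _ _
    intro X Y h
    have h' := congrArg (𝒵.lBreveLin σ m) h
    rw [lBreveLin_tBarLin, lBreveLin_tBarLin] at h'
    have h1 := congrArg Prod.fst h'
    have h2 := congrArg (fun q => q.2.2) h'
    exact (𝒵.phaseDualCharts.chart σ m).injective (Prod.ext h1 h2)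
  · refine AffineMap.range_ofLinear ?_ _ ?_
    · ext Y
      rw [LinearMap.mem_ker, hφ, neg_eq_zero]
      constructor
      · rintro ⟨X, rfl⟩
        rw [lBreveLin_tBarLin]
      · intro hY
        -- When a = 0, the coordinates u and b alone determine a preimage in the chart.
        refine ⟨(𝒵.phaseDualCharts.chart σ m).symm
          ((𝒵.lBreveLin σ m Y).1, (𝒵.lBreveLin σ m Y).2.2), ?_⟩
        refine Eq.trans ?_ (𝒵.ofCoeffs_lBreveLin σ m Y)
        change 𝒵.ofCoeffs σ m ((LinearMap.id.prodMap (LinearMap.inr ℝ ℝ ℝ))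
          (𝒵.phaseDualCharts.chart σ m ((𝒵.phaseDualCharts.chart σ m).symm _))) = _
        rw [LinearEquiv.apply_symm_apply]
        exact congrArg _ (Prod.ext rfl (Prod.ext hY.symm rfl))
    · rw [hφ, lBreveLin_ofCoeffs, neg_neg]
  · have h : ∀ S : Cₛ^∞⟮𝓘(ℝ, E); E × (ℝ × ℝ), 𝒵.LBreve⟯, diffAt E (fun x => φ x (S x)) m =
        -diffAt E (fun m => (𝒵.lBreveLin σ m (S m)).2.1) m := fun S => mfderiv_neg
    rw [h, h, hφ, hH]
    simp only [neg_apply]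
    ring
  · rintro ⟨_, _⟩ ⟨rfl, τ, rfl⟩
    -- Another constant origin τ is sent to j_v(τ − σ) + j(σ), a sum of two smooth sections.
    have h1 := (hlin.comp (𝒵.contMDiff_constPhase (𝒵.contMDiff_sub τ σ))).add_section
      (𝒵.contMDiff_ofCoeffs_const σ (-1, 0))
    refine (ContMDiff.congr h1 fun m => ?_).contMDiffOn
    exact congrArg (fun X => TotalSpace.mk' (E × (ℝ × ℝ)) m
      (𝒵.tBarLin σ m X + 𝒵.ofCoeffs σ m (0, (-1, 0)))) (AffineMap.ext fun _ => rfl)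

end TBar

/-! ### The embedding of L̄Z into RZ and its affgebroid structure -/

section LBar

/-- The linear part of the embedding of `L̄Z` into `RZ`. -/
def lBarLin (σ : 𝒵.Sec) (m : M) : 𝒵.ContactDual m →ₗ[ℝ] 𝒵.RBundle m :=
  -- The ℝ-component α of the linear part is used twice, as slope a and as function h. In X(F_τ) + h
  -- F_τ the coefficient of t is a − h, and it must vanish for the result to be constant along the
  -- fibre.
  ((𝒵.ofCoeffs σ m).prod ((LinearMap.fst ℝ ℝ ℝ).comp (LinearMap.snd ℝ _ _))).comp
    (𝒵.contactDualCharts.chart σ m).toLinearMap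

theorem lBreveLin_lBarLin (σ : 𝒵.Sec) (m : M) (X : 𝒵.ContactDual m) :
    𝒵.lBreveLin σ m (𝒵.lBarLin σ m X).1 =
      ((contactLinEquiv m X.linear).1, ((contactLinEquiv m X.linear).2, X (σ.contact m))) :=
  𝒵.lBreveLin_ofCoeffs σ m _

theorem lBarLin_snd (σ : 𝒵.Sec) (m : M) (X : 𝒵.ContactDual m) :
    ((𝒵.lBarLin σ m X).2 : ℝ) = (contactLinEquiv m X.linear).2 := rfl

/-- The embedding of `L̄Z` into `RZ`. -/
def lBarEmb (σ : 𝒵.Sec) (m : M) : 𝒵.LBar m →ᵃ[ℝ] 𝒵.RBundle m :=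
  -- The constant operator τ ↦ σ again corresponds to F_σ X_Z, with no function term.
  AffineMap.ofLinear (𝒵.lBarLin σ m) (AffineMap.const ℝ (𝒵.Contact m) (σ m))
    (𝒵.ofCoeffs σ m (0, (-1, 0)), (0 : ℝ))

theorem lBreveLin_lBarEmb (σ : 𝒵.Sec) (m : M) (D : 𝒵.LBar m) :
    𝒵.lBreveLin σ m (𝒵.lBarEmb σ m D).1 = ((contactLinEquiv m D.linear).1,
      ((contactLinEquiv m D.linear).2 - 1, D (σ.contact m) -ᵥ σ m)) := by
  change 𝒵.lBreveLin σ m ((𝒵.lBarLin σ m (D -ᵥ AffineMap.const ℝ (𝒵.Contact m) (σ m))).1 +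
    𝒵.ofCoeffs σ m (0, (-1, 0))) = _
  rw [map_add, lBreveLin_lBarLin, lBreveLin_ofCoeffs, AffineMap.vsub_linear,
    AffineMap.const_linear, sub_zero]
  simp [sub_eq_add_neg]

theorem lBarEmb_snd (σ : 𝒵.Sec) (m : M) (D : 𝒵.LBar m) :
    ((𝒵.lBarEmb σ m D).2 : ℝ) = (contactLinEquiv m D.linear).2 := by
  change ((𝒵.lBarLin σ m (D -ᵥ AffineMap.const ℝ (𝒵.Contact m) (σ m))).2 : ℝ) + 0 = _
  rw [lBarLin_snd, AffineMap.vsub_linear, AffineMap.const_linear, sub_zero, add_zero]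

/-- D(𝐜τ) − D(𝐜σ) has a part d(τ − σ)(u), produced by the vector field, and a part α(τ − σ),
produced by h F_τ with h = α. The slope α − 1 leaves a total coefficient −1 of t, as in D(τ) − z. -/
theorem lBarEmb_apply_affFun (σ : 𝒵.Sec) (m : M) (D : 𝒵.LBar m) (τ : 𝒵.Sec) (z : 𝒵.Fiber m) :
    RBundle.apply (𝒵.lBarEmb σ m D) (𝒵.affFun τ) z = D (τ.contact m) -ᵥ z := by
  have h : D.linear (𝒵.dSub τ σ m, τ m -ᵥ σ m) = D (τ.contact m) -ᵥ D (σ.contact m) :=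
    D.linearMap_vsub (τ.contact m) (σ.contact m)
  rw [← contactLinEquiv_spec] at h
  rw [RBundle.apply, 𝒵.apply_affFun σ, lBreveLin_lBarEmb, lBarEmb_snd, affFun_eq]
  simp only
  rw [← vsub_sub_vsub_cancel_right (τ m) z (σ m),
    ← vsub_sub_vsub_cancel_right (D (τ.contact m)) z (σ m)]
  rw [← vsub_sub_vsub_cancel_right (D (τ.contact m)) (D (σ.contact m)) (σ m)] at h
  linear_combination h

theorem lBarLin_apply_affFun (σ : 𝒵.Sec) (m : M) (X : 𝒵.ContactDual m) (τ : 𝒵.Sec)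
    (z : 𝒵.Fiber m) : RBundle.apply (𝒵.lBarLin σ m X) (𝒵.affFun τ) z = X (τ.contact m) := by
  have h : X.linear (𝒵.dSub τ σ m, τ m -ᵥ σ m) = X (τ.contact m) - X (σ.contact m) :=
    X.linearMap_vsub (τ.contact m) (σ.contact m)
  rw [← contactLinEquiv_spec] at h
  rw [RBundle.apply, 𝒵.apply_affFun σ, lBreveLin_lBarLin, lBarLin_snd, affFun_eq]
  simp only
  rw [← vsub_sub_vsub_cancel_right (τ m) z (σ m)]
  linear_combination h

theorem contMDiffAt_contactDual_iff (σ : 𝒵.Sec) {EN HN N : Type*} [NormedAddCommGroup EN]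
    [NormedSpace ℝ EN] [TopologicalSpace HN] {I : ModelWithCorners ℝ EN HN} [TopologicalSpace N]
    [ChartedSpace HN N] (f : N → TotalSpace (E × (ℝ × ℝ)) 𝒵.ContactDual) (x : N) :
    ContMDiffAt I (𝓘(ℝ, E).prod 𝓘(ℝ, E × (ℝ × ℝ))) ∞ f x ↔
      ContMDiffAt I 𝓘(ℝ, E).tangent ∞ (fun y =>
        (⟨(f y).1, (contactLinEquiv _ (f y).2.linear).1⟩ : TangentBundle 𝓘(ℝ, E) M)) x ∧
      ContMDiffAt I 𝓘(ℝ, ℝ × ℝ) ∞ (fun y =>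
        ((contactLinEquiv _ (f y).2.linear).2, (f y).2 (σ.contact (f y).1))) x :=
  𝒵.contactDualCharts.contMDiffAt_iff σ f x

/-- The L̆Z-coordinates of the image are exactly the chart coordinates of X, and the function
component repeats one of them, so smoothness passes both ways. -/
theorem contMDiffAt_lBarLin_iff (σ : 𝒵.Sec) {EN HN N : Type*} [NormedAddCommGroup EN]
    [NormedSpace ℝ EN] [TopologicalSpace HN] {I : ModelWithCorners ℝ EN HN} [TopologicalSpace N]
    [ChartedSpace HN N] (f : N → TotalSpace (E × (ℝ × ℝ)) 𝒵.ContactDual) (x : N) :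
    ContMDiffAt I (𝓘(ℝ, E).prod 𝓘(ℝ, (E × (ℝ × ℝ)) × ℝ)) ∞ (fun y =>
      (TotalSpace.mk' ((E × (ℝ × ℝ)) × ℝ) (f y).1 (𝒵.lBarLin σ _ (f y).2) :
        TotalSpace ((E × (ℝ × ℝ)) × ℝ) 𝒵.RBundle)) x ↔
    ContMDiffAt I (𝓘(ℝ, E).prod 𝓘(ℝ, E × (ℝ × ℝ))) ∞ f x := by
  rw [contMDiffAt_prod_trivial_iff, 𝒵.contMDiffAt_lBreve_iff σ, 𝒵.contMDiffAt_contactDual_iff σ]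
  simp only [lBreveLin_lBarLin, lBarLin_snd]
  exact ⟨fun h => h.1, fun h => ⟨h, ((contMDiffAt_prod_module_iff _).1 h.2).1⟩⟩

/-- The Lie affgebroid structure of `L̄Z`. -/
theorem exists_lieAffgebroid_lBar (σ : 𝒵.Sec) (H : LieAlgebroid E ((E × (ℝ × ℝ)) × ℝ) 𝒵.RBundle)
    (hH : ∀ S T m, (𝒵.lBreveLin σ m (H.bracket S T m).1).2.1 =
      diffAt E (fun m => (𝒵.lBreveLin σ m (T m).1).2.1) m (H.anchor m (S m)) -
        diffAt E (fun m => (𝒵.lBreveLin σ m (S m).1).2.1) m (H.anchor m (T m)))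
    (hH' : ∀ S T m, ((H.bracket S T m).2 : ℝ) =
      diffAt E (fun m => ((T m).2 : ℝ)) m (H.anchor m (S m)) -
        diffAt E (fun m => ((S m).2 : ℝ)) m (H.anchor m (T m))) :
    ∃ L : LieAffgebroid 𝒵.lBar.toSmoothAffineBundle, IsLieAlgebroidHull L H (𝒵.lBarEmb σ) := by
  -- On j(D) one has h = α and a = α − 1, so h − a = 1; on the linear part h = a. This dictates φ =
  -- h − a.
  let φ : ∀ m, 𝒵.RBundle m →ₗ[ℝ] ℝ := fun m => LinearMap.snd ℝ (𝒵.LBreve m) ℝ -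
    ((LinearMap.fst ℝ ℝ ℝ).comp ((LinearMap.snd ℝ _ _).comp (𝒵.lBreveLin σ m))).comp
      (LinearMap.fst ℝ (𝒵.LBreve m) ℝ)
  have hφ : ∀ m (P : 𝒵.RBundle m), φ m P = (P.2 : ℝ) - (𝒵.lBreveLin σ m P.1).2.1 := fun _ _ => rfl
  have hlin : ContMDiff (𝓘(ℝ, E).prod 𝓘(ℝ, E × (ℝ × ℝ)))
      (𝓘(ℝ, E).prod 𝓘(ℝ, (E × (ℝ × ℝ)) × ℝ)) ∞
      (fun p : TotalSpace (E × (ℝ × ℝ)) 𝒵.ContactDual =>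
        (TotalSpace.mk' ((E × (ℝ × ℝ)) × ℝ) p.1 (𝒵.lBarLin σ p.1 p.2) :
          TotalSpace ((E × (ℝ × ℝ)) × ℝ) 𝒵.RBundle)) := fun x =>
    (𝒵.contMDiffAt_lBarLin_iff σ id x).2 contMDiffAt_id
  refine exists_lieAffgebroid_of_hyperbundle H (𝒵.lBarEmb σ) φ (fun m => ?_) (fun m => ?_)
    (fun S T m => ?_) hlin ?_ (fun X h x => (𝒵.contMDiffAt_lBarLin_iff σ _ x).1 (h x))
  · refine AffineMap.ofLinear_injective ?_ _ _
    intro X Y h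
    have h' := congrArg (fun P : 𝒵.RBundle m => 𝒵.lBreveLin σ m P.1) h
    simp only [lBreveLin_lBarLin] at h'
    exact (𝒵.contactDualCharts.chart σ m).injective h'
  · refine AffineMap.range_ofLinear ?_ _ ?_
    · ext P
      rw [LinearMap.mem_ker, hφ, sub_eq_zero]
      constructor
      · rintro ⟨X, rfl⟩
        rw [lBreveLin_lBarLin, lBarLin_snd]
      · intro hP
        refine ⟨(𝒵.contactDualCharts.chart σ m).symm (𝒵.lBreveLin σ m P.1), ?_⟩
        change (𝒵.ofCoeffs σ m
          (𝒵.contactDualCharts.chart σ m ((𝒵.contactDualCharts.chart σ m).symm _)),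
          (𝒵.contactDualCharts.chart σ m ((𝒵.contactDualCharts.chart σ m).symm _)).2.1) = P
        rw [LinearEquiv.apply_symm_apply, ofCoeffs_lBreveLin]
        exact Prod.ext rfl hP.symm
    · rw [hφ, lBreveLin_ofCoeffs]
      simp
  -- The slope and the function component satisfy the same closedness identity, and it is linear, so
  -- it holds for their difference.
  · have h : ∀ S : Cₛ^∞⟮𝓘(ℝ, E); (E × (ℝ × ℝ)) × ℝ, 𝒵.RBundle⟯,
        diffAt E (fun x => φ x (S x)) m = diffAt E (fun m => ((S m).2 : ℝ)) m -
          diffAt E (fun m => (𝒵.lBreveLin σ m (S m).1).2.1) m := fun S =>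
      diffAt_sub ((𝒵.contMDiff_snd_section S m).mdifferentiableAt (by simp))
        (((𝒵.contMDiff_coeffs σ (𝒵.fstSection S)).2.1 m).mdifferentiableAt (by simp))
    rw [h, h, hφ, hH, hH']
    simp only [sub_apply]
    ring
  · rintro ⟨_, _⟩ ⟨rfl, τ, rfl⟩
    have h0 : ContMDiff 𝓘(ℝ, E) (𝓘(ℝ, E).prod 𝓘(ℝ, (E × (ℝ × ℝ)) × ℝ)) ∞ (fun m =>
        (TotalSpace.mk' ((E × (ℝ × ℝ)) × ℝ) m (𝒵.ofCoeffs σ m (0, (-1, 0)), (0 : ℝ)) :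
          TotalSpace ((E × (ℝ × ℝ)) × ℝ) 𝒵.RBundle)) := fun x =>
      (contMDiffAt_prod_trivial_iff _ x).2
        ⟨𝒵.contMDiff_ofCoeffs_const σ (-1, 0) x, contMDiffAt_const⟩
    have h1 := (hlin.comp (𝒵.contMDiff_constContact (𝒵.contMDiff_sub τ σ))).add_section h0
    refine (ContMDiff.congr h1 fun m => ?_).contMDiffOn
    exact congrArg (fun X => (TotalSpace.mk' ((E × (ℝ × ℝ)) × ℝ) m
      (𝒵.lBarLin σ m X + (𝒵.ofCoeffs σ m (0, (-1, 0)), (0 : ℝ))) :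
        TotalSpace ((E × (ℝ × ℝ)) × ℝ) 𝒵.RBundle)) (AffineMap.ext fun _ => rfl)

end LBar

end AVBundle

/-! ### The affgebroid brackets as commutators of operators on sections -/

namespace AVBundle

variable {E M EZ Z : Type*} [NormedAddCommGroup E] [NormedSpace ℝ E] [FiniteDimensional ℝ E]
  [TopologicalSpace M] [ChartedSpace E M] [IsManifold 𝓘(ℝ, E) ∞ M] [T2Space M] [SigmaCompactSpace M]
  [NormedAddCommGroup EZ] [NormedSpace ℝ EZ] [TopologicalSpace Z] [ChartedSpace EZ Z]
  [AddAction ℝ Z] (𝒵 : AVBundle E M EZ Z)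

theorem opL_eq_apply (S : Cₛ^∞⟮𝓘(ℝ, E); E × (ℝ × ℝ), 𝒵.LBreve⟯) (f : Z → ℝ) {m : M}
    (z : 𝒵.Fiber m) : 𝒵.opL S f z.1 = (S m).apply f z := by
  obtain ⟨z, rfl⟩ := z
  rfl

theorem opR_eq_apply (S : Cₛ^∞⟮𝓘(ℝ, E); (E × (ℝ × ℝ)) × ℝ, 𝒵.RBundle⟯) (f : Z → ℝ) {m : M}
    (z : 𝒵.Fiber m) : 𝒵.opR S f z.1 = RBundle.apply (S m) f z := by
  obtain ⟨z, rfl⟩ := z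
  rfl

/-- The bracket of `T̄Z` is the commutator of affine derivations. -/
theorem tBar_bracket_eq [IsManifold 𝓘(ℝ, EZ) ∞ Z] (σ : 𝒵.Sec) {L : LieAffgebroid 𝒵.tBar.toSmoothAffineBundle}
    {H : LieAlgebroid E (E × (ℝ × ℝ)) 𝒵.LBreve}
    (hH : ∀ (S T : Cₛ^∞⟮𝓘(ℝ, E); E × (ℝ × ℝ), 𝒵.LBreve⟯) (f : Z → ℝ),
      ContMDiff 𝓘(ℝ, EZ) 𝓘(ℝ, ℝ) ∞ f → ∀ z : Z, 𝒵.opL (H.bracket S T) f z =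
        𝒵.opL S (𝒵.opL T f) z - 𝒵.opL T (𝒵.opL S f) z)
    (h : IsLieAlgebroidHull L H (𝒵.tBarEmb σ)) (D D' : 𝒵.tBar.Sec) (τ : 𝒵.Sec) (m : M) :
    L.bracket D D' m (τ.phase m) =
      𝒵.actT D (𝒵.actT D' τ) m -ᵥ 𝒵.actT D' (𝒵.actT D τ) m := by
  obtain ⟨S, hS⟩ := h.exists_section D
  obtain ⟨T, hT⟩ := h.exists_section D'
  have key : ∀ {D : 𝒵.tBar.Sec} {S : Cₛ^∞⟮𝓘(ℝ, E); E × (ℝ × ℝ), 𝒵.LBreve⟯},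
      (∀ m, S m = 𝒵.tBarEmb σ m (D m)) → ∀ τ : 𝒵.Sec,
        𝒵.opL S (𝒵.affFun τ) = 𝒵.affFun (𝒵.actT D τ) := fun {D S} hS τ => funext fun z => by
    rw [opL, hS, tBarEmb_apply_affFun]
    exact (𝒵.affFun_eq (𝒵.actT D τ) (𝒵.toFiber z)).symm
  -- Since j(D) turns F_τ into F_{D(τ)}, the commutator on F_τ is F_{D(D'(τ))} − F_{D'(D(τ))}, in
  -- which the point of the fibre cancels. Evaluating at τ(m) is merely a convenient choice.
  have h1 := hH S T (𝒵.affFun τ) (𝒵.contMDiff_affFun τ) (τ m).1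
  rw [key hS, key hT, key hS, key hT, 𝒵.affFun_eq, 𝒵.affFun_eq, vsub_sub_vsub_cancel_right] at h1
  rw [← h1, ← 𝒵.tBarLin_apply_affFun σ m (L.bracket D D' m) τ (τ m)]
  have h2 := h.bracket_eq D D' S T hS hT m
  have h3 : ((𝒵.tBarEmb σ m).linear (L.bracket D D' m)) = 𝒵.tBarLin σ m (L.bracket D D' m) := rfl
  rw [← h3, ← h2]
  exact (𝒵.opL_eq_apply _ _ (τ m)).symm

/-- The bracket of `L̄Z` is the commutator of affine first-order differential operators. -/
theorem lBar_bracket_eq [IsManifold 𝓘(ℝ, EZ) ∞ Z] (σ : 𝒵.Sec) {L : LieAffgebroid 𝒵.lBar.toSmoothAffineBundle}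
    {H : LieAlgebroid E ((E × (ℝ × ℝ)) × ℝ) 𝒵.RBundle}
    (hH : ∀ (S T : Cₛ^∞⟮𝓘(ℝ, E); (E × (ℝ × ℝ)) × ℝ, 𝒵.RBundle⟯) (f : Z → ℝ),
      ContMDiff 𝓘(ℝ, EZ) 𝓘(ℝ, ℝ) ∞ f → ∀ z : Z, 𝒵.opR (H.bracket S T) f z =
        𝒵.opR S (𝒵.opR T f) z - 𝒵.opR T (𝒵.opR S f) z)
    (h : IsLieAlgebroidHull L H (𝒵.lBarEmb σ)) (D D' : 𝒵.lBar.Sec) (τ : 𝒵.Sec) (m : M) :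
    L.bracket D D' m (τ.contact m) =
      𝒵.actL D (𝒵.actL D' τ) m -ᵥ 𝒵.actL D' (𝒵.actL D τ) m := by
  obtain ⟨S, hS⟩ := h.exists_section D
  obtain ⟨T, hT⟩ := h.exists_section D'
  have key : ∀ {D : 𝒵.lBar.Sec} {S : Cₛ^∞⟮𝓘(ℝ, E); (E × (ℝ × ℝ)) × ℝ, 𝒵.RBundle⟯},
      (∀ m, S m = 𝒵.lBarEmb σ m (D m)) → ∀ τ : 𝒵.Sec,
        𝒵.opR S (𝒵.affFun τ) = 𝒵.affFun (𝒵.actL D τ) := fun {D S} hS τ => funext fun z => by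
    rw [opR, hS, lBarEmb_apply_affFun]
    exact (𝒵.affFun_eq (𝒵.actL D τ) (𝒵.toFiber z)).symm
  -- As for T̄Z, the functions F_τ intertwine the two kinds of operators, and the difference is
  -- independent of the point of the fibre.
  have h1 := hH S T (𝒵.affFun τ) (𝒵.contMDiff_affFun τ) (τ m).1
  rw [key hS, key hT, key hS, key hT, 𝒵.affFun_eq, 𝒵.affFun_eq, vsub_sub_vsub_cancel_right] at h1
  rw [← h1, ← 𝒵.lBarLin_apply_affFun σ m (L.bracket D D' m) τ (τ m)]
  have h2 := h.bracket_eq D D' S T hS hT m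
  have h3 : ((𝒵.lBarEmb σ m).linear (L.bracket D D' m)) = 𝒵.lBarLin σ m (L.bracket D D' m) := rfl
  rw [← h3, ← h2]
  exact (𝒵.opR_eq_apply _ _ (τ m)).symm

end AVBundle

end

theorem mainTheorem9 {E M EZ Z : Type*}
    [NormedAddCommGroup E] [NormedSpace ℝ E] [FiniteDimensional ℝ E]
    [TopologicalSpace M] [ChartedSpace E M] [IsManifold 𝓘(ℝ, E) ∞ M]
    [T2Space M] [SigmaCompactSpace M]
    [NormedAddCommGroup EZ] [NormedSpace ℝ EZ] [TopologicalSpace Z] [ChartedSpace EZ Z]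
    [IsManifold 𝓘(ℝ, EZ) ∞ Z] [AddAction ℝ Z] (𝒵 : AVBundle E M EZ Z) :
    ∃ (LT : LieAffgebroid 𝒵.tBar.toSmoothAffineBundle)
      (LL : LieAffgebroid 𝒵.lBar.toSmoothAffineBundle)
      (KT : LieAlgebroid E (E × (ℝ × ℝ)) 𝒵.LBreve)
      (KR : LieAlgebroid E ((E × (ℝ × ℝ)) × ℝ) 𝒵.RBundle)
      (jT : ∀ m : M, 𝒵.TBar m →ᵃ[ℝ] 𝒵.LBreve m)
      (jL : ∀ m : M, 𝒵.LBar m →ᵃ[ℝ] 𝒵.RBundle m),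
      -- the brackets on the affine bundles are the commutators of the operators on sections
      (∀ (D D' : 𝒵.tBar.Sec) (σ : 𝒵.Sec) (m : M), LT.bracket D D' m (σ.phase m) =
        𝒵.actT D (𝒵.actT D' σ) m -ᵥ 𝒵.actT D' (𝒵.actT D σ) m) ∧
      (∀ (D D' : 𝒵.lBar.Sec) (σ : 𝒵.Sec) (m : M), LL.bracket D D' m (σ.contact m) =
        𝒵.actL D (𝒵.actL D' σ) m -ᵥ 𝒵.actL D' (𝒵.actL D σ) m) ∧
      -- the anchors are the principal symbols
      (∀ (m : M) (D : 𝒵.TBar m) (η : Cotangent E m), η (LT.anchor m D) = D.linear η) ∧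
      (∀ (m : M) (D : 𝒵.LBar m) (η : Cotangent E m), η (LL.anchor m D) = D.linear (η, 0)) ∧
      -- the vector bundles carry the commutator brackets of operators on functions on `Z`
      (∀ (S T : Cₛ^∞⟮𝓘(ℝ, E); E × (ℝ × ℝ), 𝒵.LBreve⟯) (f : Z → ℝ),
        ContMDiff 𝓘(ℝ, EZ) 𝓘(ℝ, ℝ) ∞ f → ∀ z : Z, 𝒵.opL (KT.bracket S T) f z =
          𝒵.opL S (𝒵.opL T f) z - 𝒵.opL T (𝒵.opL S f) z) ∧
      (∀ (S T : Cₛ^∞⟮𝓘(ℝ, E); (E × (ℝ × ℝ)) × ℝ, 𝒵.RBundle⟯) (f : Z → ℝ),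
        ContMDiff 𝓘(ℝ, EZ) 𝓘(ℝ, ℝ) ∞ f → ∀ z : Z, 𝒵.opR (KR.bracket S T) f z =
          𝒵.opR S (𝒵.opR T f) z - 𝒵.opR T (𝒵.opR S f) z) ∧
      (∀ (m : M) (X : 𝒵.LBreve m) (z : 𝒵.Fiber m), KT.anchor m X = 𝒵.dProj z (X.field z)) ∧
      (∀ (m : M) (P : 𝒵.RBundle m) (z : 𝒵.Fiber m),
        KR.anchor m P = 𝒵.dProj z (P.1.field z)) ∧
      -- the canonical embeddings, determined by `D(F_σ) = F_{D(σ)}`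
      (∀ (m : M) (D : 𝒵.TBar m) (σ : 𝒵.Sec) (z : 𝒵.Fiber m),
        (jT m D).apply (𝒵.affFun σ) z = D (σ.phase m) -ᵥ z) ∧
      (∀ (m : M) (D : 𝒵.LBar m) (σ : 𝒵.Sec) (z : 𝒵.Fiber m),
        AVBundle.RBundle.apply (jL m D) (𝒵.affFun σ) z = D (σ.contact m) -ᵥ z) ∧
      -- the vector bundles are the Lie algebroid hulls
      IsLieAlgebroidHull LT KT jT ∧ IsLieAlgebroidHull LL KR jL := by
  let σ : 𝒵.Sec := Classical.arbitrary 𝒵.Sec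
  obtain ⟨KT, hKT, haT, hcT⟩ := 𝒵.exists_lieAlgebroid_lBreve σ
  obtain ⟨KR, hKR, haR, hcR, hcR'⟩ := 𝒵.exists_lieAlgebroid_rBundle σ
  obtain ⟨LT, hT⟩ := 𝒵.exists_lieAffgebroid_tBar σ KT hcT
  obtain ⟨LL, hL⟩ := 𝒵.exists_lieAffgebroid_lBar σ KR hcR hcR'
  refine ⟨LT, LL, KT, KR, 𝒵.tBarEmb σ, 𝒵.lBarEmb σ,
    fun D D' τ m => 𝒵.tBar_bracket_eq σ hKT hT D D' τ m,
    fun D D' τ m => 𝒵.lBar_bracket_eq σ hKR hL D D' τ m, fun m D η => ?_, fun m D η => ?_,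
    hKT, hKR, haT, haR, 𝒵.tBarEmb_apply_affFun σ, 𝒵.lBarEmb_apply_affFun σ, hT, hL⟩
  -- The anchor of the hull is the coordinate u, and for j(D) it is the tangent vector representing
  -- the linear part of D.
  · rw [← hT.anchor_eq, haT m _ (σ m), (𝒵.field_spec σ _ (σ m)).1, AVBundle.lBreveLin_tBarEmb]
    exact AVBundle.apply_tangentOfFunctional m D.linear η
  -- The linear part of D is η(u) + rα; setting r = 0 leaves the principal symbol.
  · rw [← hL.anchor_eq, haR m _ (σ m), (𝒵.field_spec σ _ (σ m)).1, AVBundle.lBreveLin_lBarEmb,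
      ← AVBundle.contactLinEquiv_spec m D.linear η 0, zero_mul, add_zero]
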